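/- Let $M$ be a smooth manifold of dimension $n\ge 3$ with a conformal structure $[g]$ of arbitrary signature, and let $1\le k\le n-1$. Write $\mathcal E^k[w]$ for the smooth $k$-forms of conformal weight $w$: a section assigns to every metric $g$ in the conformal class a smooth $k$-form, and the form assigned to $e^{2\Upsilon}g$ is $e^{w\Upsilon}$ times the one assigned to $g$. Fix a metric $g$ in the conformal class, use it to identify weighted forms with forms and to raise and lower indices, and let $\nabla$ be its Levi-Civita connection. Conventions. The curvature is $[\nabla_a,\nabla_b]v^c=R_{ab}{}^c{}_dv^d$, with $\mathrm{Ric}_{ab}=R_{ca}{}^c{}_b=(n-2)P_{ab}+Jg_{ab}$ and $J=P_a{}^a$, where $P$ is the Schouten tensor. The Weyl tensor $C$ is given by $R_{abcd}=C_{abcd}+2g_{c[a}P_{b]d}+2g_{d[b}P_{a]c}$, and the Cotton tensor is $A_{abc}=2\nabla_{[b}P_{c]a}$. Indices $a^0,a^1,a^2,\dots$ with sequential superscripts are always skewed over (with total weight one). Write $\mathbf a=a^1\cdots a^k$, $\dot{\mathbf a}=a^2\cdots a^k$, $\ddot{\mathbf a}=a^3\cdots a^k$, $\dddot{\mathbf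 a}=a^4\cdots a^k$. For $T_{c\mathbf a}$ skew in $\mathbf a$, let $$T_{\{c\mathbf a\}_0}=T_{c\mathbf a}-T_{[c\mathbf a]}-\tfrac{k}{n-k+1}\,g_{ca^1}T^p{}_{p\dot{\mathbf a}}$$ be its projection to the part that is trace-free and vanishes under skewing over all of $c,a^1,\dots,a^k$. For a $k$-form $f$ with $k\ge 2$ put $$(C\blacklozenge f)_{c\dot{\mathbf a}}=\tfrac{k-2}{k}\left(C_{ca^2}{}^{pq}f_{pq\ddot{\mathbf a}}+C_{a^3a^2}{}^{pq}f_{pqc\dddot{\mathbf a}}\right),$$ which is zero for $k=2$. Proposition. Solutions $\sigma\in\mathcal E^k[k+1]$ of the conformal Killing equation $\nabla_{\{c}\sigma_{\mathbf a\}_0}=0$ are in one-to-one correspondence with solutions $(\sigma,\mu,\nu,\rho)$, where $\sigma\in\mathcal E^k[k+1]$, $\mu\in\mathcal E^{k+1}[k+1]$, $\nu\in\mathcal E^{k-1}[k-1]$ and $\rho\in\mathcal E^k[k-1]$, of the system $$\nabla_c\sigma_{\mathbf a}=\mu_{c\mathbf a}+g_{ca^1}\nu_{\dot{\mathbf a}};$$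 $$\nabla_c\mu_{a^0\mathbf a}=(k+1)\left[g_{ca^0}\rho_{\mathbf a}-P_{ca^0}\sigma_{\mathbf a}-\tfrac12C_{a^0a^1c}{}^p\sigma_{p\dot{\mathbf a}}\right];$$ $$\nabla_c\nu_{\dot{\mathbf a}}=-k\left[\rho_{c\dot{\mathbf a}}+P_c{}^p\sigma_{p\dot{\mathbf a}}\right]+\tfrac{k(k-1)}{2(n-k)}(C\blacklozenge\sigma)_{c\dot{\mathbf a}}$$ (the last term being absent for $k=1$); $$\nabla_c\rho_{\mathbf a}=P_{ca^1}\nu_{\dot{\mathbf a}}-P_c{}^p\mu_{p\mathbf a}+\tfrac12A^p{}_{a^1a^2}\sigma_{pc\ddot{\mathbf a}}-A^p{}_{ca^1}\sigma_{p\dot{\mathbf a}}+\tfrac12C_{a^1a^2c}{}^p\nu_{p\ddot{\mathbf a}}-\tfrac{k}{2(n-k)}\nabla_{a^1}(C\blacklozenge\sigma)_{c\dot{\mathbf a}}\quad\text{for }k\ge2;$$ $$\nabla_c\rho_{a^1}=P_{ca^1}\nu-P_c{}^p\mu_{pa^1}+A_{a^1pc}\sigma^p\quad\text{for }k=1.$$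 The bijection sends a solution $\sigma$ of the conformal Killing equation to $$\Bigl(\sigma_{\mathbf a},\ \nabla_{a^0}\sigma_{\mathbf a},\ \tfrac{k}{n-k+1}\nabla^p\sigma_{p\dot{\mathbf a}},\ \tfrac1{nk}\nabla^p\nabla_{\{p}\sigma_{\mathbf a\}_0}-\tfrac1{n-k+1}\nabla_{a^1}\nabla^p\sigma_{p\dot{\mathbf a}}-P_{a^1}{}^p\sigma_{p\dot{\mathbf a}}\Bigr).$$ -/

import Mathlib

open scoped Manifold ContDiff

noncomputable section

namespace ConformalKilling

/-! ## Index arrays -/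

/-- The coordinate space `ℝⁿ`. -/
abbrev Coord (n : ℕ) := EuclideanSpace ℝ (Fin n)

/-- The `i`-th standard basis vector of `ℝⁿ`. -/
def stdVec {n : ℕ} (i : Fin n) : Coord n := EuclideanSpace.single i (1 : ℝ)

/-- Components `T_{i₁ … i_r}` of a covariant tensor of rank `r` in a basis. -/
abbrev Tensor (n r : ℕ) := (Fin r → Fin n) → ℝ

/-- Complete skew-symmetrisation `T_{[i₁ … i_r]}`, with the factor `1 / r!`. -/
def skew {n r : ℕ} (T : Tensor n r) : Tensor n r := fun i =>
  ((Nat.factorial r : ℕ) : ℝ)⁻¹ *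
    ∑ π : Equiv.Perm (Fin r), ((Equiv.Perm.sign π : ℤ) : ℝ) * T (fun s => i (π s))

/-- The index list `p i₁ … i_r`. -/
abbrev cons {n r : ℕ} (p : Fin n) (i : Fin r → Fin n) : Fin (r + 1) → Fin n :=
  Matrix.vecCons p i

/-- The index list `i₂ … i_r` obtained by dropping the first index. -/
abbrev tl {n r : ℕ} (i : Fin (r + 1) → Fin n) : Fin r → Fin n := Matrix.vecTail i

/-- A rank two array as a matrix. -/
def toMatrix {n : ℕ} (G : Tensor n 2) : Matrix (Fin n) (Fin n) ℝ :=
  Matrix.of fun a b => G ![a, b]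

/-! ## Levi-Civita calculus in coordinates -/

/-- The partial derivative `∂_a f` at `u`. -/
def pd {n : ℕ} (a : Fin n) (f : Coord n → ℝ) (u : Coord n) : ℝ := fderiv ℝ f u (stdVec a)

/-- The Christoffel symbol `Γ^c_{ab}` at `u` of the metric with components `G`. -/
def christoffel {n : ℕ} (G : Coord n → Tensor n 2) (u : Coord n) (a b c : Fin n) : ℝ :=
  (1 / 2) * ∑ d, (toMatrix (G u))⁻¹ c d *
    (pd a (fun v => G v ![b, d]) u + pd b (fun v => G v ![a, d]) u
      - pd d (fun v => G v ![a, b]) u)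

/-- The Levi-Civita covariant derivative in coordinates,
`∇_c T_{i₁ … i_r} = ∂_c T_{i₁ … i_r} - ∑ₛ Γ^p_{c iₛ} T_{i₁ … p … i_r}`.
The derivative index comes first. -/
def coordNabla {n r : ℕ} (G : Coord n → Tensor n 2) (T : Coord n → Tensor n r)
    (u : Coord n) : Tensor n (r + 1) := fun i =>
  pd (i 0) (fun v => T v (tl i)) u
    - ∑ s : Fin r, ∑ p, christoffel G u (i 0) (tl i s) p * T u (Function.update (tl i) s p)

/-- The Riemann curvature `R_{ab}{}^c{}_d` in coordinates, with the convention
`[∇_a, ∇_b] v^c = R_{ab}{}^c{}_d v^d`. -/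
def coordRiemann {n : ℕ} (G : Coord n → Tensor n 2) (u : Coord n) (a b c d : Fin n) : ℝ :=
  pd a (fun v => christoffel G v b d c) u - pd b (fun v => christoffel G v a d c) u
    + ∑ e, (christoffel G u a e c * christoffel G u b d e
      - christoffel G u b e c * christoffel G u a d e)

/-! ## Tensor fields, forms and metrics on a manifold -/

section Manifold

variable {n : ℕ} {M : Type*} [TopologicalSpace M] [ChartedSpace (Coord n) M]

/-- The standard basis of `TangentSpace (𝓡 n) x`, which is the coordinate basis at `x` of the
preferred chart `chartAt _ x`. -/
def tangentVec (x : M) (i : Fin n) : TangentSpace (𝓡 n) x := (stdVec i : Coord n)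

/-- A covariant tensor field of rank `r`, recorded at each `x` by its components with respect to
the basis `tangentVec x` of the tangent space at `x`. -/
abbrev TensorField (n : ℕ) (M : Type*) (r : ℕ) := M → Tensor n r

/-- A (not necessarily smooth) differential `k`-form on `M`. -/
abbrev FormField (n : ℕ) (M : Type*) [TopologicalSpace M] [ChartedSpace (Coord n) M] (k : ℕ) :=
  (x : M) → (TangentSpace (𝓡 n) x) [⋀^Fin k]→ₗ[ℝ] ℝ

/-- The components `η_{i₁ … i_k}` of a form. -/
def FormField.comp {k : ℕ} (η : FormField n M k) : TensorField n M k :=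
  fun x i => η x (fun s => tangentVec x (i s))

variable [IsManifold (𝓡 n) ∞ M]

/-- The components of a tensor field in the chart `chartAt _ x₀`, as functions on the target of
that chart, by the usual transformation law; the Jacobian matrix involved is the one of the change
from the coordinates of the chart at `x₀` to those of the chart at the point. -/
def inChart {r : ℕ} (x₀ : M) (T : TensorField n M r) (u : Coord n) : Tensor n r := fun i =>
  ∑ j : Fin r → Fin n, T ((extChartAt (𝓡 n) x₀).symm u) j *
    ∏ s, (tangentCoordChange (𝓡 n) x₀ ((extChartAt (𝓡 n) x₀).symm u)
      ((extChartAt (𝓡 n) x₀).symm u) (stdVec (i s)) : Coord n) (j s)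

/-- A tensor field is smooth if its components in charts are. -/
def IsSmooth {r : ℕ} (T : TensorField n M r) : Prop :=
  ∀ (x₀ : M) (i : Fin r → Fin n),
    ContDiffOn ℝ ∞ (fun u => inChart x₀ T u i) (extChartAt (𝓡 n) x₀).target

/-- A smooth pseudo-Riemannian metric, of arbitrary signature. -/
structure Metric (n : ℕ) (M : Type*) [TopologicalSpace M] [ChartedSpace (Coord n) M]
    [IsManifold (𝓡 n) ∞ M] where
  val : (x : M) → LinearMap.BilinForm ℝ (TangentSpace (𝓡 n) x)
  symm : ∀ x v w, val x v w = val x w v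
  nondegenerate : ∀ x v, (∀ w, val x v w = 0) → v = 0
  smooth : IsSmooth (fun x (i : Fin 2 → Fin n) =>
    val x (tangentVec x (i 0)) (tangentVec x (i 1)))

namespace Metric

variable (g : Metric n M)

/-- The components `g_{ab}`, as a tensor field. -/
def comp : TensorField n M 2 := fun x i => g.val x (tangentVec x (i 0)) (tangentVec x (i 1))

/-- `g_{ab}` at `x`. -/
def lower (x : M) (a b : Fin n) : ℝ := g.comp x ![a, b]

/-- The inverse metric `g^{ab}` at `x`. -/
def upper (x : M) (a b : Fin n) : ℝ := (toMatrix (g.comp x))⁻¹ a b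

/-- The Levi-Civita covariant derivative `∇_c T_{i₁ … i_r}`, the derivative index coming first. -/
def nabla {r : ℕ} (T : TensorField n M r) : TensorField n M (r + 1) := fun x =>
  coordNabla (inChart x g.comp) (inChart x T) (extChartAt (𝓡 n) x x)

/-- The Riemann curvature `R_{ab}{}^c{}_d` at `x`. -/
def riemann (x : M) (a b c d : Fin n) : ℝ :=
  coordRiemann (inChart x g.comp) (extChartAt (𝓡 n) x x) a b c d

/-- `R_{abcd}`. -/
def riemannLower (x : M) (a b c d : Fin n) : ℝ := ∑ e, g.lower x c e * g.riemann x a b e d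

/-- `Ric_{ab} = R_{ca}{}^c{}_b`. -/
def ricci (x : M) (a b : Fin n) : ℝ := ∑ c, g.riemann x c a c b

/-- The scalar curvature `Ric_a{}^a`. -/
def scalar (x : M) : ℝ := ∑ a, ∑ b, g.upper x a b * g.ricci x a b

/-- The Schouten tensor `P_{ab}`, determined by `Ric_{ab} = (n - 2) P_{ab} + J g_{ab}` with
`J = P_a{}^a`, so that `J` is the scalar curvature divided by `2 (n - 1)`. -/
def schouten (x : M) (a b : Fin n) : ℝ :=
  (g.ricci x a b - g.scalar x / (2 * ((n : ℝ) - 1)) * g.lower x a b) / ((n : ℝ) - 2)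

/-- `P_a{}^p`. -/
def schoutenUp (x : M) (a p : Fin n) : ℝ := ∑ q, g.schouten x a q * g.upper x q p

/-- The Weyl tensor, by
`R_{abcd} = C_{abcd} + 2 g_{c[a} P_{b]d} + 2 g_{d[b} P_{a]c}`. -/
def weyl (x : M) (a b c d : Fin n) : ℝ :=
  g.riemannLower x a b c d
    - (g.lower x c a * g.schouten x b d - g.lower x c b * g.schouten x a d)
    - (g.lower x d b * g.schouten x a c - g.lower x d a * g.schouten x b c)

/-- `C_{abc}{}^p`. -/
def weylUp (x : M) (a b c p : Fin n) : ℝ := ∑ d, g.weyl x a b c d * g.upper x d p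

/-- `C_{ab}{}^{pq}`. -/
def weylUpUp (x : M) (a b p q : Fin n) : ℝ := ∑ c, g.upper x p c * g.weylUp x a b c q

/-- The Cotton tensor `A_{abc} = 2 ∇_{[b} P_{c]a} = ∇_b P_{ca} - ∇_c P_{ba}`. -/
def cotton (x : M) (a b c : Fin n) : ℝ :=
  g.nabla (fun y i => g.schouten y (i 0) (i 1)) x ![b, c, a]
    - g.nabla (fun y i => g.schouten y (i 0) (i 1)) x ![c, b, a]

/-- `A^p{}_{ab}`. -/
def cottonUp (x : M) (p a b : Fin n) : ℝ := ∑ q, g.upper x p q * g.cotton x q a b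

/-- The trace `T^p{}_{p i₁ … i_r}` over the first two indices. -/
def trace {r : ℕ} (T : TensorField n M (r + 2)) : TensorField n M r := fun x i =>
  ∑ p, ∑ q, g.upper x p q * T x (cons p (cons q i))

/-- The `O(g)`-equivariant projection `T_{c a¹ … a^k} ↦ T_{{c a¹ … a^k}₀}` of tensors that are
skew in the last `k = m + 1` indices onto the Cartan component, i.e. those which are moreover
trace-free and satisfy `T_{[c a¹ … a^k]} = 0`: one subtracts the components in the two
complementary summands, the `(k + 1)`-form `T_{[c a¹ … a^k]}` and the pure trace part
`k / (n - k + 1) g_{c[a¹} T^p{}_{|p| a² … a^k]}`. -/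
def cartanPart {m : ℕ} (T : TensorField n M (m + 2)) : TensorField n M (m + 2) := fun x i =>
  T x i - skew (T x) i
    - ((m : ℝ) + 1) / ((n : ℝ) - ((m : ℝ) + 1) + 1) *
      skew (fun a : Fin (m + 1) → Fin n => g.lower x (i 0) (a 0) * g.trace T x (tl a)) (tl i)

/-- The action `C ♦ f` on `k`-forms, written as an array in the indices `c, a², …, a^k`:
`(k - 2) / k (C_{c a²}{}^{pq} f_{pq a³ … a^k} + C_{a³ a²}{}^{pq} f_{pqc a⁴ … a^k})`, skewed over
`a², …, a^k`. The factor `k - 2` makes it zero for `k = 2`; for `k < 2` it plays no role and is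
put equal to zero. -/
def blackDiamond : (k : ℕ) → TensorField n M k → TensorField n M k
  | l + 3, f => fun x i =>
      skew (fun b : Fin (l + 2) → Fin n =>
        (((l : ℝ) + 3) - 2) / ((l : ℝ) + 3) *
          ((∑ p, ∑ q, g.weylUpUp x (i 0) (b 0) p q * f x (cons p (cons q (tl b))))
            + ∑ p, ∑ q, g.weylUpUp x (b 1) (b 0) p q *
                f x (cons p (cons q (cons (i 0) (tl (tl b))))))) (tl i)
  | _, _ => fun _ _ => 0

/-! ## The conformal Killing equation and its prolongation, in the scale `g`

Below `k = m + 1`, the letter `c` stands for the first index `i 0`, and the remaining indices are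
always skewed over. -/

/-- The conformal Killing equation `∇_{{c} σ_{a¹ … a^k}₀} = 0`. -/
def IsConformalKilling {m : ℕ} (σ : TensorField n M (m + 1)) : Prop :=
  ∀ x i, g.cartanPart (g.nabla σ) x i = 0

/-- Right-hand side of the equation for `∇_c σ_{a¹ … a^k}`. -/
def sigmaRHS {m : ℕ} (μ : TensorField n M (m + 2)) (ν : TensorField n M m) :
    TensorField n M (m + 2) := fun x i =>
  μ x i + skew (fun a : Fin (m + 1) → Fin n => g.lower x (i 0) (a 0) * ν x (tl a)) (tl i)

/-- Right-hand side of the equation for `∇_c μ_{a⁰ … a^k}`. -/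
def muRHS {m : ℕ} (σ ρ : TensorField n M (m + 1)) : TensorField n M (m + 3) := fun x i =>
  (((m : ℝ) + 1) + 1) * skew (fun b : Fin (m + 2) → Fin n =>
    g.lower x (i 0) (b 0) * ρ x (tl b)
      - g.schouten x (i 0) (b 0) * σ x (tl b)
      - (1 / 2) * ∑ p, g.weylUp x (b 0) (b 1) (i 0) p * σ x (cons p (tl (tl b)))) (tl i)

/-- Right-hand side of the equation for `∇_c ν_{a² … a^k}`. -/
def nuRHS {m : ℕ} (σ ρ : TensorField n M (m + 1)) : TensorField n M (m + 1) := fun x i =>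
  -((m : ℝ) + 1) * (ρ x i + ∑ p, g.schoutenUp x (i 0) p * σ x (cons p (tl i)))
    + ((m : ℝ) + 1) * (((m : ℝ) + 1) - 1) / (2 * ((n : ℝ) - ((m : ℝ) + 1))) *
      g.blackDiamond (m + 1) σ x i

/-- Right-hand side of the equation for `∇_c ρ_{a¹ … a^k}`, which has one form for `k = 1` and
another one for `k = l + 2 ≥ 2`. -/
def rhoRHS : (m : ℕ) → TensorField n M (m + 1) → TensorField n M (m + 2) → TensorField n M m →
    TensorField n M (m + 2)
  | 0, σ, μ, ν => fun x i =>
      g.schouten x (i 0) (i 1) * ν x ![]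
        - (∑ p, g.schoutenUp x (i 0) p * μ x ![p, i 1])
        + ∑ p, ∑ q, g.cotton x (i 1) p (i 0) * g.upper x p q * σ x ![q]
  | l + 1, σ, μ, ν => fun x i =>
      skew (fun a : Fin (l + 2) → Fin n =>
        g.schouten x (i 0) (a 0) * ν x (tl a)
          - (∑ p, g.schoutenUp x (i 0) p * μ x (cons p a))
          + (1 / 2) * (∑ p, g.cottonUp x p (a 0) (a 1) * σ x (cons p (cons (i 0) (tl (tl a)))))
          - (∑ p, g.cottonUp x p (i 0) (a 0) * σ x (cons p (tl a)))
          + (1 / 2) * (∑ p, g.weylUp x (a 0) (a 1) (i 0) p * ν x (cons p (tl (tl a))))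
          - ((l : ℝ) + 2) / (2 * ((n : ℝ) - ((l : ℝ) + 2))) *
              g.nabla (g.blackDiamond (l + 2) σ) x (cons (a 0) (cons (i 0) (tl a)))) (tl i)

/-- The closed first-order system on `(σ, μ, ν, ρ)`. -/
def IsProlongedSolution {m : ℕ} (σ : TensorField n M (m + 1)) (μ : TensorField n M (m + 2))
    (ν : TensorField n M m) (ρ : TensorField n M (m + 1)) : Prop :=
  g.nabla σ = g.sigmaRHS μ ν ∧
  g.nabla μ = g.muRHS σ ρ ∧
  g.nabla ν = g.nuRHS σ ρ ∧
  g.nabla ρ = g.rhoRHS m σ μ ν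

/-- `∇_{a⁰} σ_{a¹ … a^k}`, skewed over all indices. -/
def muOf {m : ℕ} (σ : TensorField n M (m + 1)) : TensorField n M (m + 2) := fun x =>
  skew (g.nabla σ x)

/-- `k / (n - k + 1) ∇^p σ_{p a² … a^k}`. -/
def nuOf {m : ℕ} (σ : TensorField n M (m + 1)) : TensorField n M m := fun x i =>
  ((m : ℝ) + 1) / ((n : ℝ) - ((m : ℝ) + 1) + 1) * g.trace (g.nabla σ) x i

/-- `1 / (n k) ∇^p ∇_{{p} σ_{a¹ … a^k}₀} - 1 / (n - k + 1) ∇_{a¹} ∇^p σ_{p a² … a^k}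
- P_{a¹}{}^p σ_{p a² … a^k}`, skewed over `a¹, …, a^k`. -/
def rhoOf {m : ℕ} (σ : TensorField n M (m + 1)) : TensorField n M (m + 1) := fun x =>
  skew (fun a : Fin (m + 1) → Fin n =>
    1 / ((n : ℝ) * ((m : ℝ) + 1)) * g.trace (g.nabla (g.cartanPart (g.nabla σ))) x a
      - 1 / ((n : ℝ) - ((m : ℝ) + 1) + 1) * g.nabla (g.trace (g.nabla σ)) x a
      - ∑ p, g.schoutenUp x (a 0) p * σ x (cons p (tl a)))

/-- `g' = e^{2Υ} g` with `Υ` smooth. -/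
def Rescales (Υ : M → ℝ) (g g' : Metric n M) : Prop :=
  ContMDiff (𝓡 n) 𝓘(ℝ, ℝ) ∞ Υ ∧ ∀ x v w, g'.val x v w = Real.exp (2 * Υ x) * g.val x v w

end Metric

/-! ## Conformal structures and weighted forms -/

/-- A conformal structure: a full equivalence class of conformally related metrics. -/
structure ConformalStructure (n : ℕ) (M : Type*) [TopologicalSpace M]
    [ChartedSpace (Coord n) M] [IsManifold (𝓡 n) ∞ M] where
  metrics : Set (Metric n M)
  nonempty : metrics.Nonempty
  mem_iff : ∀ g ∈ metrics, ∀ g', g' ∈ metrics ↔ ∃ Υ : M → ℝ, Metric.Rescales Υ g g'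

/-- A smooth `k`-form of conformal weight `w`, i.e. a section of `Λ^k T^*M ⊗ E[w]`: the bundle
`E[w]` of densities is trivialised by each metric `g` of the conformal class, so the section is
a form for each such `g`, and the one for `e^{2Υ} g` is `e^{wΥ}` times the one for `g`. -/
@[ext]
structure WeightedForm (c : ConformalStructure n M) (k : ℕ) (w : ℝ) where
  inScale : c.metrics → FormField n M k
  homogeneous : ∀ (g g' : c.metrics) (Υ : M → ℝ), Metric.Rescales Υ g.1 g'.1 →
    ∀ x, inScale g' x = Real.exp (w * Υ x) • inScale g x
  smooth : ∀ g, IsSmooth (FormField.comp (inScale g))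

/-- The components of a weighted form in the scale `g`. -/
def WeightedForm.comp {c : ConformalStructure n M} {k : ℕ} {w : ℝ} (f : WeightedForm c k w)
    (g : c.metrics) : TensorField n M k := (f.inScale g).comp

/-- The variables `(σ, μ, ν, ρ)` of the prolonged system for `k = m + 1`, with
`σ ∈ E^k[k+1]`, `μ ∈ E^{k+1}[k+1]`, `ν ∈ E^{k-1}[k-1]` and `ρ ∈ E^k[k-1]`. -/
structure ProlongedTuple (c : ConformalStructure n M) (m : ℕ) where
  sigma : WeightedForm c (m + 1) ((m : ℝ) + 2)
  mu : WeightedForm c (m + 2) ((m : ℝ) + 2)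
  nu : WeightedForm c m (m : ℝ)
  rho : WeightedForm c (m + 1) (m : ℝ)

end Manifold

end ConformalKilling

end

open scoped Manifold ContDiff

noncomputable section

namespace ConformalKilling

/-! ## Index arrays: contraction, exterior multiplication and skew-symmetrisation -/

section Arrays

variable {n : ℕ}

/-! The conformal Killing equation says that `∇σ` has only a totally skew part and a pure trace
part, and these two parts are `μ` and `ν`. Prolongation differentiates once more, commutes the
derivatives by the Ricci identity, and observes that the resulting linear relations determine `∇μ`,
`∇ν` and finally `∇ρ`; the variable `ρ` is the one piece of the second derivative of `σ` that these
relations leave free.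

The algebra is done with operators. At a point, the alternating arrays of all ranks carry creation
operators `ε^a` and annihilation operators `ι_a` with `ι_a ε^b + ε^b ι_a = δ`, and `∑ ε^a ι_a`
multiplies by the degree. The first equation reads `∇_b σ = ι_b μ + (1/k) ε_b ν`, with integrability
condition `-R_{bc} σ = ι_c ∇_b μ - ι_b ∇_c μ + (1/k)(ε_c ∇_b ν - ε_b ∇_c ν)`
(`Metric.integrability_sigma`). Applying `ε^c` and summing leaves `k ∇_b μ` together with terms in
`ε^c ∇_c μ` and `ε^c ∇_c ν`. The former vanishes, because a second skewing kills the curvature by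
the first Bianchi identity; the latter is `ρ` by definition, up to a Schouten term. This is
`Clifford.CurvData.solve_first`. Contracting with `ι^b` instead isolates `∇_c ν` with a factor `n -
k`, which is where `k < n` enters (`Clifford.CurvData.solve_second`). The Weyl terms that appear are
recognised as `C ♦ σ` by `Metric.emb_blackDiamond`.

For `k ≥ 2` the same method, applied to the equation for `∇ν`, yields `k (k - 1) ∇ρ`
(`Clifford.CurvData.solve_third`); the Cotton tensor comes from the derivative of the Schouten
tensor, and one needs that `C ♦ σ` has no totally skew part. For `k = 1` this degenerates, since
second derivatives of a function commute. There `ρ = -(∇ν + Pσ)`, and `∇∇ν` is extracted from the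
contracted Ricci identity for `μ` with the help of the contracted second Bianchi identity
(`Metric.contracted_ricci_mu`, `Metric.nabla_nabla_nu_apply`).

Conversely, the first equation of the system already forces the conformal Killing equation.
Projecting it onto the skew and trace parts returns `μ` and `ν`, and skewing the equation for `∇ν`
returns `ρ` (`Metric.eq_muOf`, `Metric.eq_nuOf`, `Metric.eq_rhoOf`). So forgetting everything but
`σ` inverts the construction.

Two layers support this. The derivative at each point is computed in the preferred chart there, so
iterating it requires covariance under coordinate changes; this follows from the uniqueness of the
symmetric metric connection. The Leibniz rules then come from a frame that is parallel to first
order at the point, in which `∇` is plain differentiation. Lastly, a weighted form is determined by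
its components in one scale, and arbitrary smooth alternating components occur, so everything takes
place in the scale `g`. -/

/-- Insertion of the `p`-th basis vector in the first slot. -/
def ins {r : ℕ} (p : Fin n) (T : Tensor n (r + 1)) : Tensor n r := fun i => T (cons p i)

/-- Exterior multiplication by the `p`-th element of the dual basis. -/
def ext (p : Fin n) : {r : ℕ} → Tensor n r → Tensor n (r + 1)
  | 0, T => fun a => if a 0 = p then T (tl a) else 0
  | _ + 1, T => fun a => (if a 0 = p then T (tl a) else 0) - ext p (ins (a 0) T) (tl a)

/-- Alternating arrays. -/
def IsAlt : {r : ℕ} → Tensor n r → Prop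
  | 0, _ => True
  | 1, _ => True
  | _ + 2, T => (∀ p, IsAlt (ins p T)) ∧ ∀ p q i, T (cons p (cons q i)) = -T (cons q (cons p i))

@[simp] lemma cons_tl {r : ℕ} (i : Fin (r + 1) → Fin n) : cons (i 0) (tl i) = i :=
  Matrix.cons_head_tail i

/-- The extensionality principle behind nearly all inductions on the rank: insert a basis vector in
the first slot, simplify, and use the statement one rank lower. -/
lemma tensor_ext_ins {r : ℕ} {S T : Tensor n (r + 1)} (h : ∀ p, ins p S = ins p T) : S = T := by
  funext i
  rw [← cons_tl i]
  exact congrFun (h (i 0)) (tl i)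

lemma ext_zero_cons (p q : Fin n) (T : Tensor n 0) (i : Fin 0 → Fin n) :
    ext p T (cons q i) = if q = p then T i else 0 := rfl

lemma ext_succ_cons {r : ℕ} (p q : Fin n) (T : Tensor n (r + 1)) (i : Fin (r + 1) → Fin n) :
    ext p T (cons q i) = (if q = p then T i else 0) - ext p (ins q T) i := rfl

/-- The canonical anticommutation relation. The recursion defining `ext` was chosen so that this is
immediate, and all further properties of `ext` are derived from it. -/
lemma ins_ext {r : ℕ} (p q : Fin n) (T : Tensor n (r + 1)) :
    ins q (ext p T) = (if q = p then (1 : ℝ) else 0) • T - ext p (ins q T) := by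
  funext i
  show ext p T (cons q i) = _
  rw [ext_succ_cons]
  split_ifs <;> simp

lemma ins_ext_zero (p q : Fin n) (T : Tensor n 0) :
    ins q (ext p T) = (if q = p then (1 : ℝ) else 0) • T := by
  funext i
  show ext p T (cons q i) = _
  rw [ext_zero_cons]
  split_ifs <;> simp

lemma ins_add {r : ℕ} (p : Fin n) (S T : Tensor n (r + 1)) : ins p (S + T) = ins p S + ins p T :=
  rfl

lemma ins_smul {r : ℕ} (p : Fin n) (c : ℝ) (T : Tensor n (r + 1)) :
    ins p (c • T) = c • ins p T := rfl

lemma ext_add (p : Fin n) : ∀ {r : ℕ} (S T : Tensor n r), ext p (S + T) = ext p S + ext p T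
  | 0, S, T => by
    refine tensor_ext_ins fun q => ?_
    rw [ins_add, ins_ext_zero, ins_ext_zero, ins_ext_zero, smul_add]
  | r + 1, S, T => by
    refine tensor_ext_ins fun q => ?_
    rw [ins_add, ins_ext, ins_ext, ins_ext, smul_add, ins_add, ext_add]
    abel

lemma ext_smul (p : Fin n) (c : ℝ) : ∀ {r : ℕ} (T : Tensor n r), ext p (c • T) = c • ext p T
  | 0, T => by
    refine tensor_ext_ins fun q => ?_
    rw [ins_smul, ins_ext_zero, ins_ext_zero, smul_comm]
  | r + 1, T => by
    refine tensor_ext_ins fun q => ?_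
    rw [ins_smul, ins_ext, ins_ext, ins_smul, ext_smul, smul_sub, smul_comm c]

/-- `ins` as a linear map. -/
def insL (r : ℕ) (p : Fin n) : Tensor n (r + 1) →ₗ[ℝ] Tensor n r where
  toFun := ins p
  map_add' := ins_add p
  map_smul' := ins_smul p

/-- `ext` as a linear map. -/
def extL (r : ℕ) (p : Fin n) : Tensor n r →ₗ[ℝ] Tensor n (r + 1) where
  toFun := ext p
  map_add' := ext_add p
  map_smul' c T := ext_smul p c T

lemma ext_neg (p : Fin n) {r : ℕ} (T : Tensor n r) : ext p (-T) = -ext p T := (extL r p).map_neg T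

lemma ext_sub (p : Fin n) {r : ℕ} (S T : Tensor n r) : ext p (S - T) = ext p S - ext p T :=
  (extL r p).map_sub S T

lemma ins_sum (p : Fin n) {r : ℕ} {α : Type*} (s : Finset α) (T : α → Tensor n (r + 1)) :
    ins p (∑ a ∈ s, T a) = ∑ a ∈ s, ins p (T a) := map_sum (insL r p) T s

lemma ins_neg {r : ℕ} (p : Fin n) (T : Tensor n (r + 1)) : ins p (-T) = -ins p T := rfl

lemma ins_sub {r : ℕ} (p : Fin n) (S T : Tensor n (r + 1)) : ins p (S - T) = ins p S - ins p T :=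
  rfl

lemma ext_ext (p q : Fin n) : ∀ {r : ℕ} (T : Tensor n r), ext p (ext q T) = -ext q (ext p T)
  | 0, T => by
    refine tensor_ext_ins fun a => ?_
    rw [ins_neg, ins_ext, ins_ext, ins_ext_zero, ins_ext_zero, ext_smul, ext_smul]
    abel
  | r + 1, T => by
    refine tensor_ext_ins fun a => ?_
    rw [ins_neg, ins_ext, ins_ext, ins_ext, ins_ext, ext_sub, ext_sub, ext_smul, ext_smul, ext_ext]
    abel

lemma IsAlt.ins {r : ℕ} {T : Tensor n (r + 1)} (h : IsAlt T) (p : Fin n) : IsAlt (ins p T) := by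
  cases r with
  | zero => trivial
  | succ r => exact h.1 p

lemma IsAlt.ins_ins {r : ℕ} {T : Tensor n (r + 2)} (h : IsAlt T) (p q : Fin n) :
    ConformalKilling.ins p (ConformalKilling.ins q T)
      = -ConformalKilling.ins q (ConformalKilling.ins p T) := by
  funext i
  exact h.2 q p i

lemma isAlt_succ_succ {r : ℕ} {T : Tensor n (r + 2)} (h : ∀ p, IsAlt (ins p T))
    (h' : ∀ p q, ins p (ins q T) = -ins q (ins p T)) : IsAlt T :=
  ⟨h, fun p q i => congrFun (h' q p) i⟩

lemma IsAlt.zero : ∀ {r : ℕ}, IsAlt (0 : Tensor n r)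
  | 0 => trivial
  | 1 => trivial
  | r + 2 => ⟨fun _ => IsAlt.zero (r := r + 1), fun _ _ _ => by simp⟩

lemma IsAlt.add : ∀ {r : ℕ} {S T : Tensor n r}, IsAlt S → IsAlt T → IsAlt (S + T)
  | 0, _, _, _, _ => trivial
  | 1, _, _, _, _ => trivial
  | r + 2, S, T, hS, hT => ⟨fun p => IsAlt.add (hS.1 p) (hT.1 p), fun p q i => by
      rw [Pi.add_apply, Pi.add_apply, hS.2, hT.2]; ring⟩

lemma IsAlt.smul (c : ℝ) : ∀ {r : ℕ} {T : Tensor n r}, IsAlt T → IsAlt (c • T)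
  | 0, _, _ => trivial
  | 1, _, _ => trivial
  | r + 2, T, hT => ⟨fun p => IsAlt.smul c (hT.1 p), fun p q i => by
      rw [Pi.smul_apply, Pi.smul_apply, hT.2]; simp⟩

/-- The space of alternating arrays. -/
def altSpace (n r : ℕ) : Submodule ℝ (Tensor n r) where
  carrier := {T | IsAlt T}
  add_mem' := IsAlt.add
  zero_mem' := IsAlt.zero
  smul_mem' c _ := IsAlt.smul c

lemma IsAlt.sub {r : ℕ} {S T : Tensor n r} (hS : IsAlt S) (hT : IsAlt T) : IsAlt (S - T) :=
  (altSpace n r).sub_mem hS hT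

lemma IsAlt.sum {r : ℕ} {α : Type*} {s : Finset α} {T : α → Tensor n r}
    (h : ∀ a ∈ s, IsAlt (T a)) : IsAlt (∑ a ∈ s, T a) :=
  (altSpace n r).sum_mem h

lemma IsAlt.ext (p : Fin n) : ∀ {r : ℕ} {T : Tensor n r}, IsAlt T → IsAlt (ext p T)
  | 0, _, _ => trivial
  | 1, T, _ => by
    refine isAlt_succ_succ (fun _ => trivial) fun q s => ?_
    rw [ins_ext, ins_ext, ins_sub, ins_sub, ins_ext_zero, ins_ext_zero, ins_smul, ins_smul]
    abel
  | r + 2, T, h => by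
    refine isAlt_succ_succ (fun q => ?_) fun q s => ?_
    · rw [ins_ext]
      exact (h.smul _).sub (IsAlt.ext p (h.ins q))
    · rw [ins_ext, ins_ext, ins_sub, ins_sub, ins_ext, ins_ext, ins_smul, ins_smul, h.ins_ins q s,
        ext_neg]
      abel

/-- Explicit form of the exterior product. -/
lemma sum_ext_apply : ∀ {r : ℕ} (S : Fin n → Tensor n r) (a : Fin (r + 1) → Fin n),
    (∑ p, ConformalKilling.ext p (S p) a)
      = ∑ s : Fin (r + 1), (-1 : ℝ) ^ (s : ℕ) * S (a s) (fun t => a (s.succAbove t))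
  | 0, S, a => by
    simp only [ConformalKilling.ext, Finset.sum_ite_eq, Finset.mem_univ, if_true]
    simp
    congr 1
  | r + 1, S, a => by
    rw [← cons_tl a]
    simp only [ext_succ_cons, Finset.sum_sub_distrib, Finset.sum_ite_eq, Finset.mem_univ, if_true]
    rw [sum_ext_apply (fun p => ConformalKilling.ins (a 0) (S p)), Fin.sum_univ_succ (n := r + 1),
      sub_eq_add_neg, ← Finset.sum_neg_distrib]
    congr 1
    · simp
    · refine Finset.sum_congr rfl fun s _ => ?_
      have : (fun t => cons (a 0) (tl a) (s.succ.succAbove t))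
          = cons (a 0) (fun t => tl a (s.succAbove t)) := by
        funext t
        refine Fin.cases ?_ (fun t => ?_) t
        · simp
        · simp
      rw [this]
      simp [ConformalKilling.ins, pow_succ]

/-- A permutation is a choice of first element followed by a permutation of the others. -/
lemma bijective_cycle (r : ℕ) : Function.Bijective
    (fun x : Fin (r + 1) × Equiv.Perm (Fin r) =>
      (x.1.cycleRange.symm * Equiv.Perm.decomposeFin.symm (0, x.2) : Equiv.Perm (Fin (r + 1)))) := by
  rw [Fintype.bijective_iff_injective_and_card]
  refine ⟨?_, by simp [Fintype.card_perm, Nat.factorial_succ]⟩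
  rintro ⟨s, e⟩ ⟨s', e'⟩ h
  have hs : s = s' := by
    have := congrArg (fun π : Equiv.Perm (Fin (r + 1)) => π 0) h
    simpa using this
  subst hs
  have := mul_left_cancel h
  have := Equiv.Perm.decomposeFin.symm.injective this
  simpa using this

/-- Laplace expansion of the skew-symmetrisation. -/
lemma skew_succ {r : ℕ} (T : Tensor n (r + 1)) :
    skew T = ((r : ℝ) + 1)⁻¹ • ∑ p, ConformalKilling.ext p (skew (ConformalKilling.ins p T)) := by
  funext a
  rw [Pi.smul_apply, Finset.sum_apply, sum_ext_apply]
  unfold skew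
  rw [← (bijective_cycle r).sum_comp, Fintype.sum_prod_type, Nat.factorial_succ]
  push_cast
  rw [mul_inv, smul_eq_mul, mul_assoc, Finset.mul_sum]
  congr 1
  refine Finset.sum_congr rfl fun s _ => ?_
  rw [← mul_assoc, mul_comm ((-1 : ℝ) ^ (s : ℕ)), mul_assoc]
  congr 1
  rw [Finset.mul_sum]
  refine Finset.sum_congr rfl fun e _ => ?_
  -- The cycle moving `0` to `s` has length `s + 1`, which gives the sign of the Laplace expansion;
  -- `decomposeFin` with first entry `0` only shifts the other permutation.
  have hsign : Equiv.Perm.sign (s.cycleRange.symm * Equiv.Perm.decomposeFin.symm (0, e))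
      = (-1) ^ (s : ℕ) * Equiv.Perm.sign e := by
    rw [Equiv.Perm.sign_mul, Equiv.Perm.sign_symm, Fin.sign_cycleRange,
      Equiv.Perm.decomposeFin.symm_sign]
    simp
  rw [hsign]
  push_cast
  rw [mul_assoc]
  congr 2
  refine congrArg T (funext fun t => ?_)
  refine Fin.cases ?_ (fun t => ?_) t
  · simp
  · simp

lemma skew_zero (T : Tensor n 0) : skew T = T := by
  funext i
  simp [skew]

/-- The degree of an alternating array. -/
lemma IsAlt.sum_ext_ins : ∀ {r : ℕ} {T : Tensor n (r + 1)}, IsAlt T →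
    ∑ p, ConformalKilling.ext p (ConformalKilling.ins p T) = ((r : ℝ) + 1) • T
  | 0, T, _ => by
    refine tensor_ext_ins fun q => ?_
    rw [ins_sum]
    simp only [ins_ext_zero, ite_smul, one_smul, zero_smul, Finset.sum_ite_eq, Finset.mem_univ,
      if_true]
    simp
  | r + 1, T, h => by
    refine tensor_ext_ins fun q => ?_
    rw [ins_sum]
    simp only [ins_ext, h.ins_ins q, ext_neg, sub_neg_eq_add, Finset.sum_add_distrib, ite_smul,
      one_smul, zero_smul, Finset.sum_ite_eq, Finset.mem_univ, if_true]
    rw [(h.ins q).sum_ext_ins, ins_smul]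
    push_cast
    module

/-- In the Laplace expansion the inner skewing is trivial by induction, and the degree formula
`sum_ext_ins` produces exactly the factor cancelled by `1 / (r + 1)`. -/
lemma IsAlt.skew_eq : ∀ {r : ℕ} {T : Tensor n r}, IsAlt T → skew T = T
  | 0, T, _ => skew_zero T
  | r + 1, T, h => by
    rw [skew_succ]
    simp only [fun p => (h.ins p).skew_eq]
    rw [h.sum_ext_ins, smul_smul, inv_mul_cancel₀ (by positivity), one_smul]

lemma isAlt_skew : ∀ {r : ℕ} (T : Tensor n r), IsAlt (skew T)
  | 0, _ => trivial
  | r + 1, T => by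
    rw [skew_succ]
    exact (IsAlt.sum fun p _ => (isAlt_skew _).ext p).smul _

/-- The link with the usual notion of alternation. Under the sign rule all `r!` terms of the
skew-symmetrisation agree, so the array equals its own skew part, and skew parts are alternating in
the recursive sense. -/
lemma isAlt_of_perm : ∀ {r : ℕ} {T : Tensor n r}
    (_ : ∀ i (π : Equiv.Perm (Fin r)), T (fun s => i (π s)) = ((Equiv.Perm.sign π : ℤ) : ℝ) * T i),
    IsAlt T := by
  intro r T h
  have : skew T = T := by
    funext i
    unfold skew
    simp only [h]
    have : ∀ π : Equiv.Perm (Fin r), ((Equiv.Perm.sign π : ℤ) : ℝ) *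
        (((Equiv.Perm.sign π : ℤ) : ℝ) * T i) = T i := fun π => by
      rcases Int.units_eq_one_or (Equiv.Perm.sign π) with h | h <;> simp [h]
    simp only [this, Finset.sum_const, Finset.card_univ, Fintype.card_perm, Fintype.card_fin,
      nsmul_eq_mul]
    rw [← mul_assoc, inv_mul_cancel₀ (by positivity), one_mul]
  rw [← this]
  exact isAlt_skew T

/-- Skew-symmetrisation as a linear map. -/
def skewL (n r : ℕ) : Tensor n r →ₗ[ℝ] Tensor n r where
  toFun := skew
  map_add' S T := by
    funext i
    simp [skew, mul_add, Finset.sum_add_distrib]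
  map_smul' c T := by
    funext i
    simp only [skew, Pi.smul_apply, smul_eq_mul, RingHom.id_apply, Finset.mul_sum]
    refine Finset.sum_congr rfl fun π _ => by ring

lemma skew_smul {r : ℕ} (c : ℝ) (T : Tensor n r) : skew (c • T) = c • skew T :=
  (skewL n r).map_smul c T

lemma skew_sum {r : ℕ} {α : Type*} (s : Finset α) (T : α → Tensor n r) :
    skew (∑ a ∈ s, T a) = ∑ a ∈ s, skew (T a) := map_sum (skewL n r) T s

end Arrays

/-! ## Change of frame and infinitesimal change of frame -/

section Frames

variable {n : ℕ}

/-- Components of `T` in the frame whose `i`-th vector has components `A · i`. -/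
def pull (A : Matrix (Fin n) (Fin n) ℝ) {r : ℕ} (T : Tensor n r) : Tensor n r := fun i =>
  ∑ j : Fin r → Fin n, T j * ∏ s, A (j s) (i s)

/-- The derivation of arrays given by an endomorphism. -/
def act (B : Fin n → Fin n → ℝ) {r : ℕ} (T : Tensor n r) : Tensor n r := fun i =>
  ∑ s : Fin r, ∑ p, B (i s) p * T (Function.update i s p)

lemma pull_add (A : Matrix (Fin n) (Fin n) ℝ) {r : ℕ} (S T : Tensor n r) :
    pull A (S + T) = pull A S + pull A T := by
  funext i
  simp [pull, add_mul, Finset.sum_add_distrib]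

lemma pull_smul (A : Matrix (Fin n) (Fin n) ℝ) {r : ℕ} (c : ℝ) (T : Tensor n r) :
    pull A (c • T) = c • pull A T := by
  funext i
  simp [pull, Finset.mul_sum, mul_assoc]

/-- `pull` as a linear map. -/
def pullL (A : Matrix (Fin n) (Fin n) ℝ) (r : ℕ) : Tensor n r →ₗ[ℝ] Tensor n r where
  toFun := pull A
  map_add' := pull_add A
  map_smul' := pull_smul A

lemma pull_sum (A : Matrix (Fin n) (Fin n) ℝ) {r : ℕ} {α : Type*} (s : Finset α)
    (T : α → Tensor n r) : pull A (∑ a ∈ s, T a) = ∑ a ∈ s, pull A (T a) :=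
  map_sum (pullL A r) T s

lemma pull_zero (A : Matrix (Fin n) (Fin n) ℝ) (r : ℕ) : pull A (0 : Tensor n r) = 0 :=
  (pullL A r).map_zero

lemma pull_rank_zero (A : Matrix (Fin n) (Fin n) ℝ) (T : Tensor n 0) : pull A T = T := by
  funext i
  simp only [pull, Finset.univ_unique, Finset.sum_singleton, Finset.univ_eq_empty,
    Finset.prod_empty, mul_one]
  congr 1
  exact Subsingleton.elim _ _

/-- Splitting off the first index turns a change of frame into a recursion on the rank, which
replaces the sums over multi-indices in the later proofs. -/
lemma pull_cons (A : Matrix (Fin n) (Fin n) ℝ) {r : ℕ} (T : Tensor n (r + 1)) (p : Fin n)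
    (i : Fin r → Fin n) : pull A T (cons p i) = ∑ q, A q p * pull A (ins q T) i := by
  unfold pull
  rw [← (Fin.consEquiv (fun _ : Fin (r + 1) => Fin n)).sum_comp, Fintype.sum_prod_type]
  refine Finset.sum_congr rfl fun q _ => ?_
  rw [Finset.mul_sum]
  refine Finset.sum_congr rfl fun j _ => ?_
  rw [Fin.prod_univ_succ]
  show T (cons q j) * (A q p * _) = A q p * (T (cons q j) * _)
  rw [mul_left_comm]
  rfl

lemma ins_pull (A : Matrix (Fin n) (Fin n) ℝ) {r : ℕ} (T : Tensor n (r + 1)) (p : Fin n) :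
    ins p (pull A T) = ∑ q, A q p • pull A (ins q T) := by
  funext i
  simp [ins, pull_cons]

lemma pull_one : ∀ {r : ℕ} (T : Tensor n r), pull 1 T = T
  | 0, T => pull_rank_zero _ T
  | r + 1, T => by
    refine tensor_ext_ins fun p => ?_
    rw [ins_pull]
    simp [Matrix.one_apply, pull_one]

lemma pull_mul (A B : Matrix (Fin n) (Fin n) ℝ) : ∀ {r : ℕ} (T : Tensor n r),
    pull B (pull A T) = pull (A * B) T
  | 0, T => by rw [pull_rank_zero, pull_rank_zero, pull_rank_zero]
  | r + 1, T => by
    refine tensor_ext_ins fun p => ?_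
    rw [ins_pull, ins_pull]
    simp only [ins_pull, pull_sum, pull_smul, Matrix.mul_apply, Finset.smul_sum, Finset.sum_smul,
      smul_smul, pull_mul]
    rw [Finset.sum_comm]
    simp only [mul_comm]

lemma pull_two (A : Matrix (Fin n) (Fin n) ℝ) (T : Tensor n 2) (a b : Fin n) :
    pull A T ![a, b] = ∑ p, ∑ q, A p a * (A q b * T ![p, q]) := by
  rw [show (![a, b] : Fin 2 → Fin n) = cons a (cons b ![]) from rfl, pull_cons]
  simp only [pull_cons, pull_rank_zero, ← Finset.mul_sum]
  rfl

lemma toMatrix_pull (A : Matrix (Fin n) (Fin n) ℝ) (T : Tensor n 2) :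
    toMatrix (pull A T) = A.transpose * toMatrix T * A := by
  ext a b
  rw [Matrix.mul_assoc, Matrix.mul_apply]
  simp only [toMatrix, Matrix.of_apply, pull_two, Matrix.mul_apply, Matrix.transpose_apply,
    Finset.mul_sum]
  refine Finset.sum_congr rfl fun p _ => Finset.sum_congr rfl fun q _ => by ring

lemma act_add (B : Fin n → Fin n → ℝ) {r : ℕ} (S T : Tensor n r) :
    act B (S + T) = act B S + act B T := by
  funext i
  simp [act, mul_add, Finset.sum_add_distrib]

lemma act_smul (B : Fin n → Fin n → ℝ) {r : ℕ} (c : ℝ) (T : Tensor n r) :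
    act B (c • T) = c • act B T := by
  funext i
  simp only [act, Pi.smul_apply, smul_eq_mul, Finset.mul_sum]
  refine Finset.sum_congr rfl fun s _ => Finset.sum_congr rfl fun p _ => by ring

/-- `act` as a linear map. -/
def actL (B : Fin n → Fin n → ℝ) (r : ℕ) : Tensor n r →ₗ[ℝ] Tensor n r where
  toFun := act B
  map_add' := act_add B
  map_smul' := act_smul B

lemma act_sum (B : Fin n → Fin n → ℝ) {r : ℕ} {α : Type*} (s : Finset α)
    (T : α → Tensor n r) : act B (∑ a ∈ s, T a) = ∑ a ∈ s, act B (T a) :=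
  map_sum (actL B r) T s

lemma act_rank_zero (B : Fin n → Fin n → ℝ) (T : Tensor n 0) : act B T = 0 := by
  funext i
  simp [act]

lemma ins_act (B : Fin n → Fin n → ℝ) {r : ℕ} (T : Tensor n (r + 1)) (q : Fin n) :
    ins q (act B T) = ∑ p, B q p • ins p T + act B (ins q T) := by
  funext i
  simp only [ins, act, Pi.add_apply, Finset.sum_apply, Pi.smul_apply, smul_eq_mul]
  rw [Fin.sum_univ_succ]
  congr 1
  · refine Finset.sum_congr rfl fun p _ => ?_
    congr 2
    exact Fin.update_cons_zero (α := fun _ => Fin n) q i p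
  · refine Finset.sum_congr rfl fun s _ => Finset.sum_congr rfl fun p _ => ?_
    congr 2
    exact (Fin.cons_update (α := fun _ => Fin n) q i s p).symm

lemma act_cons (B : Fin n → Fin n → ℝ) {r : ℕ} (T : Tensor n (r + 1)) (q : Fin n)
    (i : Fin r → Fin n) :
    act B T (cons q i) = ∑ p, B q p * T (cons p i) + act B (ins q T) i := by
  have := congrFun (ins_act B T q) i
  simpa [ins] using this

lemma act_neg_left (B : Fin n → Fin n → ℝ) {r : ℕ} (T : Tensor n r) :
    act (fun a p => -B a p) T = -act B T := by
  funext i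
  simp [act]

lemma act_sum_left {α : Type*} (s : Finset α) (c : α → ℝ) (B : α → Fin n → Fin n → ℝ) {r : ℕ}
    (T : Tensor n r) :
    act (fun a p => ∑ x ∈ s, c x * B x a p) T = ∑ x ∈ s, c x • act (B x) T := by
  funext i
  simp only [act, Finset.sum_apply, Pi.smul_apply, smul_eq_mul, Finset.mul_sum, Finset.sum_mul]
  rw [Finset.sum_comm (s := s)]
  refine Finset.sum_congr rfl fun t _ => ?_
  rw [Finset.sum_comm (s := s)]
  refine Finset.sum_congr rfl fun p _ => Finset.sum_congr rfl fun x _ => by ring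

/-- The commutator of two derivations. -/
lemma act_act_sub (B C : Fin n → Fin n → ℝ) : ∀ {r : ℕ} (T : Tensor n r),
    act B (act C T) - act C (act B T)
      = act (fun a p => ∑ e, (B a e * C e p - C a e * B e p)) T
  | 0, T => by simp [act_rank_zero]
  | r + 1, T => by
    refine tensor_ext_ins fun q => ?_
    rw [ins_sub, ins_act, ins_act, ins_act, ins_act, ins_act, act_add, act_add, act_sum, act_sum,
      ← act_act_sub B C]
    simp only [act_smul, ins_act, smul_add, Finset.sum_add_distrib, Finset.smul_sum, smul_smul,
      Finset.sum_smul, sub_smul, Finset.sum_sub_distrib]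
    rw [Finset.sum_comm (f := fun x y => (C q y * B y x) • _),
      Finset.sum_comm (f := fun x y => (B q y * C y x) • _)]
    abel

end Frames

/-! ## Partial derivatives -/

section PartialDerivatives

variable {n : ℕ}

lemma pd_congr {c : Fin n} {f g : Coord n → ℝ} {u : Coord n} (h : f =ᶠ[nhds u] g) :
    pd c f u = pd c g u := by
  unfold pd
  rw [h.fderiv_eq]

lemma pd_const (c : Fin n) (a : ℝ) (u : Coord n) : pd c (fun _ => a) u = 0 := by
  simp [pd]

lemma pd_add {c : Fin n} {f g : Coord n → ℝ} {u : Coord n} (hf : DifferentiableAt ℝ f u)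
    (hg : DifferentiableAt ℝ g u) : pd c (fun v => f v + g v) u = pd c f u + pd c g u := by
  unfold pd
  rw [fderiv_fun_add hf hg]
  rfl

lemma pd_sub {c : Fin n} {f g : Coord n → ℝ} {u : Coord n} (hf : DifferentiableAt ℝ f u)
    (hg : DifferentiableAt ℝ g u) : pd c (fun v => f v - g v) u = pd c f u - pd c g u := by
  unfold pd
  rw [fderiv_fun_sub hf hg]
  rfl

lemma pd_mul {c : Fin n} {f g : Coord n → ℝ} {u : Coord n} (hf : DifferentiableAt ℝ f u)
    (hg : DifferentiableAt ℝ g u) :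
    pd c (fun v => f v * g v) u = pd c f u * g u + f u * pd c g u := by
  unfold pd
  rw [fderiv_fun_mul hf hg]
  simp
  ring

lemma pd_const_mul {c : Fin n} (a : ℝ) {f : Coord n → ℝ} {u : Coord n}
    (hf : DifferentiableAt ℝ f u) : pd c (fun v => a * f v) u = a * pd c f u := by
  rw [pd_mul (differentiableAt_const a) hf, pd_const, zero_mul, zero_add]

lemma pd_sum {c : Fin n} {α : Type*} {s : Finset α} {f : α → Coord n → ℝ} {u : Coord n}
    (hf : ∀ a ∈ s, DifferentiableAt ℝ (f a) u) :
    pd c (fun v => ∑ a ∈ s, f a v) u = ∑ a ∈ s, pd c (f a) u := by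
  unfold pd
  rw [fderiv_fun_sum hf]
  simp

lemma coord_eq_sum (w : Coord n) : w = ∑ e, w e • stdVec e := by
  ext i
  simp [stdVec, Pi.single_apply]

lemma clm_eq_sum {E : Type*} [NormedAddCommGroup E] [NormedSpace ℝ E] (L : Coord n →L[ℝ] E)
    (w : Coord n) : L w = ∑ e, w e • L (stdVec e) := by
  conv_lhs => rw [coord_eq_sum w, map_sum]
  simp

lemma pd_coord (c e : Fin n) (u : Coord n) :
    pd c (fun v => v e) u = if e = c then 1 else 0 := by
  have : (fun v : Coord n => v e) = (EuclideanSpace.proj e : Coord n →L[ℝ] ℝ) := rfl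
  unfold pd
  rw [this, ContinuousLinearMap.fderiv]
  simp [stdVec]

lemma fderiv_apply_coord {c e : Fin n} {ψ : Coord n → Coord n} {u : Coord n}
    (hψ : DifferentiableAt ℝ ψ u) : (fderiv ℝ ψ u (stdVec c)) e = pd c (fun v => ψ v e) u := by
  unfold pd
  have : (fun v => ψ v e) = (EuclideanSpace.proj e : Coord n →L[ℝ] ℝ) ∘ ψ := rfl
  rw [this, fderiv_comp _ (ContinuousLinearMap.differentiableAt _) hψ,
    ContinuousLinearMap.fderiv]
  rfl

lemma pd_comp {c : Fin n} {f : Coord n → ℝ} {ψ : Coord n → Coord n} {u : Coord n}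
    (hf : DifferentiableAt ℝ f (ψ u)) (hψ : DifferentiableAt ℝ ψ u) :
    pd c (fun v => f (ψ v)) u = ∑ e, pd c (fun v => ψ v e) u * pd e f (ψ u) := by
  have : (fun v => f (ψ v)) = f ∘ ψ := rfl
  rw [pd, this, fderiv_comp _ hf hψ, ContinuousLinearMap.comp_apply, clm_eq_sum]
  refine Finset.sum_congr rfl fun e _ => ?_
  rw [fderiv_apply_coord hψ]
  rfl

lemma pd_pd_comm {f : Coord n → ℝ} {u : Coord n} (hf : ContDiffAt ℝ ∞ f u) (a b : Fin n) :
    pd a (pd b f) u = pd b (pd a f) u := by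
  have hs : IsSymmSndFDerivAt ℝ f u := hf.isSymmSndFDerivAt (by
    rw [minSmoothness_of_isRCLikeNormedField]
    exact WithTop.coe_le_coe.2 (le_top : ((2 : ℕ∞)) ≤ ⊤))
  have hd : DifferentiableAt ℝ (fderiv ℝ f) u :=
    (hf.fderiv_right (m := 1) (WithTop.coe_le_coe.2 (le_top : ((2 : ℕ∞)) ≤ ⊤))).differentiableAt (by simp)
  have key : ∀ a b : Fin n, pd a (pd b f) u = fderiv ℝ (fderiv ℝ f) u (stdVec a) (stdVec b) := by
    intro a b
    unfold pd
    rw [fderiv_clm_apply hd (differentiableAt_const _)]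
    simp
  rw [key, key, hs]

lemma contDiffOn_pd {f : Coord n → ℝ} {U : Set (Coord n)} (hU : IsOpen U)
    (hf : ContDiffOn ℝ ∞ f U) (c : Fin n) : ContDiffOn ℝ ∞ (pd c f) U :=
  (hf.fderiv_of_isOpen hU (by simp)).clm_apply contDiffOn_const

lemma differentiableAt_of_contDiffOn {f : Coord n → ℝ} {U : Set (Coord n)} (hU : IsOpen U)
    (hf : ContDiffOn ℝ ∞ f U) {u : Coord n} (hu : u ∈ U) : DifferentiableAt ℝ f u :=
  (hf.contDiffAt (hU.mem_nhds hu)).differentiableAt (by simp)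

lemma differentiableAt_pull {r : ℕ} {A : Coord n → Matrix (Fin n) (Fin n) ℝ}
    {T : Coord n → Tensor n r} {u : Coord n}
    (hA : ∀ p q, DifferentiableAt ℝ (fun v => A v p q) u)
    (hT : ∀ i, DifferentiableAt ℝ (fun v => T v i) u) (i : Fin r → Fin n) :
    DifferentiableAt ℝ (fun v => pull (A v) (T v) i) u := by
  unfold pull
  refine DifferentiableAt.fun_sum fun j _ => (hT j).mul ?_
  exact (HasFDerivAt.finsetProd (g := fun s v => A v (j s) (i s))
    fun s _ => (hA (j s) (i s)).hasFDerivAt).differentiableAt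

lemma contDiffOn_pull {r : ℕ} {A : Coord n → Matrix (Fin n) (Fin n) ℝ}
    {T : Coord n → Tensor n r} {U : Set (Coord n)}
    (hA : ∀ p q, ContDiffOn ℝ ∞ (fun v => A v p q) U)
    (hT : ∀ i, ContDiffOn ℝ ∞ (fun v => T v i) U) (i : Fin r → Fin n) :
    ContDiffOn ℝ ∞ (fun v => pull (A v) (T v) i) U := by
  unfold pull
  refine ContDiffOn.sum fun j _ => (hT j).mul ?_
  exact contDiffOn_prod fun s _ => hA (j s) (i s)

/-- Derivative of the components of a tensor field in a moving frame. -/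
lemma pd_pull (A : Coord n → Matrix (Fin n) (Fin n) ℝ) {u : Coord n} {c : Fin n}
    (hA : ∀ p q, DifferentiableAt ℝ (fun v => A v p q) u) (B C : Fin n → Fin n → ℝ)
    (h : ∀ q p, pd c (fun v => A v q p) u = ∑ s, A u s p * C s q + ∑ s, B p s * A u q s) :
    ∀ {r : ℕ} (T : Coord n → Tensor n r) (_ : ∀ i, DifferentiableAt ℝ (fun v => T v i) u)
      (i : Fin r → Fin n),
    pd c (fun v => pull (A v) (T v) i) u
      = pull (A u) ((fun j => pd c (fun v => T v j) u) + act C (T u)) i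
        + act B (pull (A u) (T u)) i
  | 0, T, hT, i => by
    simp only [pull_rank_zero, act_rank_zero, add_zero, Pi.zero_apply]
  | r + 1, T, hT, i => by
    rw [← cons_tl i]
    generalize i 0 = p
    generalize tl i = i
    have hT' : ∀ q j, DifferentiableAt ℝ (fun v => ins q (T v) j) u := fun q j => hT _
    have ih := fun q => pd_pull A hA B C h (fun v => ins q (T v)) (hT' q) i
    simp only [pull_cons]
    rw [pd_sum (f := fun q v => A v q p * pull (A v) (ins q (T v)) i)
      fun q _ => (hA q p).mul (differentiableAt_pull hA (hT' q) i)]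
    -- The hypothesis splits `∂A` as `A·C + B·A`. The first summand is absorbed by the derivation
    -- `C` of the original components, the second by the derivation `B` of the transformed ones.
    simp only [fun q => pd_mul (c := c) (hA q p) (differentiableAt_pull hA (hT' q) i), ih, h]
    rw [act_cons, ins_pull, act_sum]
    simp only [ins_add, ins_act, pull_add, pull_sum, pull_smul, act_smul, Pi.add_apply,
      Finset.sum_apply, Pi.smul_apply, smul_eq_mul, mul_add, add_mul, Finset.sum_add_distrib,
      pull_cons, Finset.mul_sum, Finset.sum_mul]
    rw [Finset.sum_comm (f := fun x y => B p x * (A u y x * _)),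
      Finset.sum_comm (f := fun x y => A u x p * (C x y * _))]
    simp only [mul_assoc]
    have e : ∀ q, (fun j => pd c (fun v => ins q (T v) j) u)
        = ins q (fun j => pd c (fun v => T v j) u) := fun q => rfl
    simp only [e]
    ring

end PartialDerivatives

/-! ## The Levi-Civita connection of a metric in coordinates -/

section Coordinates

variable {n : ℕ}

/-- Smooth components on a set. -/
def SmoothOn {r : ℕ} (T : Coord n → Tensor n r) (U : Set (Coord n)) : Prop :=
  ∀ i, ContDiffOn ℝ ∞ (fun u => T u i) U

/-- Components of a smooth pseudo-Riemannian metric on an open set. -/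
structure IsMetricOn (G : Coord n → Tensor n 2) (U : Set (Coord n)) : Prop where
  isOpen : IsOpen U
  smooth : SmoothOn G U
  symm : ∀ u ∈ U, ∀ a b, G u ![a, b] = G u ![b, a]
  det : ∀ u ∈ U, IsUnit (toMatrix (G u)).det

lemma SmoothOn.differentiableAt {r : ℕ} {T : Coord n → Tensor n r} {U : Set (Coord n)}
    (hT : SmoothOn T U) (hU : IsOpen U) {u : Coord n} (hu : u ∈ U) (i : Fin r → Fin n) :
    DifferentiableAt ℝ (fun v => T v i) u :=
  differentiableAt_of_contDiffOn hU (hT i) hu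

lemma contDiffOn_det {A : Coord n → Matrix (Fin n) (Fin n) ℝ} {U : Set (Coord n)}
    (hA : ∀ p q, ContDiffOn ℝ ∞ (fun v => A v p q) U) :
    ContDiffOn ℝ ∞ (fun v => (A v).det) U := by
  simp only [Matrix.det_apply']
  refine ContDiffOn.sum fun π _ => contDiffOn_const.mul ?_
  exact contDiffOn_prod fun s _ => hA (π s) s

lemma contDiffOn_inv {A : Coord n → Matrix (Fin n) (Fin n) ℝ} {U : Set (Coord n)}
    (hA : ∀ p q, ContDiffOn ℝ ∞ (fun v => A v p q) U) (hd : ∀ u ∈ U, IsUnit (A u).det)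
    (p q : Fin n) : ContDiffOn ℝ ∞ (fun v => (A v)⁻¹ p q) U := by
  -- Cramer's rule: entries of the adjugate are determinants of matrices with one row replaced by a
  -- constant vector, hence smooth.
  have h1 : ContDiffOn ℝ ∞ (fun v => ((A v).updateRow q (Pi.single p 1)).det) U := by
    refine contDiffOn_det fun a b => ?_
    by_cases h : a = q
    · subst h
      simp only [Matrix.updateRow_self]
      exact contDiffOn_const
    · simp only [Matrix.updateRow_ne h]
      exact hA a b
  refine ((contDiffOn_det hA).inv (fun u hu => (hd u hu).ne_zero) |>.mul h1).congr fun u _ => ?_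
  simp only [Matrix.inv_def, Matrix.smul_apply, Ring.inverse_eq_inv', Matrix.adjugate_apply,
    smul_eq_mul]
  rfl

variable {G : Coord n → Tensor n 2} {U : Set (Coord n)}

lemma IsMetricOn.contDiffOn_upper (hG : IsMetricOn G U) (a b : Fin n) :
    ContDiffOn ℝ ∞ (fun u => (toMatrix (G u))⁻¹ a b) U :=
  contDiffOn_inv (fun p q => hG.smooth ![p, q]) hG.det a b

lemma IsMetricOn.contDiffOn_christoffel (hG : IsMetricOn G U) (a b c : Fin n) :
    ContDiffOn ℝ ∞ (fun u => christoffel G u a b c) U := by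
  unfold christoffel
  refine contDiffOn_const.mul (ContDiffOn.sum fun d _ => (hG.contDiffOn_upper c d).mul ?_)
  exact ((contDiffOn_pd hG.isOpen (hG.smooth _) a).add
    (contDiffOn_pd hG.isOpen (hG.smooth _) b)).sub (contDiffOn_pd hG.isOpen (hG.smooth _) d)

lemma IsMetricOn.pd_symm (hG : IsMetricOn G U) {u : Coord n} (hu : u ∈ U) (c a b : Fin n) :
    pd c (fun v => G v ![a, b]) u = pd c (fun v => G v ![b, a]) u :=
  pd_congr (by filter_upwards [hG.isOpen.mem_nhds hu] with v hv using hG.symm v hv a b)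

lemma IsMetricOn.christoffel_symm (hG : IsMetricOn G U) {u : Coord n} (hu : u ∈ U)
    (a b c : Fin n) : christoffel G u a b c = christoffel G u b a c := by
  unfold christoffel
  simp only [hG.pd_symm hu _ a b]
  congr 1
  refine Finset.sum_congr rfl fun d _ => by ring

lemma IsMetricOn.sum_upper (hG : IsMetricOn G U) {u : Coord n} (hu : u ∈ U) (X : Fin n → ℝ)
    (e : Fin n) : ∑ c, G u ![e, c] * ∑ d, (toMatrix (G u))⁻¹ c d * X d = X e := by
  have h : toMatrix (G u) * (toMatrix (G u))⁻¹ = 1 := Matrix.mul_nonsing_inv _ (hG.det u hu)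
  have := congrFun (congrArg (fun A => Matrix.mulVec A X) h) e
  rw [← Matrix.mulVec_mulVec, Matrix.one_mulVec] at this
  exact this

lemma IsMetricOn.sum_lower (hG : IsMetricOn G U) {u : Coord n} (hu : u ∈ U) (X : Fin n → ℝ)
    (c : Fin n) : ∑ d, (toMatrix (G u))⁻¹ c d * ∑ e, G u ![d, e] * X e = X c := by
  have h : (toMatrix (G u))⁻¹ * toMatrix (G u) = 1 := Matrix.nonsing_inv_mul _ (hG.det u hu)
  have := congrFun (congrArg (fun A => Matrix.mulVec A X) h) c
  rw [← Matrix.mulVec_mulVec, Matrix.one_mulVec] at this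
  exact this

lemma IsMetricOn.sum_christoffel (hG : IsMetricOn G U) {u : Coord n} (hu : u ∈ U)
    (a b e : Fin n) : ∑ c, christoffel G u a b c * G u ![c, e]
      = (1 / 2) * (pd a (fun v => G v ![b, e]) u + pd b (fun v => G v ![a, e]) u
      - pd e (fun v => G v ![a, b]) u) := by
  rw [← hG.sum_upper hu (fun d => (pd a (fun v => G v ![b, d]) u + pd b (fun v => G v ![a, d]) u
      - pd d (fun v => G v ![a, b]) u)) e, Finset.mul_sum]
  refine Finset.sum_congr rfl fun c _ => ?_
  rw [hG.symm u hu c e]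
  unfold christoffel
  ring

lemma act_two (B : Fin n → Fin n → ℝ) (T : Tensor n 2) (a b : Fin n) :
    act B T ![a, b] = ∑ p, B a p * T ![p, b] + ∑ p, B b p * T ![a, p] := by
  rw [show (![a, b] : Fin 2 → Fin n) = cons a (cons b ![]) from rfl, act_cons, act_cons,
    act_rank_zero, Pi.zero_apply, add_zero]
  rfl

/-- The Levi-Civita connection is metric. -/
lemma IsMetricOn.pd_eq_act (hG : IsMetricOn G U) {u : Coord n} (hu : u ∈ U) (c : Fin n)
    (i : Fin 2 → Fin n) : pd c (fun v => G v i) u = act (christoffel G u c) (G u) i := by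
  have : i = ![i 0, i 1] := by
    funext s
    fin_cases s <;> rfl
  rw [this, act_two]
  simp only [hG.symm u hu (i 0) _, hG.sum_christoffel hu, hG.pd_symm hu _ (i 1) (i 0)]
  ring

/-- The Levi-Civita connection is the only symmetric metric connection. -/
lemma IsMetricOn.christoffel_unique (hG : IsMetricOn G U) {u : Coord n} (hu : u ∈ U)
    (B : Fin n → Fin n → Fin n → ℝ) (hB : ∀ a b c, B a b c = B b a c)
    (h : ∀ c i, pd c (fun v => G v i) u = act (B c) (G u) i) (a b c : Fin n) :
    christoffel G u a b c = B a b c := by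
  -- Koszul's combination: of the six terms, symmetry of `B` and of the metric cancels four and
  -- makes the other two equal.
  have key : ∀ d, pd a (fun v => G v ![b, d]) u + pd b (fun v => G v ![a, d]) u
      - pd d (fun v => G v ![a, b]) u = 2 * ∑ e, G u ![d, e] * B a b e := by
    intro d
    simp only [h, act_two, hB d]
    simp only [hB b a, hG.symm u hu _ d, hG.symm u hu _ b, hG.symm u hu a, mul_comm (G u _)]
    ring
  unfold christoffel
  simp only [key]
  conv_rhs => rw [← hG.sum_lower hu (B a b) c]
  rw [Finset.mul_sum]
  refine Finset.sum_congr rfl fun d _ => by ring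

lemma coordNabla_cons {r : ℕ} (T : Coord n → Tensor n r) (u : Coord n) (c : Fin n)
    (i : Fin r → Fin n) : coordNabla G T u (cons c i)
      = pd c (fun v => T v i) u - act (christoffel G u c) (T u) i := rfl

lemma ins_coordNabla {r : ℕ} (T : Coord n → Tensor n r) (u : Coord n) (c : Fin n) :
    ins c (coordNabla G T u)
      = (fun i => pd c (fun v => T v i) u) - act (christoffel G u c) (T u) := rfl

lemma coordNabla_congr {r : ℕ} {T T' : Coord n → Tensor n r} {u : Coord n}
    (h : T =ᶠ[nhds u] T') : coordNabla G T u = coordNabla G T' u := by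
  refine tensor_ext_ins fun c => ?_
  rw [ins_coordNabla, ins_coordNabla, h.self_of_nhds]
  congr 1
  funext i
  exact pd_congr (h.mono fun v hv => congrFun hv i)

lemma contDiffOn_act {r : ℕ} {B : Coord n → Fin n → Fin n → ℝ} {T : Coord n → Tensor n r}
    (hB : ∀ p q, ContDiffOn ℝ ∞ (fun u => B u p q) U) (hT : SmoothOn T U) :
    SmoothOn (fun u => act (B u) (T u)) U := fun i => by
  unfold act
  exact ContDiffOn.sum fun s _ => ContDiffOn.sum fun p _ => (hB _ _).mul (hT _)

lemma IsMetricOn.smoothOn_coordNabla (hG : IsMetricOn G U) {r : ℕ} {T : Coord n → Tensor n r}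
    (hT : SmoothOn T U) : SmoothOn (coordNabla G T) U := fun i => by
  rw [← cons_tl i]
  simp only [coordNabla_cons]
  exact (contDiffOn_pd hG.isOpen (hT _) _).sub
    (contDiffOn_act (fun p q => hG.contDiffOn_christoffel _ p q) hT _)

lemma pd_act {r : ℕ} {B : Coord n → Fin n → Fin n → ℝ} {T : Coord n → Tensor n r} {u : Coord n}
    (hB : ∀ p q, DifferentiableAt ℝ (fun v => B v p q) u)
    (hT : ∀ i, DifferentiableAt ℝ (fun v => T v i) u) (c : Fin n) (i : Fin r → Fin n) :
    pd c (fun v => act (B v) (T v) i) u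
      = act (fun p q => pd c (fun v => B v p q) u) (T u) i
        + act (B u) (fun j => pd c (fun v => T v j) u) i := by
  unfold act
  rw [pd_sum (f := fun s v => ∑ p, B v (i s) p * T v (Function.update i s p))
    fun s _ => DifferentiableAt.fun_sum fun p _ => (hB _ _).mul (hT _),
    ← Finset.sum_add_distrib]
  refine Finset.sum_congr rfl fun s _ => ?_
  rw [pd_sum (f := fun p v => B v (i s) p * T v (Function.update i s p))
    fun p _ => (hB _ _).mul (hT _), ← Finset.sum_add_distrib]
  exact Finset.sum_congr rfl fun p _ => pd_mul (hB _ _) (hT _)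

/-- The Ricci identity. -/
lemma IsMetricOn.ricci_identity (hG : IsMetricOn G U) {u : Coord n} (hu : u ∈ U) {r : ℕ}
    {T : Coord n → Tensor n r} (hT : SmoothOn T U) (b c : Fin n) (i : Fin r → Fin n) :
    coordNabla G (coordNabla G T) u (cons b (cons c i))
      - coordNabla G (coordNabla G T) u (cons c (cons b i))
      = -act (fun a p => coordRiemann G u b c p a) (T u) i := by
  have hd := fun i => hT.differentiableAt hG.isOpen hu i
  have hΓ := fun a p q => differentiableAt_of_contDiffOn hG.isOpen
    (hG.contDiffOn_christoffel a p q) hu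
  have hpd := fun a j => differentiableAt_of_contDiffOn hG.isOpen
    (contDiffOn_pd hG.isOpen (hT j) a) hu
  have hact := fun a j => differentiableAt_of_contDiffOn hG.isOpen
    (contDiffOn_act (fun p q => hG.contDiffOn_christoffel a p q) hT j) hu
  have key : ∀ b c, coordNabla G (coordNabla G T) u (cons b (cons c i))
      = pd b (pd c (fun v => T v i)) u
        - act (fun p q => pd b (fun v => christoffel G v c p q) u) (T u) i
        - act (christoffel G u c) (fun j => pd b (fun v => T v j) u) i
        - ∑ p, christoffel G u b c p * coordNabla G T u (cons p i)
        - act (christoffel G u b) (fun j => pd c (fun v => T v j) u) i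
        + act (christoffel G u b) (act (christoffel G u c) (T u)) i := by
    intro b c
    rw [coordNabla_cons, act_cons, ins_coordNabla]
    simp only [coordNabla_cons]
    rw [pd_sub (hpd c i) (hact c i), pd_act (hΓ c) hd]
    rw [show ((fun i => pd c (fun v => T v i) u) - act (christoffel G u c) (T u))
      = (fun i => pd c (fun v => T v i) u) + (-1 : ℝ) • act (christoffel G u c) (T u) by
        rw [neg_one_smul, sub_eq_add_neg], act_add, act_smul]
    simp only [Pi.add_apply, Pi.smul_apply, smul_eq_mul]
    change pd b (pd c (fun v => T v i)) u - _ - _ = _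
    ring
  -- The curvature is the derivative of the Christoffel matrices minus their commutator in the order
  -- used here, and `act` turns matrix commutators into commutators of derivations.
  have hR : act (fun a p => coordRiemann G u b c p a) (T u)
      = act (fun p q => pd b (fun v => christoffel G v c p q) u) (T u)
        - act (fun p q => pd c (fun v => christoffel G v b p q) u) (T u)
        - (act (christoffel G u b) (act (christoffel G u c) (T u))
          - act (christoffel G u c) (act (christoffel G u b) (T u))) := by
    rw [act_act_sub]
    funext i
    simp only [act, Pi.sub_apply, ← Finset.sum_sub_distrib, ← sub_mul, coordRiemann]
    refine Finset.sum_congr rfl fun s _ => Finset.sum_congr rfl fun p _ => ?_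
    congr 1
    rw [sub_eq_add_neg _ (Finset.sum _ _), ← Finset.sum_neg_distrib]
    congr 1
    refine Finset.sum_congr rfl fun e _ => by ring
  -- Second partial derivatives commute, and the term with `Γ^p_{bc}` cancels because the connection
  -- is torsion-free.
  rw [key, key, hR, pd_pd_comm ((hT i).contDiffAt (hG.isOpen.mem_nhds hu)) b c]
  simp only [hG.christoffel_symm hu c b, Pi.sub_apply]
  ring

end Coordinates

/-! ## Covariance under changes of coordinates -/

section Covariance

variable {n : ℕ}

/-- The Jacobian matrix. -/
def jac (ψ : Coord n → Coord n) (u : Coord n) : Matrix (Fin n) (Fin n) ℝ :=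
  Matrix.of fun e c => pd c (fun v => ψ v e) u

/-- A smooth change of coordinates. -/
structure IsCoordChange (ψ : Coord n → Coord n) (U' U : Set (Coord n)) : Prop where
  isOpen : IsOpen U'
  smooth : ContDiffOn ℝ ∞ ψ U'
  mapsTo : Set.MapsTo ψ U' U
  det : ∀ u ∈ U', IsUnit (jac ψ u).det

/-- The pull-back of a tensor field by a change of coordinates. -/
def pullField (ψ : Coord n → Coord n) {r : ℕ} (T : Coord n → Tensor n r) :
    Coord n → Tensor n r := fun v => pull (jac ψ v) (T (ψ v))

variable {ψ : Coord n → Coord n} {U' U : Set (Coord n)} {G : Coord n → Tensor n 2}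

lemma IsCoordChange.contDiffOn_coord (h : IsCoordChange ψ U' U) (e : Fin n) :
    ContDiffOn ℝ ∞ (fun v => ψ v e) U' :=
  (EuclideanSpace.proj e : Coord n →L[ℝ] ℝ).contDiff.comp_contDiffOn h.smooth

lemma IsCoordChange.contDiffOn_jac (h : IsCoordChange ψ U' U) (e c : Fin n) :
    ContDiffOn ℝ ∞ (fun v => jac ψ v e c) U' :=
  contDiffOn_pd h.isOpen (h.contDiffOn_coord e) c

lemma IsCoordChange.smoothOn_comp (h : IsCoordChange ψ U' U) {r : ℕ} {T : Coord n → Tensor n r}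
    (hT : SmoothOn T U) : SmoothOn (fun v => T (ψ v)) U' := fun i =>
  (hT i).comp h.smooth h.mapsTo

lemma IsCoordChange.smoothOn_pullField (h : IsCoordChange ψ U' U) {r : ℕ}
    {T : Coord n → Tensor n r} (hT : SmoothOn T U) : SmoothOn (pullField ψ T) U' :=
  contDiffOn_pull h.contDiffOn_jac (h.smoothOn_comp hT)

lemma IsCoordChange.differentiableAt (h : IsCoordChange ψ U' U) {v : Coord n} (hv : v ∈ U') :
    DifferentiableAt ℝ ψ v :=
  (h.smooth.contDiffAt (h.isOpen.mem_nhds hv)).differentiableAt (by simp)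

lemma IsCoordChange.isMetricOn (h : IsCoordChange ψ U' U) (hG : IsMetricOn G U) :
    IsMetricOn (pullField ψ G) U' where
  isOpen := h.isOpen
  smooth := h.smoothOn_pullField hG.smooth
  symm u hu a b := by
    unfold pullField
    rw [pull_two, pull_two, Finset.sum_comm]
    refine Finset.sum_congr rfl fun p _ => Finset.sum_congr rfl fun q _ => ?_
    rw [hG.symm _ (h.mapsTo hu) q p]
    ring
  det u hu := by
    unfold pullField
    rw [toMatrix_pull, Matrix.det_mul, Matrix.det_mul, Matrix.det_transpose]
    exact ((h.det u hu).mul (hG.det _ (h.mapsTo hu))).mul (h.det u hu)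

lemma IsCoordChange.pd_jac_comm (h : IsCoordChange ψ U' U) {v : Coord n} (hv : v ∈ U')
    (a b e : Fin n) : pd a (fun w => jac ψ w e b) v = pd b (fun w => jac ψ w e a) v :=
  pd_pd_comm ((h.contDiffOn_coord e).contDiffAt (h.isOpen.mem_nhds hv)) a b

lemma IsCoordChange.sum_jac_inv (h : IsCoordChange ψ U' U) {v : Coord n} (hv : v ∈ U')
    (X : Fin n → ℝ) (q : Fin n) : ∑ s, (∑ r, (jac ψ v)⁻¹ s r * X r) * jac ψ v q s = X q := by
  have h1 : jac ψ v * (jac ψ v)⁻¹ = 1 := Matrix.mul_nonsing_inv _ (h.det v hv)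
  have := congrFun (congrArg (fun A => Matrix.mulVec A X) h1) q
  rw [← Matrix.mulVec_mulVec, Matrix.one_mulVec] at this
  rw [← this]
  simp only [Matrix.mulVec, dotProduct]
  exact Finset.sum_congr rfl fun s _ => mul_comm _ _

/-- The derivative of the Jacobian in terms of two connections. -/
lemma pd_pullField_of (h : IsCoordChange ψ U' U) {v : Coord n} (hv : v ∈ U') (c : Fin n)
    (Γ B : Fin n → Fin n → Fin n → ℝ)
    (hB : ∀ q p, pd c (fun w => jac ψ w q p) v + ∑ e, ∑ s, jac ψ v e c * jac ψ v s p * Γ e s q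
      = ∑ s, B c p s * jac ψ v q s)
    {r : ℕ} {T : Coord n → Tensor n r} (hU : IsOpen U) (hT : SmoothOn T U) (i : Fin r → Fin n) :
    pd c (fun w => pullField ψ T w i) v
      = ∑ e, jac ψ v e c * pull (jac ψ v)
          ((fun j => pd e (fun w => T w j) (ψ v)) - act (Γ e) (T (ψ v))) i
        + act (B c) (pullField ψ T v) i := by
  -- The old connection enters with a minus sign as the derivation of the old components and the new
  -- one as the derivation of the new components; `hB` is precisely the required splitting of the
  -- derivative of the Jacobian.
  have h1 := pd_pull (jac ψ) (u := v) (c := c)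
    (fun p q => differentiableAt_of_contDiffOn h.isOpen (h.contDiffOn_jac p q) hv) (B c)
    (fun s q => ∑ e, jac ψ v e c * -Γ e s q) (fun q p => by
      rw [← hB]
      simp only [mul_neg, Finset.sum_neg_distrib, Finset.mul_sum]
      rw [Finset.sum_comm (f := fun s e => jac ψ v s p * _)]
      simp only [mul_left_comm (jac ψ v _ p), mul_assoc]
      ring) (fun w => T (ψ w))
    (fun i => (h.smoothOn_comp hT).differentiableAt h.isOpen hv i) i
  unfold pullField
  rw [h1]
  congr 1
  rw [act_sum_left]
  have h2 : ((fun j => pd c (fun w => T (ψ w) j) v) : Tensor n r)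
      = ∑ e, jac ψ v e c • (fun j => pd e (fun w => T w j) (ψ v)) := by
    funext j
    rw [pd_comp (hT.differentiableAt hU (h.mapsTo hv) j) (h.differentiableAt hv)]
    simp only [Finset.sum_apply, Pi.smul_apply, smul_eq_mul]
    rfl
  rw [h2, ← Finset.sum_add_distrib, pull_sum, Finset.sum_apply]
  refine Finset.sum_congr rfl fun e _ => ?_
  rw [← smul_add, act_neg_left (Γ e), pull_smul, ← sub_eq_add_neg]
  rfl

/-- The transformation law of the Christoffel symbols. -/
lemma IsCoordChange.christoffel (h : IsCoordChange ψ U' U) (hG : IsMetricOn G U) {v : Coord n}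
    (hv : v ∈ U') (c p q : Fin n) :
    pd c (fun w => jac ψ w q p) v
        + ∑ e, ∑ s, jac ψ v e c * jac ψ v s p * christoffel G (ψ v) e s q
      = ∑ s, christoffel (pullField ψ G) v c p s * jac ψ v q s := by
  set X : Fin n → Fin n → Fin n → ℝ := fun c p q => pd c (fun w => jac ψ w q p) v
        + ∑ e, ∑ s, jac ψ v e c * jac ψ v s p * ConformalKilling.christoffel G (ψ v) e s q with hX
  have hs : ∀ a b c, X a b c = X b a c := by
    intro a b c
    simp only [hX]
    rw [h.pd_jac_comm hv a b c, Finset.sum_comm]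
    congr 1
    refine Finset.sum_congr rfl fun e _ => Finset.sum_congr rfl fun s _ => ?_
    rw [hG.christoffel_symm (h.mapsTo hv) s e]
    ring
  -- The coefficients given by the transformation law are symmetric by `hs` and preserve the
  -- pulled-back metric, since the old connection preserves the old metric. Uniqueness identifies
  -- them with its Christoffel symbols.
  have hu := (h.isMetricOn hG).christoffel_unique hv
    (fun c p s => ∑ r, (jac ψ v)⁻¹ s r * X c p r) (fun a b c => by simp only [hs a b])
    (fun c i => by
      rw [pd_pullField_of h hv c (ConformalKilling.christoffel G (ψ v))
        (fun c p s => ∑ r, (jac ψ v)⁻¹ s r * X c p r)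
        (fun q p => (h.sum_jac_inv hv (X c p) q).symm) hG.isOpen hG.smooth]
      have : ∀ e, ((fun j => pd e (fun w => G w j) (ψ v))
          - act (ConformalKilling.christoffel G (ψ v) e) (G (ψ v)) : Tensor n 2) = 0 := by
        intro e
        funext j
        simp [hG.pd_eq_act (h.mapsTo hv)]
      simp [this, pull_zero])
  simp only [hu]
  exact (h.sum_jac_inv hv (X c p) q).symm

/-- Covariance of the Levi-Civita derivative. -/
lemma IsCoordChange.coordNabla_pullField (h : IsCoordChange ψ U' U) (hG : IsMetricOn G U)
    {r : ℕ} {T : Coord n → Tensor n r} (hT : SmoothOn T U) {v : Coord n} (hv : v ∈ U') :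
    coordNabla (pullField ψ G) (pullField ψ T) v = pullField ψ (coordNabla G T) v := by
  refine tensor_ext_ins fun c => ?_
  funext i
  rw [ins_coordNabla, Pi.sub_apply]
  rw [pd_pullField_of h hv c (ConformalKilling.christoffel G (ψ v))
    (ConformalKilling.christoffel (pullField ψ G) v) (fun q p => h.christoffel hG hv c p q)
    hG.isOpen hT, add_sub_cancel_right]
  simp only [ins, pullField, pull_cons]
  rfl

/-- The curvature with all indices down. -/
def coordRiemannLower (G : Coord n → Tensor n 2) (u : Coord n) : Tensor n 4 := fun i =>
  ∑ e, G u ![i 2, e] * coordRiemann G u (i 0) (i 1) e (i 3)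

lemma act_one (B : Fin n → Fin n → ℝ) (T : Tensor n 1) (a : Fin n) :
    act B T ![a] = ∑ p, B a p * T ![p] := by
  rw [show (![a] : Fin 1 → Fin n) = cons a ![] from rfl, act_cons, act_rank_zero, Pi.zero_apply,
    add_zero]

lemma pull_tensor_one (A : Matrix (Fin n) (Fin n) ℝ) (T : Tensor n 1) (a : Fin n) :
    pull A T ![a] = ∑ p, A p a * T ![p] := by
  rw [show (![a] : Fin 1 → Fin n) = cons a ![] from rfl, pull_cons]
  simp only [pull_rank_zero]
  rfl

lemma smoothOn_const {r : ℕ} (T : Tensor n r) : SmoothOn (fun _ => T) U := fun _ =>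
  contDiffOn_const

/-- Covariance of the curvature. -/
lemma IsCoordChange.coordRiemann (h : IsCoordChange ψ U' U) (hG : IsMetricOn G U) {v : Coord n}
    (hv : v ∈ U') (a b d q : Fin n) :
    ∑ p, coordRiemann (pullField ψ G) v a b p d * jac ψ v q p
      = ∑ e, jac ψ v e a * ∑ f, jac ψ v f b * ∑ s, jac ψ v s d
          * coordRiemann G (ψ v) e f q s := by
  -- A constant coordinate covector. The Ricci identities for it and for its pull-back are related
  -- by covariance of the second derivative, so the transformation law of the Christoffel symbols
  -- need not be differentiated.
  set η : Tensor n 1 := fun i => if i 0 = q then 1 else 0 with hη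
  have hη' : ∀ p, η ![p] = if p = q then 1 else 0 := fun p => rfl
  have hs : SmoothOn (fun _ => η) U := smoothOn_const η
  have hG' := h.isMetricOn hG
  have h1 := hG'.ricci_identity hv (h.smoothOn_pullField hs) a b ![d]
  have h2 : coordNabla (pullField ψ G) (coordNabla (pullField ψ G) (pullField ψ fun _ => η)) v
      = pullField ψ (coordNabla G (coordNabla G fun _ => η)) v := by
    rw [← h.coordNabla_pullField hG (hG.smoothOn_coordNabla hs) hv]
    refine coordNabla_congr ?_
    filter_upwards [h.isOpen.mem_nhds hv] with w hw using h.coordNabla_pullField hG hs hw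
  have h3 : ∀ e f s, coordNabla G (coordNabla G fun _ => η) (ψ v) (cons e (cons f ![s]))
      - coordNabla G (coordNabla G fun _ => η) (ψ v) (cons f (cons e ![s]))
      = -ConformalKilling.coordRiemann G (ψ v) e f q s := by
    intro e f s
    rw [hG.ricci_identity (h.mapsTo hv) hs, act_one]
    simp [hη']
  rw [h2, act_one] at h1
  unfold pullField at h1
  simp only [pull_tensor_one, hη', mul_ite, mul_one, mul_zero, Finset.sum_ite_eq', Finset.mem_univ,
    if_true] at h1
  rw [← neg_inj]
  unfold pullField
  rw [← h1]
  simp only [pull_cons, pull_rank_zero]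
  simp only [Finset.mul_sum]
  rw [Finset.sum_comm (f := fun x y => ∑ z, jac ψ v x b * _), ← Finset.sum_sub_distrib,
    ← Finset.sum_neg_distrib]
  refine Finset.sum_congr rfl fun e _ => ?_
  rw [← Finset.sum_sub_distrib, ← Finset.sum_neg_distrib]
  refine Finset.sum_congr rfl fun f _ => ?_
  rw [← Finset.sum_sub_distrib, ← Finset.sum_neg_distrib]
  refine Finset.sum_congr rfl fun s _ => ?_
  have := h3 e f s
  simp only [ins]
  linear_combination (jac ψ v e a * jac ψ v s d * jac ψ v f b) * this

lemma IsCoordChange.coordRiemannLower (h : IsCoordChange ψ U' U) (hG : IsMetricOn G U)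
    {v : Coord n} (hv : v ∈ U') : ConformalKilling.coordRiemannLower (pullField ψ G) v
      = pullField ψ (ConformalKilling.coordRiemannLower G) v := by
  funext i
  have hi : i = cons (i 0) (cons (i 1) (cons (i 2) ![i 3])) := by
    funext s
    fin_cases s <;> rfl
  generalize i 0 = a, i 1 = b, i 2 = c, i 3 = d at hi
  subst hi
  have e1 : ∀ x, pullField ψ G v ![c, x] = ∑ p, ∑ q, jac ψ v p c * (jac ψ v q x
      * G (ψ v) ![p, q]) := fun x => pull_two _ _ _ _
  have e2 := h.coordRiemann hG hv a b d
  show ∑ e, pullField ψ G v ![c, e] * ConformalKilling.coordRiemann (pullField ψ G) v a b e d = _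
  have e3 : ∑ e, pullField ψ G v ![c, e] * ConformalKilling.coordRiemann (pullField ψ G) v a b e d
      = ∑ p, ∑ q, jac ψ v p c * G (ψ v) ![p, q]
        * ∑ e, ConformalKilling.coordRiemann (pullField ψ G) v a b e d * jac ψ v q e := by
    simp only [e1, Finset.sum_mul, Finset.mul_sum]
    rw [Finset.sum_comm]
    refine Finset.sum_congr rfl fun p _ => ?_
    rw [Finset.sum_comm]
    refine Finset.sum_congr rfl fun q _ => Finset.sum_congr rfl fun e _ => by ring
  rw [e3]
  simp only [e2]
  unfold pullField
  simp only [pull_cons, pull_rank_zero]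
  have e4 : ∀ e f p s, ins s (ins p (ins f (ins e (ConformalKilling.coordRiemannLower G (ψ v))))) ![]
      = ∑ q, G (ψ v) ![p, q] * ConformalKilling.coordRiemann G (ψ v) e f q s :=
    fun e f p s => rfl
  simp only [e4, Finset.mul_sum]
  rw [show ∀ F : Fin n → Fin n → Fin n → Fin n → Fin n → ℝ,
    (∑ p, ∑ q, ∑ e, ∑ f, ∑ s, F p q e f s) = ∑ e, ∑ f, ∑ p, ∑ s, ∑ q, F p q e f s from fun F => by
      calc _ = ∑ p, ∑ e, ∑ f, ∑ s, ∑ q, F p q e f s := by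
            refine Finset.sum_congr rfl fun p _ => ?_
            rw [Finset.sum_comm]
            refine Finset.sum_congr rfl fun e _ => ?_
            rw [Finset.sum_comm]
            refine Finset.sum_congr rfl fun f _ => ?_
            rw [Finset.sum_comm]
        _ = _ := by
            rw [Finset.sum_comm]
            refine Finset.sum_congr rfl fun e _ => ?_
            rw [Finset.sum_comm]]
  refine Finset.sum_congr rfl fun e _ => Finset.sum_congr rfl fun f _ =>
    Finset.sum_congr rfl fun p _ => Finset.sum_congr rfl fun s _ =>
    Finset.sum_congr rfl fun q _ => by ring

lemma IsMetricOn.smoothOn_coordRiemannLower (hG : IsMetricOn G U) :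
    SmoothOn (ConformalKilling.coordRiemannLower G) U := fun i => by
  unfold ConformalKilling.coordRiemannLower ConformalKilling.coordRiemann
  refine ContDiffOn.sum fun e _ => (hG.smooth _).mul ?_
  refine ((contDiffOn_pd hG.isOpen (hG.contDiffOn_christoffel _ _ _) _).sub
    (contDiffOn_pd hG.isOpen (hG.contDiffOn_christoffel _ _ _) _)).add
    (ContDiffOn.sum fun f _ => ?_)
  exact ((hG.contDiffOn_christoffel _ _ _).mul (hG.contDiffOn_christoffel _ _ _)).sub
    ((hG.contDiffOn_christoffel _ _ _).mul (hG.contDiffOn_christoffel _ _ _))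

end Covariance

/-! ## Tensor fields in charts -/

section Charts

variable {n : ℕ} {M : Type*} [TopologicalSpace M] [ChartedSpace (Coord n) M]

/-- The change of coordinates from the chart at `y` to the chart at `x`. -/
def transition (x y : M) : Coord n → Coord n := extChartAt (𝓡 n) x ∘ (extChartAt (𝓡 n) y).symm

/-- The domain of `transition x y`. -/
def overlap (x y : M) : Set (Coord n) :=
  ((extChartAt (𝓡 n) y).symm.trans (extChartAt (𝓡 n) x)).source

lemma mem_overlap {x y : M} {v : Coord n} : v ∈ overlap x y ↔
    v ∈ (extChartAt (𝓡 n) y).target ∧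
      (extChartAt (𝓡 n) y).symm v ∈ (extChartAt (𝓡 n) x).source := by
  simp [overlap, PartialEquiv.trans_source]

lemma isOpen_overlap (x y : M) : IsOpen (overlap (n := n) x y) := by
  have := (continuousOn_extChartAt_symm (I := 𝓡 n) y).isOpen_inter_preimage
    (isOpen_extChartAt_target y) (isOpen_extChartAt_source (I := 𝓡 n) x)
  have h : overlap (n := n) x y = (extChartAt (𝓡 n) y).target ∩
      (extChartAt (𝓡 n) y).symm ⁻¹' (extChartAt (𝓡 n) x).source :=
    Set.ext fun v => mem_overlap
  rw [h]
  exact this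

lemma target_mem_nhds (x : M) :
    (extChartAt (𝓡 n) x).target ∈ nhds (extChartAt (𝓡 n) x x) :=
  extChartAt_target_mem_nhds x

lemma self_mem_overlap {x y : M} (hy : y ∈ (extChartAt (𝓡 n) x).source) :
    extChartAt (𝓡 n) y y ∈ overlap x y := by
  rw [mem_overlap, extChartAt_to_inv]
  exact ⟨mem_extChartAt_target y, hy⟩

variable [IsManifold (𝓡 n) ∞ M]

/-- The Jacobian matrix of the change from the chart at `x` to the preferred chart. -/
def chartJac (x : M) (u : Coord n) : Matrix (Fin n) (Fin n) ℝ :=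
  Matrix.of fun e i => (tangentCoordChange (𝓡 n) x ((extChartAt (𝓡 n) x).symm u)
      ((extChartAt (𝓡 n) x).symm u) (stdVec i) : Coord n) e

lemma inChart_eq_pull {r : ℕ} (x : M) (T : TensorField n M r) (u : Coord n) :
    inChart x T u = pull (chartJac x u) (T ((extChartAt (𝓡 n) x).symm u)) := rfl

/-- Smoothness in one chart. -/
def SmoothIn {r : ℕ} (x : M) (T : TensorField n M r) : Prop :=
  SmoothOn (inChart x T) (extChartAt (𝓡 n) x).target

lemma isSmooth_iff {r : ℕ} {T : TensorField n M r} : IsSmooth T ↔ ∀ x, SmoothIn x T := Iff.rfl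

/-- The model has no boundary, so the derivative within the range used for tangent coordinate
changes is the ordinary one. -/
lemma jac_eq {x y : M} {v : Coord n} (hv : v ∈ overlap x y) (e c : Fin n) :
    jac (transition x y) v e c
      = (tangentCoordChange (𝓡 n) y x ((extChartAt (𝓡 n) y).symm v) (stdVec c) : Coord n) e := by
  rw [mem_overlap] at hv
  have hd : DifferentiableAt ℝ (transition x y) v := by
    have h1 := contDiffOn_ext_coord_change (n := ∞) (I := 𝓡 n) x y
    have h2 : ContDiffWithinAt ℝ ∞ (transition x y) (Set.range (𝓡 n)) v :=
      contDiffWithinAt_ext_coord_change x y (by simpa [PartialEquiv.trans_source] using hv)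
    rw [ModelWithCorners.range_eq_univ, contDiffWithinAt_univ] at h2
    exact h2.differentiableAt (by simp)
  rw [tangentCoordChange_def, ModelWithCorners.range_eq_univ, fderivWithin_univ,
    (extChartAt (𝓡 n) y).right_inv hv.1]
  exact (fderiv_apply_coord hd).symm

lemma tangent_mul {w x y : M} {z : M}
    (h : z ∈ (extChartAt (𝓡 n) w).source ∩ (extChartAt (𝓡 n) x).source
      ∩ (extChartAt (𝓡 n) y).source) (e c : Fin n) :
    ∑ f, (tangentCoordChange (𝓡 n) x y z (stdVec f) : Coord n) e
        * (tangentCoordChange (𝓡 n) w x z (stdVec c) : Coord n) f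
      = (tangentCoordChange (𝓡 n) w y z (stdVec c) : Coord n) e := by
  rw [← tangentCoordChange_comp h, clm_eq_sum (tangentCoordChange (𝓡 n) x y z)]
  simp [mul_comm]

lemma tangent_self {x z : M} (h : z ∈ (extChartAt (𝓡 n) x).source) (e c : Fin n) :
    (tangentCoordChange (𝓡 n) x x z (stdVec c) : Coord n) e = if e = c then 1 else 0 := by
  rw [tangentCoordChange_self h]
  simp [stdVec]

lemma chartJac_self (x : M) : chartJac x (extChartAt (𝓡 n) x x) = 1 := by
  ext e c
  simp only [chartJac, Matrix.of_apply, extChartAt_to_inv]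
  rw [tangent_self (mem_extChartAt_source x), Matrix.one_apply]

/-- Components are stored with respect to the preferred chart of each point, so at its own base
point the chart expression involves the identity Jacobian. -/
lemma inChart_self {r : ℕ} (x : M) (T : TensorField n M r) :
    inChart x T (extChartAt (𝓡 n) x x) = T x := by
  rw [inChart_eq_pull, chartJac_self, pull_one, extChartAt_to_inv]

lemma isUnit_det_chartJac {x : M} {u : Coord n} (hu : u ∈ (extChartAt (𝓡 n) x).target) :
    IsUnit (chartJac x u).det := by
  set z := (extChartAt (𝓡 n) x).symm u with hz
  have hzx : z ∈ (extChartAt (𝓡 n) x).source := (extChartAt (𝓡 n) x).map_target hu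
  refine (Matrix.isUnit_iff_isUnit_det _).1 (IsUnit.of_mul_eq_one
    (Matrix.of fun e i => (tangentCoordChange (𝓡 n) z x z (stdVec i) : Coord n) e) ?_)
  ext e c
  rw [Matrix.mul_apply]
  simp only [chartJac, Matrix.of_apply]
  rw [tangent_mul ⟨⟨mem_extChartAt_source z, hzx⟩, mem_extChartAt_source z⟩,
    tangent_self (mem_extChartAt_source z), Matrix.one_apply]

lemma isCoordChange_transition (x y : M) :
    IsCoordChange (transition x y) (overlap x y) (extChartAt (𝓡 n) x).target where
  isOpen := isOpen_overlap x y
  smooth := contDiffOn_ext_coord_change (n := ∞) (I := 𝓡 n) x y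
  mapsTo v hv := (extChartAt (𝓡 n) x).map_source (mem_overlap.1 hv).2
  det v hv := by
    have hv' := mem_overlap.1 hv
    set z := (extChartAt (𝓡 n) y).symm v with hz
    have hzy : z ∈ (extChartAt (𝓡 n) y).source := (extChartAt (𝓡 n) y).map_target hv'.1
    refine (Matrix.isUnit_iff_isUnit_det _).1 (IsUnit.of_mul_eq_one
      (Matrix.of fun e i => (tangentCoordChange (𝓡 n) x y z (stdVec i) : Coord n) e) ?_)
    ext e c
    rw [Matrix.mul_apply]
    simp only [jac_eq hv, Matrix.of_apply]
    rw [tangent_mul ⟨⟨hv'.2, hzy⟩, hv'.2⟩, tangent_self hv'.2, Matrix.one_apply]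

lemma inChart_eq_pullField {r : ℕ} (x y : M) (T : TensorField n M r) {v : Coord n}
    (hv : v ∈ overlap x y) : inChart y T v = pullField (transition x y) (inChart x T) v := by
  have hv' := mem_overlap.1 hv
  have hz : (extChartAt (𝓡 n) x).symm (transition x y v) = (extChartAt (𝓡 n) y).symm v :=
    (extChartAt (𝓡 n) x).left_inv hv'.2
  rw [inChart_eq_pull, pullField, inChart_eq_pull, hz, pull_mul]
  congr 1
  ext e c
  rw [Matrix.mul_apply]
  simp only [jac_eq hv]
  simp only [chartJac, Matrix.of_apply, hz]
  rw [tangent_mul ⟨⟨(extChartAt (𝓡 n) y).map_target hv'.1, hv'.2⟩, mem_extChartAt_source _⟩]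

/-- A field with a coordinate expression which is covariant has this expression in all charts. -/
lemma inChart_of_covariant {r : ℕ} {x : M} {S : TensorField n M r} {F : M → Coord n → Tensor n r}
    (hF : ∀ y, S y = F y (extChartAt (𝓡 n) y y))
    (h : ∀ y ∈ (extChartAt (𝓡 n) x).source, F y (extChartAt (𝓡 n) y y)
      = pullField (transition x y) (F x) (extChartAt (𝓡 n) y y))
    {u : Coord n} (hu : u ∈ (extChartAt (𝓡 n) x).target) : inChart x S u = F x u := by
  set y := (extChartAt (𝓡 n) x).symm u with hy
  have hyx : y ∈ (extChartAt (𝓡 n) x).source := (extChartAt (𝓡 n) x).map_target hu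
  have hv := self_mem_overlap hyx
  have ht : transition x y (extChartAt (𝓡 n) y y) = u := by
    simp only [transition, Function.comp, extChartAt_to_inv]
    exact (extChartAt (𝓡 n) x).right_inv hu
  rw [inChart_eq_pull, ← hy, hF, h y hyx, pullField, ht, pull_mul]
  -- The two Jacobians belong to opposite changes between the charts at `x` and at `y`, so they are
  -- inverse to each other by the cocycle rule.
  have h1 : chartJac x u * jac (transition x y) (extChartAt (𝓡 n) y y) = 1 := by
    ext e c
    rw [Matrix.mul_apply]
    simp only [jac_eq hv]
    simp only [chartJac, Matrix.of_apply, extChartAt_to_inv, ← hy]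
    rw [tangent_mul ⟨⟨mem_extChartAt_source _, hyx⟩, mem_extChartAt_source _⟩,
      tangent_self (mem_extChartAt_source _), Matrix.one_apply]
  rw [mul_eq_one_comm.1 h1, pull_one]

end Charts

/-! ### Metrics, covariant derivatives and curvature of a manifold in arbitrary charts. -/

section MetricCharts

variable {n : ℕ} {M : Type*} [TopologicalSpace M] [ChartedSpace (Coord n) M]
  [IsManifold (𝓡 n) ∞ M]

namespace Metric

variable (g : Metric n M)

lemma lower_symm (x : M) (a b : Fin n) : g.lower x a b = g.lower x b a := g.symm x _ _

/-- A vector in the kernel of the Gram matrix is orthogonal to every tangent vector, hence zero by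
nondegeneracy. -/
lemma isUnit_det (x : M) : IsUnit (toMatrix (g.comp x)).det := by
  rw [← Matrix.isUnit_iff_isUnit_det, ← Matrix.mulVec_injective_iff_isUnit]
  refine (injective_iff_map_eq_zero (Matrix.mulVecLin (toMatrix (g.comp x)))).2 fun w hw => ?_
  have h0 : (∑ b, w b • tangentVec x b : TangentSpace (𝓡 n) x) = 0 := by
    refine g.nondegenerate x _ fun v => ?_
    obtain ⟨w', hv⟩ : ∃ w' : Coord n, v = ∑ a, w' a • tangentVec x a := ⟨v, coord_eq_sum (n := n) v⟩
    rw [hv, map_sum]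
    refine Finset.sum_eq_zero fun a _ => ?_
    have h2 : ∑ b, g.val x (tangentVec x a) (tangentVec x b) * w b = 0 := congrFun hw a
    rw [map_smul, g.symm, map_sum]
    simp only [map_smul, smul_eq_mul]
    simp only [mul_comm (w _), h2, mul_zero]
  have h1 : (∑ b, w b • stdVec b : Coord n) = 0 := h0
  funext b
  have := congrArg (fun v : Coord n => v b) h1
  simpa [stdVec, Pi.single_apply] using this

lemma isMetricOn (x : M) : IsMetricOn (inChart x g.comp) (extChartAt (𝓡 n) x).target where
  isOpen := isOpen_extChartAt_target x
  smooth := g.smooth x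
  symm u _ a b := by
    rw [inChart_eq_pull, pull_two, pull_two, Finset.sum_comm]
    refine Finset.sum_congr rfl fun p _ => Finset.sum_congr rfl fun q _ => ?_
    rw [show ∀ y, g.comp y ![q, p] = g.comp y ![p, q] from fun y => g.lower_symm y q p]
    ring
  det u hu := by
    rw [inChart_eq_pull, toMatrix_pull, Matrix.det_mul, Matrix.det_mul, Matrix.det_transpose]
    exact ((isUnit_det_chartJac hu).mul (g.isUnit_det _)).mul (isUnit_det_chartJac hu)

lemma inChart_comp_eventuallyEq {x y : M} (hy : y ∈ (extChartAt (𝓡 n) x).source) {r : ℕ}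
    (T : TensorField n M r) : inChart y T =ᶠ[nhds (extChartAt (𝓡 n) y y)]
      pullField (transition x y) (inChart x T) := by
  filter_upwards [(isOpen_overlap x y).mem_nhds (self_mem_overlap hy)] with v hv
  exact inChart_eq_pullField x y T hv

end Metric

lemma christoffel_congr {G G' : Coord n → Tensor n 2} {u : Coord n} (h : G =ᶠ[nhds u] G')
    (a b c : Fin n) : christoffel G u a b c = christoffel G' u a b c := by
  have h1 : ∀ a i, pd a (fun v => G v i) u = pd a (fun v => G' v i) u := fun a i =>
    pd_congr (h.mono fun v hv => congrFun hv i)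
  unfold christoffel
  simp only [h1, h.self_of_nhds]

lemma coordNabla_congr_metric {G G' : Coord n → Tensor n 2} {u : Coord n} (h : G =ᶠ[nhds u] G')
    {r : ℕ} (T : Coord n → Tensor n r) : coordNabla G T u = coordNabla G' T u := by
  refine tensor_ext_ins fun c => ?_
  rw [ins_coordNabla, ins_coordNabla]
  congr 2
  funext a b
  exact christoffel_congr h c a b

lemma coordRiemann_congr {G G' : Coord n → Tensor n 2} {u : Coord n} (h : G =ᶠ[nhds u] G')
    (a b c d : Fin n) : coordRiemann G u a b c d = coordRiemann G' u a b c d := by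
  have h1 : ∀ a b c d, pd a (fun v => christoffel G v b c d) u
      = pd a (fun v => christoffel G' v b c d) u := fun a b c d =>
    pd_congr (h.eventuallyEq_nhds.mono fun v hv => christoffel_congr hv b c d)
  unfold coordRiemann
  simp only [h1, christoffel_congr h]

namespace Metric

variable (g : Metric n M)

/-- The covariant derivative in any chart. -/
lemma inChart_nabla {r : ℕ} {x : M} {T : TensorField n M r} (hT : SmoothIn x T) {u : Coord n}
    (hu : u ∈ (extChartAt (𝓡 n) x).target) :
    inChart x (g.nabla T) u = coordNabla (inChart x g.comp) (inChart x T) u := by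
  refine inChart_of_covariant (F := fun y => coordNabla (inChart y g.comp) (inChart y T))
    (fun y => rfl) (fun y hy => ?_) hu
  rw [coordNabla_congr (inChart_comp_eventuallyEq hy T),
    coordNabla_congr_metric (inChart_comp_eventuallyEq hy g.comp),
    (isCoordChange_transition x y).coordNabla_pullField (g.isMetricOn x) hT (self_mem_overlap hy)]

lemma smoothIn_nabla {r : ℕ} {x : M} {T : TensorField n M r} (hT : SmoothIn x T) :
    SmoothIn x (g.nabla T) := fun i =>
  ((g.isMetricOn x).smoothOn_coordNabla hT i).congr fun u hu => by rw [g.inChart_nabla hT hu]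

/-- `R_{abcd}` as a tensor field. -/
def curv : TensorField n M 4 := fun x i => g.riemannLower x (i 0) (i 1) (i 2) (i 3)

lemma inChart_curv {x : M} {u : Coord n} (hu : u ∈ (extChartAt (𝓡 n) x).target) :
    inChart x g.curv u = coordRiemannLower (inChart x g.comp) u := by
  refine inChart_of_covariant (F := fun y => coordRiemannLower (inChart y g.comp))
    (fun y => ?_) (fun y hy => ?_) hu
  · funext i
    simp only [curv, riemannLower, coordRiemannLower, inChart_self]
    rfl
  · rw [← (isCoordChange_transition x y).coordRiemannLower (g.isMetricOn x) (self_mem_overlap hy)]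
    funext i
    have := inChart_comp_eventuallyEq hy g.comp
    simp only [coordRiemannLower, coordRiemann_congr this, this.self_of_nhds]

lemma smoothIn_curv (x : M) : SmoothIn x g.curv := fun i =>
  ((g.isMetricOn x).smoothOn_coordRiemannLower i).congr fun u hu => by rw [g.inChart_curv hu]

lemma nabla_congr {r : ℕ} {x : M} {S T : TensorField n M r}
    (h : ∀ u ∈ (extChartAt (𝓡 n) x).target, inChart x S u = inChart x T u) :
    g.nabla S x = g.nabla T x := by
  refine coordNabla_congr ?_
  filter_upwards [target_mem_nhds x] with u hu using h u hu

/-- The Ricci identity. -/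
lemma ricci_identity {r : ℕ} {x : M} {T : TensorField n M r} (hT : SmoothIn x T) (b c : Fin n)
    (i : Fin r → Fin n) :
    g.nabla (g.nabla T) x (cons b (cons c i)) - g.nabla (g.nabla T) x (cons c (cons b i))
      = -act (fun a p => g.riemann x b c p a) (T x) i := by
  have h1 : g.nabla (g.nabla T) x = coordNabla (inChart x g.comp)
      (coordNabla (inChart x g.comp) (inChart x T)) (extChartAt (𝓡 n) x x) := by
    refine coordNabla_congr ?_
    filter_upwards [target_mem_nhds x] with u hu using g.inChart_nabla hT hu
  rw [h1, (g.isMetricOn x).ricci_identity (mem_extChartAt_target x) hT, inChart_self]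
  rfl

end Metric

end MetricCharts

/-! ## Natural operations on arrays -/

section Operations

variable {n : ℕ}

lemma pull_reindex (A : Matrix (Fin n) (Fin n) ℝ) {r : ℕ} (T : Tensor n r)
    (π : Equiv.Perm (Fin r)) (i : Fin r → Fin n) :
    pull A (fun j => T (fun s => j (π s))) i = pull A T (fun s => i (π s)) := by
  unfold pull
  rw [← (Equiv.arrowCongr π (Equiv.refl (Fin n))).sum_comp]
  refine Finset.sum_congr rfl fun j _ => ?_
  congr 1
  · show T _ = T _
    congr 1
    funext s
    simp
  · rw [← Equiv.prod_comp π]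
    simp

/-- Skewing is a combination of permutations of the slots, and a change of frame treats all slots
alike. -/
lemma pull_skew (A : Matrix (Fin n) (Fin n) ℝ) {r : ℕ} (T : Tensor n r) :
    pull A (skew T) = skew (pull A T) := by
  have : skew T = ((Nat.factorial r : ℕ) : ℝ)⁻¹ • ∑ π : Equiv.Perm (Fin r),
      ((Equiv.Perm.sign π : ℤ) : ℝ) • (fun j => T (fun s => j (π s))) := by
    funext i
    simp [skew]
  rw [this, pull_smul, pull_sum]
  funext i
  simp only [Pi.smul_apply, Finset.sum_apply, pull_smul, pull_reindex, smul_eq_mul]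
  rfl

/-- Skew-symmetrisation over all indices but the first. -/
def tailSkew {r : ℕ} (T : Tensor n (r + 1)) : Tensor n (r + 1) := fun i => skew (ins (i 0) T) (tl i)

lemma ins_tailSkew {r : ℕ} (T : Tensor n (r + 1)) (c : Fin n) :
    ins c (tailSkew T) = skew (ins c T) := rfl

lemma pull_tailSkew (A : Matrix (Fin n) (Fin n) ℝ) {r : ℕ} (T : Tensor n (r + 1)) :
    pull A (tailSkew T) = tailSkew (pull A T) := by
  refine tensor_ext_ins fun p => ?_
  rw [ins_tailSkew, ins_pull, ins_pull, skew_sum]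
  simp only [ins_tailSkew, pull_skew, skew_smul]

/-- Tensor product with the second factor in the last slots. -/
def outer : {s r : ℕ} → Tensor n s → Tensor n r → Tensor n (r + s)
  | 0, _, S, T => S ![] • T
  | _ + 1, _, S, T => fun i => outer (ins (i 0) S) T (tl i)

/-- Contraction with the metric `H` of the last index of `S` with the first one of `T`. -/
def contr (H : Tensor n 2) : {s r : ℕ} → Tensor n (s + 1) → Tensor n (r + 1) → Tensor n (r + s)
  | 0, _, S, T => ∑ p, ∑ q, ((toMatrix H)⁻¹ p q * S ![p]) • ins q T
  | _ + 1, _, S, T => fun i => contr H (ins (i 0) S) T (tl i)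

/-- Contraction with the metric `H` of the first two indices. -/
def traceWith (H : Tensor n 2) {r : ℕ} (T : Tensor n (r + 2)) : Tensor n r :=
  ∑ p, ∑ q, (toMatrix H)⁻¹ p q • ins q (ins p T)

lemma ins_outer {s r : ℕ} (S : Tensor n (s + 1)) (T : Tensor n r) (a : Fin n) :
    ins a (outer (s := s + 1) S T) = outer (ins a S) T := rfl

lemma ins_contr (H : Tensor n 2) {s r : ℕ} (S : Tensor n (s + 2)) (T : Tensor n (r + 1))
    (a : Fin n) : ins a (contr H (s := s + 1) S T) = contr H (ins a S) T := rfl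

lemma outer_add_left : ∀ {s r : ℕ} (S S' : Tensor n s) (T : Tensor n r),
    outer (S + S') T = outer S T + outer S' T
  | 0, _, S, S', T => add_smul (S ![]) (S' ![]) T
  | _ + 1, _, S, S', T => tensor_ext_ins fun a => outer_add_left (ins a S) (ins a S') T

lemma outer_smul_left : ∀ {s r : ℕ} (c : ℝ) (S : Tensor n s) (T : Tensor n r),
    outer (c • S) T = c • outer S T
  | 0, _, c, S, T => mul_smul c (S ![]) T
  | _ + 1, _, c, S, T => tensor_ext_ins fun a => outer_smul_left c (ins a S) T

lemma outer_sum_left {s r : ℕ} {α : Type*} (t : Finset α) (S : α → Tensor n s)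
    (T : Tensor n r) : outer (∑ a ∈ t, S a) T = ∑ a ∈ t, outer (S a) T :=
  map_sum (⟨⟨fun S => outer S T, fun S S' => outer_add_left S S' T⟩,
    fun c S => outer_smul_left c S T⟩ : Tensor n s →ₗ[ℝ] Tensor n (r + s)) S t

lemma contr_add_left (H : Tensor n 2) : ∀ {s r : ℕ} (S S' : Tensor n (s + 1))
    (T : Tensor n (r + 1)), contr H (S + S') T = contr H S T + contr H S' T
  | 0, _, S, S', T => by
    simp only [contr, Pi.add_apply, mul_add, add_smul, Finset.sum_add_distrib]
  | _ + 1, _, S, S', T => tensor_ext_ins fun a => contr_add_left H (ins a S) (ins a S') T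

lemma contr_smul_left (H : Tensor n 2) : ∀ {s r : ℕ} (c : ℝ) (S : Tensor n (s + 1))
    (T : Tensor n (r + 1)), contr H (c • S) T = c • contr H S T
  | 0, _, c, S, T => by
    simp only [contr, Pi.smul_apply, smul_eq_mul, Finset.smul_sum, smul_smul, mul_left_comm c]
  | _ + 1, _, c, S, T => tensor_ext_ins fun a => contr_smul_left H c (ins a S) T

lemma contr_sum_left (H : Tensor n 2) {s r : ℕ} {α : Type*} (t : Finset α)
    (S : α → Tensor n (s + 1)) (T : Tensor n (r + 1)) :
    contr H (∑ a ∈ t, S a) T = ∑ a ∈ t, contr H (S a) T :=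
  map_sum (⟨⟨fun S => contr H S T, fun S S' => contr_add_left H S S' T⟩,
    fun c S => contr_smul_left H c S T⟩ : Tensor n (s + 1) →ₗ[ℝ] Tensor n (r + s)) S t

lemma pull_outer (A : Matrix (Fin n) (Fin n) ℝ) : ∀ {s r : ℕ} (S : Tensor n s)
    (T : Tensor n r), pull A (outer S T) = outer (pull A S) (pull A T)
  | 0, _, S, T => by
    rw [pull_rank_zero A S]
    exact pull_smul A (S ![]) T
  | _ + 1, _, S, T => tensor_ext_ins fun a => by
    rw [ins_outer, ins_pull, ins_pull, outer_sum_left]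
    simp only [outer_smul_left, ← pull_outer A]
    rfl

/-- `(Aᵀ H A)⁻¹ = A⁻¹ H⁻¹ A⁻ᵀ`: the inverse metric transforms contravariantly. -/
lemma inverse_toMatrix_pull {A : Matrix (Fin n) (Fin n) ℝ} (hA : IsUnit A.det) (H : Tensor n 2)
    (r t : Fin n) : ∑ p, ∑ q, (toMatrix (pull A H))⁻¹ p q * (A r p * A t q)
      = (toMatrix H)⁻¹ r t := by
  have h : A * (toMatrix (pull A H))⁻¹ * A.transpose = (toMatrix H)⁻¹ := by
    rw [toMatrix_pull, Matrix.mul_inv_rev, Matrix.mul_inv_rev, ← Matrix.mul_assoc,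
      Matrix.mul_nonsing_inv A hA, Matrix.one_mul, Matrix.mul_assoc,
      Matrix.nonsing_inv_mul A.transpose (by rwa [Matrix.det_transpose]), Matrix.mul_one]
  rw [← h, Matrix.mul_assoc, Matrix.mul_apply]
  simp only [Matrix.mul_apply, Matrix.transpose_apply, Finset.mul_sum]
  refine Finset.sum_congr rfl fun p _ => Finset.sum_congr rfl fun q _ => by ring

/-- Frame independence of a metric contraction. Values in an arbitrary module let the same
computation serve traces and contractions of two factors. -/
lemma pull_sum_inverse {A : Matrix (Fin n) (Fin n) ℝ} (hA : IsUnit A.det) (H : Tensor n 2)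
    {E : Type*} [AddCommGroup E] [Module ℝ E] (F : Fin n → Fin n → E) :
    ∑ p, ∑ q, (toMatrix (pull A H))⁻¹ p q • ∑ r, A r p • ∑ t, A t q • F r t
      = ∑ r, ∑ t, (toMatrix H)⁻¹ r t • F r t := by
  simp only [← inverse_toMatrix_pull hA H, Finset.sum_smul, Finset.smul_sum, smul_smul]
  calc _ = ∑ p, ∑ r, ∑ q, ∑ t, ((toMatrix (pull A H))⁻¹ p q * (A r p * A t q)) • F r t := by
        refine Finset.sum_congr rfl fun p _ => ?_
        rw [Finset.sum_comm]
        
    _ = ∑ p, ∑ r, ∑ t, ∑ q, ((toMatrix (pull A H))⁻¹ p q * (A r p * A t q)) • F r t := by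
        refine Finset.sum_congr rfl fun p _ => Finset.sum_congr rfl fun r _ => ?_
        rw [Finset.sum_comm]
    _ = _ := by
        rw [Finset.sum_comm]
        refine Finset.sum_congr rfl fun r _ => ?_
        rw [Finset.sum_comm]

lemma pull_traceWith {A : Matrix (Fin n) (Fin n) ℝ} (hA : IsUnit A.det) (H : Tensor n 2) {r : ℕ}
    (T : Tensor n (r + 2)) : pull A (traceWith H T) = traceWith (pull A H) (pull A T) := by
  unfold traceWith
  simp only [ins_pull, ins_sum, ins_smul]
  rw [pull_sum_inverse hA H (fun p q => pull A (ins q (ins p T)))]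
  simp only [pull_sum, pull_smul]

lemma pull_contr {A : Matrix (Fin n) (Fin n) ℝ} (hA : IsUnit A.det) (H : Tensor n 2) :
    ∀ {s r : ℕ} (S : Tensor n (s + 1)) (T : Tensor n (r + 1)),
    pull A (contr H S T) = contr (pull A H) (pull A S) (pull A T)
  | 0, _, S, T => by
    have h : ∀ (H : Tensor n 2) {r : ℕ} (S : Tensor n 1) (T : Tensor n (r + 1)), contr H S T
        = ∑ p, ∑ q, (toMatrix H)⁻¹ p q • (S ![p] • ins q T) := fun H r S T => by
      simp only [contr, smul_smul]
    rw [h, h]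
    simp only [ins_pull, pull_tensor_one, Finset.sum_smul, mul_smul]
    have := pull_sum_inverse hA H (fun p q => S ![p] • pull A (ins q T))
    simp only [pull_sum, pull_smul]
    rw [← this]
    simp only [Finset.smul_sum, smul_smul, mul_comm]
  | _ + 1, _, S, T => tensor_ext_ins fun a => by
    rw [ins_contr, ins_pull, ins_pull, contr_sum_left]
    simp only [contr_smul_left, ← pull_contr hA]
    rfl

/-! ### Smoothness and derivatives -/

variable {U : Set (Coord n)}

lemma SmoothOn.add {r : ℕ} {S T : Coord n → Tensor n r} (hS : SmoothOn S U) (hT : SmoothOn T U) :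
    SmoothOn (fun u => S u + T u) U := fun i => (hS i).add (hT i)

lemma SmoothOn.smul {r : ℕ} (c : ℝ) {T : Coord n → Tensor n r} (hT : SmoothOn T U) :
    SmoothOn (fun u => c • T u) U := fun i => contDiffOn_const.mul (hT i)

lemma SmoothOn.ins {r : ℕ} {T : Coord n → Tensor n (r + 1)} (hT : SmoothOn T U) (a : Fin n) :
    SmoothOn (fun u => ins a (T u)) U := fun _ => hT _

lemma SmoothOn.skew {r : ℕ} {T : Coord n → Tensor n r} (hT : SmoothOn T U) :
    SmoothOn (fun u => skew (T u)) U := fun _ =>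
  contDiffOn_const.mul (ContDiffOn.sum fun _ _ => contDiffOn_const.mul (hT _))

lemma SmoothOn.tailSkew {r : ℕ} {T : Coord n → Tensor n (r + 1)} (hT : SmoothOn T U) :
    SmoothOn (fun u => tailSkew (T u)) U := fun i => (hT.ins (i 0)).skew (tl i)

lemma SmoothOn.outer : ∀ {s r : ℕ} {S : Coord n → Tensor n s} {T : Coord n → Tensor n r}
    (_ : SmoothOn S U) (_ : SmoothOn T U), SmoothOn (fun u => outer (S u) (T u)) U
  | 0, _, _, _, hS, hT => fun i => (hS ![]).mul (hT i)
  | _ + 1, _, _, _, hS, hT => fun i => SmoothOn.outer (hS.ins (i 0)) hT (tl i)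

lemma IsMetricOn.smoothOn_traceWith {H : Coord n → Tensor n 2} (hH : IsMetricOn H U) {r : ℕ}
    {T : Coord n → Tensor n (r + 2)} (hT : SmoothOn T U) :
    SmoothOn (fun u => traceWith (H u) (T u)) U := fun i => by
  simp only [traceWith, Finset.sum_apply, Pi.smul_apply, smul_eq_mul]
  exact ContDiffOn.sum fun p _ => ContDiffOn.sum fun q _ => (hH.contDiffOn_upper p q).mul (hT _)

lemma IsMetricOn.smoothOn_contr {H : Coord n → Tensor n 2} (hH : IsMetricOn H U) :
    ∀ {s r : ℕ} {S : Coord n → Tensor n (s + 1)} {T : Coord n → Tensor n (r + 1)}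
    (_ : SmoothOn S U) (_ : SmoothOn T U), SmoothOn (fun u => contr (H u) (S u) (T u)) U
  | 0, _, _, _, hS, hT => fun i => by
    simp only [contr, Finset.sum_apply, Pi.smul_apply, smul_eq_mul]
    exact ContDiffOn.sum fun p _ => ContDiffOn.sum fun q _ =>
      ((hH.contDiffOn_upper p q).mul (hS _)).mul (hT _)
  | _ + 1, _, _, _, hS, hT => fun i => hH.smoothOn_contr (hS.ins (i 0)) hT (tl i)

/-- The partial derivatives of an array of functions. -/
def pdT {r : ℕ} (c : Fin n) (T : Coord n → Tensor n r) (u : Coord n) : Tensor n r :=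
  fun i => pd c (fun v => T v i) u

/-- Differentiability of all components. -/
def DiffAt {r : ℕ} (T : Coord n → Tensor n r) (u : Coord n) : Prop :=
  ∀ i, DifferentiableAt ℝ (fun v => T v i) u

variable {u : Coord n} {c : Fin n}

lemma pdT_congr {r : ℕ} {S T : Coord n → Tensor n r} (h : S =ᶠ[nhds u] T) :
    pdT c S u = pdT c T u :=
  funext fun i => pd_congr (h.mono fun _ hv => congrFun hv i)

lemma pdT_add {r : ℕ} {S T : Coord n → Tensor n r} (hS : DiffAt S u) (hT : DiffAt T u) :
    pdT c (fun v => S v + T v) u = pdT c S u + pdT c T u :=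
  funext fun i => pd_add (hS i) (hT i)

lemma pdT_smul {r : ℕ} (a : ℝ) {T : Coord n → Tensor n r} (hT : DiffAt T u) :
    pdT c (fun v => a • T v) u = a • pdT c T u :=
  funext fun i => pd_const_mul a (hT i)

lemma pdT_skew {r : ℕ} {T : Coord n → Tensor n r} (hT : DiffAt T u) :
    pdT c (fun v => skew (T v)) u = skew (pdT c T u) := by
  funext i
  unfold pdT skew
  rw [pd_const_mul _ (DifferentiableAt.fun_sum fun π _ => (hT _).const_mul _),
    pd_sum (f := fun (π : Equiv.Perm (Fin r)) v => ((Equiv.Perm.sign π : ℤ) : ℝ) *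
      T v (fun s => i (π s))) fun π _ => (hT _).const_mul _]
  simp only [fun π : Equiv.Perm (Fin r) => pd_const_mul (c := c)
    ((Equiv.Perm.sign π : ℤ) : ℝ) (hT (fun s => i (π s)))]

lemma pdT_tailSkew {r : ℕ} {T : Coord n → Tensor n (r + 1)} (hT : DiffAt T u) :
    pdT c (fun v => tailSkew (T v)) u = tailSkew (pdT c T u) :=
  tensor_ext_ins fun a => pdT_skew (T := fun v => ins a (T v)) fun _ => hT _

lemma pdT_outer : ∀ {s r : ℕ} {S : Coord n → Tensor n s} {T : Coord n → Tensor n r}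
    (_ : DiffAt S u) (_ : DiffAt T u),
    pdT c (fun v => outer (S v) (T v)) u = outer (pdT c S u) (T u) + outer (S u) (pdT c T u)
  | 0, _, _, _, hS, hT => funext fun i => pd_mul (hS ![]) (hT i)
  | _ + 1, _, S, _, hS, hT => tensor_ext_ins fun a =>
    pdT_outer (S := fun v => ins a (S v)) (fun _ => hS _) hT

lemma pd_sum_sum {f : Fin n → Fin n → Coord n → ℝ} (hf : ∀ p q, DifferentiableAt ℝ (f p q) u) :
    pd c (fun v => ∑ p, ∑ q, f p q v) u = ∑ p, ∑ q, pd c (f p q) u := by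
  rw [pd_sum (f := fun p v => ∑ q, f p q v) fun p _ => DifferentiableAt.fun_sum fun q _ => hf p q]
  exact Finset.sum_congr rfl fun p _ => pd_sum fun q _ => hf p q

/-- Vanishing first derivatives of the inverse metric at the point are what make traces commute with
differentiation; the frame parallel to first order supplies them. -/
lemma pdT_traceWith {H : Coord n → Tensor n 2}
    (hH : ∀ p q, DifferentiableAt ℝ (fun v => (toMatrix (H v))⁻¹ p q) u)
    (hH' : ∀ p q, pd c (fun v => (toMatrix (H v))⁻¹ p q) u = 0) {r : ℕ}
    {T : Coord n → Tensor n (r + 2)} (hT : DiffAt T u) :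
    pdT c (fun v => traceWith (H v) (T v)) u = traceWith (H u) (pdT c T u) := by
  funext i
  simp only [pdT, traceWith, Finset.sum_apply, Pi.smul_apply, smul_eq_mul]
  rw [pd_sum_sum (f := fun p q v => (toMatrix (H v))⁻¹ p q * ins q (ins p (T v)) i)
    fun p q => (hH p q).mul (hT _)]
  refine Finset.sum_congr rfl fun p _ => Finset.sum_congr rfl fun q _ => ?_
  refine (pd_mul (f := fun v => (toMatrix (H v))⁻¹ p q)
    (g := fun v => ins q (ins p (T v)) i) (hH p q) (hT _)).trans ?_
  rw [hH', zero_mul, zero_add]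
  rfl

lemma pdT_contr {H : Coord n → Tensor n 2}
    (hH : ∀ p q, DifferentiableAt ℝ (fun v => (toMatrix (H v))⁻¹ p q) u)
    (hH' : ∀ p q, pd c (fun v => (toMatrix (H v))⁻¹ p q) u = 0) :
    ∀ {s r : ℕ} {S : Coord n → Tensor n (s + 1)} {T : Coord n → Tensor n (r + 1)}
    (_ : DiffAt S u) (_ : DiffAt T u), pdT c (fun v => contr (H v) (S v) (T v)) u
      = contr (H u) (pdT c S u) (T u) + contr (H u) (S u) (pdT c T u)
  | 0, _, S, T, hS, hT => by
    funext i
    simp only [pdT, contr, Finset.sum_apply, Pi.smul_apply, smul_eq_mul, Pi.add_apply,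
      ← Finset.sum_add_distrib]
    rw [pd_sum_sum (f := fun p q v => (toMatrix (H v))⁻¹ p q * S v ![p] * ins q (T v) i)
      fun p q => ((hH p q).mul (hS _)).mul (hT _)]
    refine Finset.sum_congr rfl fun p _ => Finset.sum_congr rfl fun q _ => ?_
    refine (pd_mul (f := fun v => (toMatrix (H v))⁻¹ p q * S v ![p])
      (g := fun v => ins q (T v) i) ((hH p q).mul (hS _)) (hT _)).trans ?_
    rw [pd_mul (f := fun v => (toMatrix (H v))⁻¹ p q) (g := fun v => S v ![p]) (hH p q) (hS _),
      hH', zero_mul, zero_add]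
    rfl
  | _ + 1, _, S, _, hS, hT => tensor_ext_ins fun a =>
    pdT_contr hH hH' (S := fun v => ins a (S v)) (fun _ => hS _) hT

end Operations
/-! ## A frame which is parallel to first order at a point, and the Leibniz rules -/

section Leibniz

variable {n : ℕ} {M : Type*} [TopologicalSpace M] [ChartedSpace (Coord n) M]
  [IsManifold (𝓡 n) ∞ M]

lemma SmoothIn.congr {r : ℕ} {x : M} {E : TensorField n M r} {e : Coord n → Tensor n r}
    (he : SmoothOn e (extChartAt (𝓡 n) x).target)
    (h : ∀ u ∈ (extChartAt (𝓡 n) x).target, inChart x E u = e u) : SmoothIn x E := fun i =>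
  (he i).congr fun u hu => by rw [h u hu]

namespace Metric

variable (g : Metric n M)

/-- Coordinates of a frame which is parallel to first order at `x`. -/
def corr (x : M) (u : Coord n) : Matrix (Fin n) (Fin n) ℝ := Matrix.of fun q p =>
  (if q = p then 1 else 0) - ∑ c, (u c - extChartAt (𝓡 n) x x c)
    * christoffel (inChart x g.comp) (extChartAt (𝓡 n) x x) c p q

/-- Components of a tensor field in a frame which is parallel to first order at `x`. -/
def moved (x : M) {r : ℕ} (T : TensorField n M r) (u : Coord n) : Tensor n r :=
  pull (g.corr x u) (inChart x T u)

/-- The domain of the frame. -/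
def frameDom (x : M) : Set (Coord n) := (extChartAt (𝓡 n) x).target ∩ {u | (g.corr x u).det ≠ 0}

variable {g} {x : M}

lemma contDiff_corr (p q : Fin n) : ContDiff ℝ ∞ (fun u => g.corr x u p q) := by
  refine contDiff_const.sub (ContDiff.sum fun c _ => ContDiff.mul (ContDiff.sub ?_ contDiff_const)
    contDiff_const)
  exact (EuclideanSpace.proj c : Coord n →L[ℝ] ℝ).contDiff

lemma isOpen_frameDom : IsOpen (g.frameDom x) := by
  refine (isOpen_extChartAt_target x).inter (isOpen_ne.preimage ?_)
  have := contDiffOn_det (U := Set.univ) (fun p q => (contDiff_corr (g := g) (x := x) p q).contDiffOn)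
  exact (contDiffOn_univ.1 this).continuous

lemma corr_self : g.corr x (extChartAt (𝓡 n) x x) = 1 := by
  ext q p
  simp [corr, Matrix.one_apply]

lemma self_mem_frameDom : extChartAt (𝓡 n) x x ∈ g.frameDom x :=
  ⟨mem_extChartAt_target x, by
    rw [Set.mem_ofPred_eq, corr_self, Matrix.det_one]
    exact one_ne_zero⟩

lemma frameDom_mem_nhds : g.frameDom x ∈ nhds (extChartAt (𝓡 n) x x) :=
  isOpen_frameDom.mem_nhds self_mem_frameDom

lemma moved_self {r : ℕ} (T : TensorField n M r) : g.moved x T (extChartAt (𝓡 n) x x) = T x := by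
  rw [moved, corr_self, pull_one, inChart_self]

lemma smoothOn_moved {r : ℕ} {T : TensorField n M r} (hT : SmoothIn x T) :
    SmoothOn (g.moved x T) (g.frameDom x) :=
  contDiffOn_pull (fun p q => (contDiff_corr p q).contDiffOn)
    (fun i => (hT i).mono Set.inter_subset_left)

lemma diffAt_moved {r : ℕ} {T : TensorField n M r} (hT : SmoothIn x T) :
    DiffAt (g.moved x T) (extChartAt (𝓡 n) x x) := fun i =>
  (smoothOn_moved hT).differentiableAt isOpen_frameDom self_mem_frameDom i

lemma pd_corr (c q p : Fin n) : pd c (fun u => g.corr x u q p) (extChartAt (𝓡 n) x x)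
    = -christoffel (inChart x g.comp) (extChartAt (𝓡 n) x x) c p q := by
  have hd : ∀ e : Fin n, DifferentiableAt ℝ (fun u : Coord n => (u e - extChartAt (𝓡 n) x x e)
      * christoffel (inChart x g.comp) (extChartAt (𝓡 n) x x) e p q) (extChartAt (𝓡 n) x x) :=
    fun e => ((EuclideanSpace.proj e : Coord n →L[ℝ] ℝ).differentiableAt.sub
      (differentiableAt_const _)).mul (differentiableAt_const _)
  have h : ∀ e : Fin n, pd c (fun u : Coord n => (u e - extChartAt (𝓡 n) x x e)
      * christoffel (inChart x g.comp) (extChartAt (𝓡 n) x x) e p q) (extChartAt (𝓡 n) x x)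
      = (if e = c then 1 else 0)
        * christoffel (inChart x g.comp) (extChartAt (𝓡 n) x x) e p q := by
    intro e
    have he : DifferentiableAt ℝ (fun u : Coord n => u e) (extChartAt (𝓡 n) x x) :=
      (EuclideanSpace.proj e : Coord n →L[ℝ] ℝ).differentiableAt
    rw [pd_mul (f := fun u : Coord n => u e - extChartAt (𝓡 n) x x e)
      (he.sub (differentiableAt_const _)) (differentiableAt_const _),
      pd_sub he (differentiableAt_const _), pd_const, pd_const, pd_coord]
    simp
  refine (pd_sub (f := fun _ => if q = p then (1 : ℝ) else 0) (differentiableAt_const _)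
    (DifferentiableAt.fun_sum fun e _ => hd e)).trans ?_
  rw [pd_const, zero_sub, pd_sum fun e _ => hd e, Finset.sum_congr rfl fun e _ => h e]
  simp

/-- The covariant derivative at `x` is the derivative of the components in the frame. -/
lemma ins_nabla {r : ℕ} {T : TensorField n M r} (hT : SmoothIn x T) (c : Fin n) :
    ins c (g.nabla T x) = pdT c (g.moved x T) (extChartAt (𝓡 n) x x) := by
  -- The frame is affine in the coordinates, equals the coordinate frame at `x`, and has derivative
  -- `-Γ` there. The Christoffel terms therefore act on the new components, and nothing acts on the
  -- old ones.
  have h := pd_pull (g.corr x) (u := extChartAt (𝓡 n) x x) (c := c)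
    (fun p q => (contDiff_corr p q).differentiable (by simp) _)
    (fun p s => -christoffel (inChart x g.comp) (extChartAt (𝓡 n) x x) c p s) (fun _ _ => 0)
    (fun q p => by
      rw [pd_corr, corr_self]
      simp [Matrix.one_apply]) (inChart x T)
    (fun i => hT.differentiableAt (isOpen_extChartAt_target x) (mem_extChartAt_target x) i)
  funext i
  have h0 : act (fun _ _ => 0) (inChart x T (extChartAt (𝓡 n) x x)) = 0 := by
    funext i
    simp [act]
  refine Eq.trans ?_ (h i).symm
  rw [corr_self, pull_one, pull_one, h0, add_zero, act_neg_left]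
  rfl

/-- The source of all Leibniz rules below: a natural operation has the same expression in the
components with respect to the adapted frame, and at `x` one differentiates that expression in the
ordinary sense. -/
lemma ins_nabla_of_moved {r : ℕ} {E : TensorField n M r} {e : Coord n → Tensor n r}
    (hE : SmoothIn x E) (h : ∀ u ∈ g.frameDom x, g.moved x E u = e u) (c : Fin n) :
    ins c (g.nabla E x) = pdT c e (extChartAt (𝓡 n) x x) := by
  rw [ins_nabla hE]
  refine pdT_congr ?_
  filter_upwards [frameDom_mem_nhds] with u hu using h u hu

/-- The metric is parallel. -/
lemma nabla_comp : g.nabla g.comp = 0 := by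
  funext x
  refine tensor_ext_ins fun c => ?_
  funext i
  show coordNabla _ _ _ (cons c i) = 0
  rw [coordNabla_cons, (g.isMetricOn x).pd_eq_act (mem_extChartAt_target x), sub_self]

lemma isMetricOn_moved : IsMetricOn (g.moved x g.comp) (g.frameDom x) where
  isOpen := isOpen_frameDom
  smooth := smoothOn_moved (g.smooth x)
  symm u hu a b := by
    unfold moved
    rw [pull_two, pull_two, Finset.sum_comm]
    refine Finset.sum_congr rfl fun p _ => Finset.sum_congr rfl fun q _ => ?_
    rw [(g.isMetricOn x).symm u hu.1 q p]
    ring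
  det u hu := by
    unfold moved
    rw [toMatrix_pull, Matrix.det_mul, Matrix.det_mul, Matrix.det_transpose]
    exact (hu.2.isUnit.mul ((g.isMetricOn x).det u hu.1)).mul hu.2.isUnit

lemma differentiableAt_upper_moved (p q : Fin n) :
    DifferentiableAt ℝ (fun v => (toMatrix (g.moved x g.comp v))⁻¹ p q) (extChartAt (𝓡 n) x x) :=
  differentiableAt_of_contDiffOn isOpen_frameDom (isMetricOn_moved.contDiffOn_upper p q)
    self_mem_frameDom

/-- The metric is parallel, so its components in the frame have zero derivative at `x`.
Differentiating the identity saying that metric times inverse is `1` transfers this to the inverse.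
-/
lemma pd_upper_moved (c p q : Fin n) :
    pd c (fun v => (toMatrix (g.moved x g.comp v))⁻¹ p q) (extChartAt (𝓡 n) x x) = 0 := by
  have h0 : ∀ i, pd c (fun v => g.moved x g.comp v i) (extChartAt (𝓡 n) x x) = 0 := fun i => by
    have := congrFun (ins_nabla (g := g) (x := x) (T := g.comp) (g.smooth x) c) i
    rw [nabla_comp] at this
    exact this.symm
  have h1 : ∀ e, ∑ b, g.moved x g.comp (extChartAt (𝓡 n) x x) ![e, b]
      * pd c (fun v => (toMatrix (g.moved x g.comp v))⁻¹ b q) (extChartAt (𝓡 n) x x) = 0 := by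
    intro e
    have h2 : pd c (fun v => ∑ b, g.moved x g.comp v ![e, b]
        * (toMatrix (g.moved x g.comp v))⁻¹ b q) (extChartAt (𝓡 n) x x) = 0 := by
      rw [← pd_const c (if e = q then 1 else 0) (extChartAt (𝓡 n) x x)]
      refine pd_congr ?_
      filter_upwards [frameDom_mem_nhds (g := g)] with v hv
      have h3 := Matrix.mul_nonsing_inv _ (isMetricOn_moved.det v hv)
      have h4 := congrFun (congrFun h3 e) q
      rwa [Matrix.mul_apply, Matrix.one_apply] at h4
    rw [pd_sum (f := fun b v => g.moved x g.comp v ![e, b]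
        * (toMatrix (g.moved x g.comp v))⁻¹ b q) fun b _ =>
      (diffAt_moved (g.smooth x) _).mul (differentiableAt_upper_moved b q)] at h2
    rw [← h2]
    refine Finset.sum_congr rfl fun b _ => ?_
    refine Eq.trans ?_ (pd_mul (f := fun v => g.moved x g.comp v ![e, b])
      (g := fun v => (toMatrix (g.moved x g.comp v))⁻¹ b q) (diffAt_moved (g.smooth x) _)
      (differentiableAt_upper_moved b q)).symm
    rw [h0, zero_mul, zero_add]
  have h5 := (isMetricOn_moved (g := g) (x := x)).sum_lower self_mem_frameDom (fun b =>
    pd c (fun v => (toMatrix (g.moved x g.comp v))⁻¹ b q) (extChartAt (𝓡 n) x x)) p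
  simp only [h1, mul_zero, Finset.sum_const_zero] at h5
  exact h5.symm

/-! ### Linear combinations -/

variable {r s : ℕ} {S T : TensorField n M r}

lemma inChart_add (S T : TensorField n M r) (u : Coord n) :
    inChart x (S + T) u = inChart x S u + inChart x T u :=
  pull_add (chartJac x u) (S _) (T _)

lemma inChart_smul (a : ℝ) (T : TensorField n M r) (u : Coord n) :
    inChart x (a • T) u = a • inChart x T u :=
  pull_smul (chartJac x u) a (T _)

lemma smoothIn_add (hS : SmoothIn x S) (hT : SmoothIn x T) : SmoothIn x (S + T) :=
  SmoothIn.congr (SmoothOn.add hS hT) fun u _ => inChart_add S T u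

lemma smoothIn_smul (a : ℝ) (hT : SmoothIn x T) : SmoothIn x (a • T) :=
  SmoothIn.congr (SmoothOn.smul a hT) fun u _ => inChart_smul a T u

lemma smoothIn_sub (hS : SmoothIn x S) (hT : SmoothIn x T) : SmoothIn x (S - T) := by
  rw [sub_eq_add_neg, ← neg_one_smul ℝ T]
  exact smoothIn_add hS (smoothIn_smul _ hT)

lemma nabla_add (hS : SmoothIn x S) (hT : SmoothIn x T) :
    g.nabla (S + T) x = g.nabla S x + g.nabla T x := tensor_ext_ins fun c => by
  rw [ins_nabla_of_moved (smoothIn_add hS hT) (e := fun u => g.moved x S u + g.moved x T u)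
    (fun u _ => by rw [moved, inChart_add, pull_add]; rfl), ins_add, ins_nabla hS, ins_nabla hT,
    pdT_add (diffAt_moved hS) (diffAt_moved hT)]

lemma nabla_smul (a : ℝ) (hT : SmoothIn x T) : g.nabla (a • T) x = a • g.nabla T x :=
  tensor_ext_ins fun c => by
  rw [ins_nabla_of_moved (smoothIn_smul a hT) (e := fun u => a • g.moved x T u)
    (fun u _ => by rw [moved, inChart_smul, pull_smul]; rfl), ins_smul, ins_nabla hT,
    pdT_smul a (diffAt_moved hT)]

lemma nabla_sub (hS : SmoothIn x S) (hT : SmoothIn x T) :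
    g.nabla (S - T) x = g.nabla S x - g.nabla T x := by
  rw [sub_eq_add_neg, ← neg_one_smul ℝ T, nabla_add hS (smoothIn_smul _ hT), nabla_smul _ hT,
    neg_one_smul, sub_eq_add_neg]

lemma inChart_zero (x : M) (u : Coord n) : inChart x (0 : TensorField n M r) u = 0 :=
  pull_zero (chartJac x u) r

lemma smoothIn_zero : SmoothIn x (0 : TensorField n M r) :=
  SmoothIn.congr (smoothOn_const 0) fun u _ => inChart_zero x u

lemma nabla_zero : g.nabla (0 : TensorField n M r) = 0 := by
  funext x
  have := nabla_smul (g := g) (x := x) 0 (smoothIn_zero (r := r))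
  rwa [zero_smul, zero_smul] at this

/-! ### Skew-symmetrisation -/

/-- Skew-symmetrisation of a tensor field. -/
def skewF (T : TensorField n M r) : TensorField n M r := fun y => skew (T y)

/-- Skew-symmetrisation of a tensor field over all indices but the first. -/
def tailSkewF (T : TensorField n M (r + 1)) : TensorField n M (r + 1) := fun y => tailSkew (T y)

lemma smoothIn_skewF (hT : SmoothIn x T) : SmoothIn x (skewF T) :=
  SmoothIn.congr (SmoothOn.skew hT) fun u _ => pull_skew (chartJac x u) (T _)

lemma nabla_skewF (hT : SmoothIn x T) : g.nabla (skewF T) x = tailSkew (g.nabla T x) :=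
  tensor_ext_ins fun c => by
  rw [ins_nabla_of_moved (smoothIn_skewF hT) (e := fun u => skew (g.moved x T u))
    (fun u _ => by
      rw [moved, moved, ← pull_skew, inChart_eq_pull, inChart_eq_pull, ← pull_skew]; rfl),
    ins_tailSkew, ins_nabla hT, pdT_skew (diffAt_moved hT)]

lemma smoothIn_tailSkewF {T : TensorField n M (r + 1)} (hT : SmoothIn x T) :
    SmoothIn x (tailSkewF T) :=
  SmoothIn.congr (SmoothOn.tailSkew hT) fun u _ => pull_tailSkew (chartJac x u) (T _)

lemma nabla_tailSkewF {T : TensorField n M (r + 1)} (hT : SmoothIn x T) (c : Fin n) :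
    ins c (g.nabla (tailSkewF T) x) = tailSkew (ins c (g.nabla T x)) := by
  rw [ins_nabla_of_moved (smoothIn_tailSkewF hT) (e := fun u => tailSkew (g.moved x T u))
    (fun u _ => by
      rw [moved, moved, ← pull_tailSkew, inChart_eq_pull, inChart_eq_pull, ← pull_tailSkew]; rfl),
    ins_nabla hT, pdT_tailSkew (diffAt_moved hT)]

/-- The covariant derivative of a form is skew in the form indices. -/
lemma isAlt_ins_nabla (hT : SmoothIn x T) (h : ∀ y, IsAlt (T y)) (c : Fin n) :
    IsAlt (ins c (g.nabla T x)) := by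
  have h1 : T = skewF T := funext fun y => (h y).skew_eq.symm
  rw [h1, nabla_skewF hT, ins_tailSkew]
  exact isAlt_skew _

/-! ### Products and contractions -/

/-- Tensor product of tensor fields. -/
def outerF (S : TensorField n M s) (T : TensorField n M r) : TensorField n M (r + s) :=
  fun y => outer (S y) (T y)

/-- Contraction of the last index of `S` with the first one of `T`. -/
def contrF (g : Metric n M) (S : TensorField n M (s + 1)) (T : TensorField n M (r + 1)) :
    TensorField n M (r + s) := fun y => contr (g.comp y) (S y) (T y)

lemma trace_eq (T : TensorField n M (r + 2)) (y : M) :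
    g.trace T y = traceWith (g.comp y) (T y) := by
  funext i
  simp [trace, traceWith, upper, ins]

lemma smoothIn_outerF {S : TensorField n M s} (hS : SmoothIn x S) (hT : SmoothIn x T) :
    SmoothIn x (outerF S T) :=
  SmoothIn.congr (SmoothOn.outer hS hT) fun u _ => pull_outer (chartJac x u) (S _) (T _)

lemma nabla_outerF {S : TensorField n M s} (hS : SmoothIn x S) (hT : SmoothIn x T) (c : Fin n) :
    ins c (g.nabla (outerF S T) x)
      = outer (ins c (g.nabla S x)) (T x) + outer (S x) (ins c (g.nabla T x)) := by
  rw [ins_nabla_of_moved (smoothIn_outerF hS hT)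
    (e := fun u => outer (g.moved x S u) (g.moved x T u))
    (fun u _ => by
      rw [moved, moved, moved, ← pull_outer, inChart_eq_pull, inChart_eq_pull, inChart_eq_pull,
        ← pull_outer]; rfl),
    ins_nabla hS, ins_nabla hT, pdT_outer (diffAt_moved hS) (diffAt_moved hT), moved_self,
    moved_self]

lemma inChart_contrF {S : TensorField n M (s + 1)} {T : TensorField n M (r + 1)} {u : Coord n}
    (hu : u ∈ (extChartAt (𝓡 n) x).target) : inChart x (contrF g S T) u
      = contr (inChart x g.comp u) (inChart x S u) (inChart x T u) := by
  simp only [inChart_eq_pull]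
  rw [← pull_contr (isUnit_det_chartJac hu)]
  rfl

lemma inChart_trace {T : TensorField n M (r + 2)} {u : Coord n}
    (hu : u ∈ (extChartAt (𝓡 n) x).target) :
    inChart x (g.trace T) u = traceWith (inChart x g.comp u) (inChart x T u) := by
  simp only [inChart_eq_pull]
  rw [← pull_traceWith (isUnit_det_chartJac hu), trace_eq]

lemma smoothIn_contrF {S : TensorField n M (s + 1)} {T : TensorField n M (r + 1)}
    (hS : SmoothIn x S) (hT : SmoothIn x T) : SmoothIn x (contrF g S T) :=
  SmoothIn.congr ((g.isMetricOn x).smoothOn_contr hS hT) fun _ hu => inChart_contrF hu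

lemma smoothIn_trace {T : TensorField n M (r + 2)} (hT : SmoothIn x T) : SmoothIn x (g.trace T) :=
  SmoothIn.congr ((g.isMetricOn x).smoothOn_traceWith hT) fun _ hu => inChart_trace hu

lemma nabla_contrF {S : TensorField n M (s + 1)} {T : TensorField n M (r + 1)}
    (hS : SmoothIn x S) (hT : SmoothIn x T) (c : Fin n) :
    ins c (g.nabla (contrF g S T) x) = contr (g.comp x) (ins c (g.nabla S x)) (T x)
      + contr (g.comp x) (S x) (ins c (g.nabla T x)) := by
  rw [ins_nabla_of_moved (smoothIn_contrF hS hT)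
    (e := fun u => contr (g.moved x g.comp u) (g.moved x S u) (g.moved x T u))
    (fun u hu => by
      rw [moved, moved, moved, moved, ← pull_contr hu.2.isUnit, inChart_contrF hu.1]),
    ins_nabla hS, ins_nabla hT, pdT_contr differentiableAt_upper_moved (pd_upper_moved c)
    (diffAt_moved hS) (diffAt_moved hT), moved_self, moved_self, moved_self]

lemma nabla_trace {T : TensorField n M (r + 2)} (hT : SmoothIn x T) (c : Fin n) :
    ins c (g.nabla (g.trace T) x) = traceWith (g.comp x) (ins c (g.nabla T x)) := by
  rw [ins_nabla_of_moved (smoothIn_trace hT)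
    (e := fun u => traceWith (g.moved x g.comp u) (g.moved x T u))
    (fun u hu => by
      rw [moved, moved, moved, ← pull_traceWith hu.2.isUnit, inChart_trace hu.1]),
    ins_nabla hT, pdT_traceWith differentiableAt_upper_moved (pd_upper_moved c)
    (diffAt_moved hT), moved_self]

/-! ### Permutations of the indices -/

/-- Permutation of the indices of a tensor field. -/
def permF (π : Equiv.Perm (Fin r)) (T : TensorField n M r) : TensorField n M r :=
  fun y i => T y (fun s => i (π s))

lemma inChart_permF (π : Equiv.Perm (Fin r)) (T : TensorField n M r) (u : Coord n)
    (i : Fin r → Fin n) : inChart x (permF π T) u i = inChart x T u (fun s => i (π s)) :=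
  pull_reindex (chartJac x u) (T _) π i

lemma smoothIn_permF (π : Equiv.Perm (Fin r)) (hT : SmoothIn x T) : SmoothIn x (permF π T) :=
  fun i => (hT fun s => i (π s)).congr fun u _ => inChart_permF π T u i

lemma nabla_permF (π : Equiv.Perm (Fin r)) (hT : SmoothIn x T) (c : Fin n) (i : Fin r → Fin n) :
    g.nabla (permF π T) x (cons c i) = g.nabla T x (cons c fun s => i (π s)) := by
  have h := congrFun (ins_nabla_of_moved (g := g) (smoothIn_permF π hT)
    (e := fun u i => g.moved x T u (fun s => i (π s)))
    (fun u _ => funext fun i => by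
      have : inChart x (permF π T) u = fun i => inChart x T u (fun s => i (π s)) :=
        funext fun i => inChart_permF π T u i
      rw [moved, this]
      exact pull_reindex _ _ _ _) c) i
  have h' := congrFun (ins_nabla (g := g) hT c) (fun s => i (π s))
  exact h.trans h'.symm

end Metric

end Leibniz

/-! ## Symmetries of the curvature -/

section Curvature

variable {n : ℕ}

lemma coordRiemann_antisymm (G : Coord n → Tensor n 2) (u : Coord n) (a b c d : Fin n) :
    coordRiemann G u a b c d = -coordRiemann G u b a c d := by
  unfold coordRiemann
  simp only [Finset.sum_sub_distrib]
  ring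

/-- A consequence of torsion-freeness alone: after ordering the lower indices of the Christoffel
symbols, the derivative and quadratic terms cancel in pairs. -/
lemma IsMetricOn.bianchi {G : Coord n → Tensor n 2} {U : Set (Coord n)} (hG : IsMetricOn G U)
    {u : Coord n} (hu : u ∈ U) (a b c d : Fin n) :
    coordRiemann G u a b c d + coordRiemann G u b d c a + coordRiemann G u d a c b = 0 := by
  have h1 : ∀ a b d, pd a (fun v => christoffel G v b d c) u
      = pd a (fun v => christoffel G v d b c) u := fun a b d =>
    pd_congr (by filter_upwards [hG.isOpen.mem_nhds hu] with v hv using hG.christoffel_symm hv _ _ _)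
  unfold coordRiemann
  simp only [Finset.sum_sub_distrib]
  rw [h1 a d b, h1 b d a, h1 d b a]
  have h2 : ∀ a b d : Fin n, ∑ e, christoffel G u a e c * christoffel G u b d e
      = ∑ e, christoffel G u a e c * christoffel G u d b e := fun a b d =>
    Finset.sum_congr rfl fun e _ => by rw [hG.christoffel_symm hu b d]
  rw [h2 a b d, h2 b a d, h2 d a b]
  ring

variable {M : Type*} [TopologicalSpace M] [ChartedSpace (Coord n) M] [IsManifold (𝓡 n) ∞ M]

namespace Metric

variable (g : Metric n M) (x : M)

lemma upper_symm (a b : Fin n) : g.upper x a b = g.upper x b a := by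
  have h : (toMatrix (g.comp x)).IsSymm := by
    ext a b
    exact g.lower_symm x b a
  have h2 : ((toMatrix (g.comp x))⁻¹).IsSymm := h.inv
  exact h2.apply b a

lemma sum_lower_upper (a b : Fin n) : ∑ c, g.lower x a c * g.upper x c b = if a = b then 1 else 0 := by
  have := congrFun (congrFun (Matrix.mul_nonsing_inv _ (g.isUnit_det x)) a) b
  rwa [Matrix.mul_apply, Matrix.one_apply] at this

lemma sum_upper_lower (a b : Fin n) : ∑ c, g.upper x a c * g.lower x c b = if a = b then 1 else 0 := by
  have := congrFun (congrFun (Matrix.nonsing_inv_mul _ (g.isUnit_det x)) a) b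
  rwa [Matrix.mul_apply, Matrix.one_apply] at this

lemma riemann_antisymm (a b c d : Fin n) : g.riemann x a b c d = -g.riemann x b a c d :=
  coordRiemann_antisymm _ _ _ _ _ _

lemma riemann_bianchi (a b c d : Fin n) :
    g.riemann x a b c d + g.riemann x b d c a + g.riemann x d a c b = 0 :=
  (g.isMetricOn x).bianchi (mem_extChartAt_target x) a b c d

lemma riemannLower_antisymm (a b c d : Fin n) :
    g.riemannLower x a b c d = -g.riemannLower x b a c d := by
  unfold riemannLower
  simp only [g.riemann_antisymm x a b, mul_neg, Finset.sum_neg_distrib]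

lemma riemannLower_bianchi (a b c d : Fin n) :
    g.riemannLower x a b c d + g.riemannLower x b d c a + g.riemannLower x d a c b = 0 := by
  unfold riemannLower
  rw [← Finset.sum_add_distrib, ← Finset.sum_add_distrib]
  refine Finset.sum_eq_zero fun e _ => ?_
  rw [← mul_add, ← mul_add, g.riemann_bianchi, mul_zero]

/-- The Ricci identity applied to the parallel tensor `g`: the left side is zero, and the right side
is the symmetric part in the last two indices. -/
lemma riemannLower_antisymm' (a b c d : Fin n) :
    g.riemannLower x a b c d = -g.riemannLower x a b d c := by
  have h := g.ricci_identity (x := x) (T := g.comp) (g.smooth x) a b ![c, d]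
  rw [nabla_comp, nabla_zero, act_two] at h
  have h' : (0 : ℝ) = -(∑ p, g.riemann x a b p c * g.lower x p d
      + ∑ p, g.riemann x a b p d * g.lower x c p) := by
    rw [← sub_self (0 : ℝ)]
    exact h
  unfold riemannLower
  simp only [g.lower_symm x _ d, mul_comm (g.riemann x _ _ _ _)] at h'
  linarith

/-- The classical octahedron argument: four instances of the first Bianchi identity combined with
the two antisymmetries. -/
lemma riemannLower_pair (a b c d : Fin n) :
    g.riemannLower x a b c d = g.riemannLower x c d a b := by
  have h1 := g.riemannLower_bianchi x a b c d
  have h2 := g.riemannLower_bianchi x b c d a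
  have h3 := g.riemannLower_bianchi x c d a b
  have h4 := g.riemannLower_bianchi x d a b c
  have s1 := g.riemannLower_antisymm x
  have s2 := g.riemannLower_antisymm' x
  have e1 := s1 b d c a
  have e1' := s2 b d c a
  have e2 := s1 d a c b
  have e2' := s2 d a c b
  have e3 := s2 b c d a
  have e4 := s1 c a d b
  have e4' := s2 c a d b
  have e5 := s1 a b d c
  have e5' := s2 a b d c
  have e6 := s2 c d a b
  have e7 := s1 d b a c
  have e7' := s2 d b a c
  have e8 := s1 b c a d
  have e8' := s2 b c a d
  have e9 := s1 a c b d
  have e9' := s2 a c b d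
  have e10 := s1 c d b a
  linarith

lemma riemann_eq (a b c d : Fin n) :
    g.riemann x a b c d = ∑ e, g.upper x c e * g.riemannLower x a b e d := by
  unfold riemannLower
  simp only [Finset.mul_sum, ← mul_assoc]
  rw [Finset.sum_comm]
  simp only [← Finset.sum_mul, g.sum_upper_lower]
  simp

lemma ricci_eq (a b : Fin n) :
    g.ricci x a b = ∑ c, ∑ e, g.upper x c e * g.riemannLower x c a e b := by
  unfold ricci
  simp only [g.riemann_eq]

lemma ricci_symm (a b : Fin n) : g.ricci x a b = g.ricci x b a := by
  rw [ricci_eq, ricci_eq, Finset.sum_comm]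
  refine Finset.sum_congr rfl fun e _ => Finset.sum_congr rfl fun c _ => ?_
  rw [g.upper_symm x c e, g.riemannLower_pair x c a e b]

lemma schouten_symm (a b : Fin n) : g.schouten x a b = g.schouten x b a := by
  unfold schouten
  rw [g.ricci_symm x a b, g.lower_symm x a b]

/-- The trace `J` of the Schouten tensor. -/
def traceSchouten : ℝ := g.scalar x / (2 * ((n : ℝ) - 1))

variable {x}

lemma ricci_eq_schouten (hn : 3 ≤ n) (a b : Fin n) :
    g.ricci x a b = ((n : ℝ) - 2) * g.schouten x a b + g.traceSchouten x * g.lower x a b := by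
  have h : (n : ℝ) - 2 ≠ 0 := by
    have : (3 : ℝ) ≤ n := by exact_mod_cast hn
    linarith
  unfold schouten traceSchouten
  field_simp
  ring

lemma sum_upper_mul_lower : ∑ a, ∑ b, g.upper x a b * g.lower x a b = n := by
  have : ∀ a, ∑ b, g.upper x a b * g.lower x a b = 1 := fun a => by
    simp only [g.lower_symm x a]
    rw [g.sum_upper_lower]
    simp
  simp [this]

/-- Tracing `Ric = (n - 2) P + J g`, with `J` defined from the scalar curvature, gives `2 (n - 1) J
= (n - 2) tr P + n J`; division by `n - 2` needs `n ≥ 3`. -/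
lemma sum_upper_mul_schouten (hn : 3 ≤ n) :
    ∑ a, ∑ b, g.upper x a b * g.schouten x a b = g.traceSchouten x := by
  have h3 : (3 : ℝ) ≤ n := by exact_mod_cast hn
  have h : (n : ℝ) - 2 ≠ 0 := by linarith
  have h' : (n : ℝ) - 1 ≠ 0 := by linarith
  have e1 : g.scalar x = ((n : ℝ) - 2) * (∑ a, ∑ b, g.upper x a b * g.schouten x a b)
      + g.traceSchouten x * n := by
    rw [scalar]
    simp only [g.ricci_eq_schouten hn, mul_add, Finset.sum_add_distrib]
    congr 1
    · simp only [Finset.mul_sum]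
      refine Finset.sum_congr rfl fun a _ => Finset.sum_congr rfl fun b _ => by ring
    · rw [← g.sum_upper_mul_lower (x := x)]
      simp only [Finset.mul_sum]
      refine Finset.sum_congr rfl fun a _ => Finset.sum_congr rfl fun b _ => by ring
  have e2 : g.scalar x = 2 * ((n : ℝ) - 1) * g.traceSchouten x := by
    unfold traceSchouten
    field_simp
  have e3 : ((n : ℝ) - 2) * (∑ a, ∑ b, g.upper x a b * g.schouten x a b)
      = ((n : ℝ) - 2) * g.traceSchouten x := by linarith
  exact mul_left_cancel₀ h e3

lemma riemannLower_eq_weyl (a b c d : Fin n) : g.riemannLower x a b c d = g.weyl x a b c d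
    + (g.lower x c a * g.schouten x b d - g.lower x c b * g.schouten x a d)
    + (g.lower x d b * g.schouten x a c - g.lower x d a * g.schouten x b c) := by
  unfold weyl
  ring

lemma weyl_antisymm (a b c d : Fin n) : g.weyl x a b c d = -g.weyl x b a c d := by
  unfold weyl
  rw [g.riemannLower_antisymm x a b]
  ring

lemma weyl_antisymm' (a b c d : Fin n) : g.weyl x a b c d = -g.weyl x a b d c := by
  unfold weyl
  rw [g.riemannLower_antisymm' x a b]
  ring

lemma weyl_pair (a b c d : Fin n) : g.weyl x a b c d = g.weyl x c d a b := by
  unfold weyl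
  rw [g.riemannLower_pair x a b]
  rw [g.lower_symm x c a, g.lower_symm x c b, g.lower_symm x d b, g.lower_symm x d a,
    g.schouten_symm x b d, g.schouten_symm x a d, g.schouten_symm x a c, g.schouten_symm x b c]
  ring

lemma weyl_bianchi (a b c d : Fin n) :
    g.weyl x a b c d + g.weyl x b d c a + g.weyl x d a c b = 0 := by
  have := g.riemannLower_bianchi x a b c d
  unfold weyl
  rw [g.lower_symm x d b, g.lower_symm x d a, g.lower_symm x a b, g.schouten_symm x b d,
    g.schouten_symm x a d, g.schouten_symm x b a]
  linarith

/-- The Weyl tensor is trace-free. -/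
lemma weyl_trace (hn : 3 ≤ n) (a b : Fin n) :
    ∑ c, ∑ e, g.upper x c e * g.weyl x c a e b = 0 := by
  -- The Schouten terms of the decomposition have trace `(n - 2) P + J g`, which is the whole Ricci
  -- tensor, so nothing remains for the Weyl part.
  have h : ∑ c, ∑ e, g.upper x c e * g.riemannLower x c a e b
      = ∑ c, ∑ e, g.upper x c e * g.weyl x c a e b
        + (n * g.schouten x a b - g.schouten x a b
          + (g.lower x a b * g.traceSchouten x - g.schouten x a b)) := by
    have e1 := g.sum_upper_mul_lower (x := x)
    have e2 := g.sum_upper_mul_schouten (x := x) hn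
    have e3 : ∀ X : Fin n → ℝ, ∑ c, ∑ e, g.upper x c e * (g.lower x e a * X c) = X a := by
      intro X
      simp only [← mul_assoc, ← Finset.sum_mul, g.sum_upper_lower]
      simp
    have e4 : ∀ X : Fin n → ℝ, ∑ c, ∑ e, g.upper x c e * (g.lower x b c * X e) = X b := by
      intro X
      have : ∀ e, ∑ c, g.upper x c e * (g.lower x b c * X e) = if b = e then X e else 0 := by
        intro e
        have h := congrArg (· * X e) (g.sum_lower_upper x b e)
        simp only [Finset.sum_mul, ite_mul, one_mul, zero_mul] at h
        rw [← h]
        exact Finset.sum_congr rfl fun c _ => by ring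
      rw [Finset.sum_comm]
      simp [this]
    rw [← e1, ← e2]
    nth_rewrite 2 [← e3 (fun c => g.schouten x c b)]
    nth_rewrite 2 [← e4 (fun e => g.schouten x a e)]
    simp only [Finset.sum_mul, Finset.mul_sum, ← Finset.sum_add_distrib, ← Finset.sum_sub_distrib]
    refine Finset.sum_congr rfl fun c _ => Finset.sum_congr rfl fun e _ => ?_
    rw [g.riemannLower_eq_weyl, g.lower_symm x e c, g.lower_symm x b a]
    ring
  rw [← ricci_eq, g.ricci_eq_schouten hn] at h
  linarith

end Metric

end Curvature

/-! ## The curvature as smooth tensor fields -/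

section CurvatureFields

variable {n : ℕ} {M : Type*} [TopologicalSpace M] [ChartedSpace (Coord n) M]
  [IsManifold (𝓡 n) ∞ M]

namespace Metric

variable (g : Metric n M)

/-- The Ricci tensor as a tensor field. -/
def ricciF : TensorField n M 2 := fun y i => g.ricci y (i 0) (i 1)

/-- The scalar curvature as a tensor field. -/
def scalarF : TensorField n M 0 := fun y _ => g.scalar y

/-- The Schouten tensor as a tensor field. -/
def schoutenF : TensorField n M 2 := fun y i => g.schouten y (i 0) (i 1)

/-- The Weyl tensor as a tensor field. -/
def weylF : TensorField n M 4 := fun y i => g.weyl y (i 0) (i 1) (i 2) (i 3)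

lemma ricciF_eq : g.ricciF = g.trace (permF (Equiv.swap 1 2) g.curv) := by
  funext y i
  exact g.ricci_eq y _ _

lemma scalarF_eq : g.scalarF = g.trace g.ricciF := rfl

lemma schoutenF_eq : g.schoutenF = ((n : ℝ) - 2)⁻¹ •
    (g.ricciF - (2 * ((n : ℝ) - 1))⁻¹ • outerF g.comp g.scalarF) := by
  funext y i
  show g.schouten y (i 0) (i 1) = ((n : ℝ) - 2)⁻¹ * (g.ricci y (i 0) (i 1)
    - (2 * ((n : ℝ) - 1))⁻¹ * (g.lower y (i 0) (i 1) * g.scalar y))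
  unfold schouten
  ring

/-- The permutation of the indices in the Kulkarni-Nomizu product. -/
def kulkarniPerm : Equiv.Perm (Fin 4) := Equiv.ofBijective ![2, 0, 1, 3] (by decide)

/-- All correction terms are index permutations of the single product `g ⊗ P`, which reduces
smoothness of the Weyl tensor to the rules for natural operations. -/
lemma weylF_eq : g.weylF = g.curv
    - (permF kulkarniPerm (outerF g.comp g.schoutenF)
      - permF (Equiv.swap 0 1 * kulkarniPerm) (outerF g.comp g.schoutenF))
    - (permF (Equiv.swap 0 1 * Equiv.swap 2 3 * kulkarniPerm) (outerF g.comp g.schoutenF)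
      - permF (Equiv.swap 2 3 * kulkarniPerm) (outerF g.comp g.schoutenF)) := by
  funext y i
  rfl

variable {g} {x : M}

lemma smoothIn_ricciF : SmoothIn x g.ricciF := by
  rw [ricciF_eq]
  exact smoothIn_trace (smoothIn_permF _ (g.smoothIn_curv x))

lemma smoothIn_scalarF : SmoothIn x g.scalarF := by
  rw [scalarF_eq]
  exact smoothIn_trace (r := 0) smoothIn_ricciF

lemma smoothIn_schoutenF : SmoothIn x g.schoutenF := by
  rw [schoutenF_eq]
  exact smoothIn_smul _ (smoothIn_sub smoothIn_ricciF
    (smoothIn_smul _ (smoothIn_outerF (g.smooth x) smoothIn_scalarF)))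

lemma smoothIn_weylF : SmoothIn x g.weylF := by
  have h : SmoothIn x (outerF g.comp g.schoutenF) :=
    smoothIn_outerF (g.smooth x) smoothIn_schoutenF
  rw [weylF_eq]
  exact smoothIn_sub (smoothIn_sub (g.smoothIn_curv x)
    (smoothIn_sub (smoothIn_permF _ h) (smoothIn_permF _ h)))
    (smoothIn_sub (smoothIn_permF _ h) (smoothIn_permF _ h))

/-! ### Smoothness of `C ♦ f` -/

/-- The double contraction `C_{ab}{}^{pq} f_{qp …}` as a tensor field. -/
def weylContr {r : ℕ} (g : Metric n M) (f : TensorField n M (r + 2)) : TensorField n M (r + 2) :=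
  g.trace (permF (r := r + 4) (Equiv.swap 0 2 * Equiv.swap 1 3) (contrF g (s := 3) (r := r + 1) g.weylF f))

lemma smoothIn_weylContr {r : ℕ} {f : TensorField n M (r + 2)} (hf : SmoothIn x f) :
    SmoothIn x (weylContr g f) :=
  smoothIn_trace (smoothIn_permF _ (smoothIn_contrF (s := 3) (r := r + 1) smoothIn_weylF hf))

lemma cons4_perm {r : ℕ} (a b c d : Fin n) (i : Fin r → Fin n) :
    (fun s => cons c (cons d (cons a (cons b i)))
      ((Equiv.swap 0 2 * Equiv.swap 1 3 : Equiv.Perm (Fin (r + 4))) s))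
      = cons a (cons b (cons c (cons d i))) := by
  funext s
  refine Fin.cases ?_ (fun s => Fin.cases ?_ (fun s => Fin.cases ?_ (fun s => Fin.cases ?_
    (fun s => ?_) s) s) s) s
  · rfl
  · rfl
  · rfl
  · rfl
  · rw [Equiv.Perm.mul_apply, Equiv.swap_apply_of_ne_of_ne (a := 1), Equiv.swap_apply_of_ne_of_ne]
    · rfl
    all_goals
      intro h
      have h' := congrArg Fin.val h
      simp only [Fin.val_succ] at h'
      first
      | (rw [Fin.val_zero] at h'; omega)
      | (rw [Fin.val_one] at h'; omega)
      | (change _ = 2 % (r + 4) at h'; rw [Nat.mod_eq_of_lt (by omega)] at h'; omega)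
      | (change _ = 3 % (r + 4) at h'; rw [Nat.mod_eq_of_lt (by omega)] at h'; omega)

lemma weylContr_apply {r : ℕ} (f : TensorField n M (r + 2)) (y : M) (a b : Fin n)
    (i : Fin r → Fin n) : weylContr g f y (cons a (cons b i))
      = ∑ p, ∑ q, g.weylUpUp y a b p q * f y (cons q (cons p i)) := by
  have h1 : ∀ c p, permF (r := r + 4) (Equiv.swap 0 2 * Equiv.swap 1 3) (contrF g (s := 3) (r := r + 1) g.weylF f) y
      (cons c (cons p (cons a (cons b i)))) = ∑ d, ∑ q, g.upper y d q * g.weyl y a b c d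
        * f y (cons q (cons p i)) := by
    intro c p
    show contrF g (s := 3) (r := r + 1) g.weylF f y _ = _
    rw [cons4_perm]
    show contr (g.comp y) (s := 0) (r := r + 1) (ins c (ins b (ins a (g.weylF y)))) (f y) (cons p i) = _
    simp only [contr, Finset.sum_apply, Pi.smul_apply, smul_eq_mul]
    rfl
  simp only [weylContr, trace, h1, weylUpUp, weylUp, Finset.mul_sum, Finset.sum_mul]
  refine Finset.sum_comm.trans (Finset.sum_congr rfl fun p _ => ?_)
  refine Eq.trans (Finset.sum_congr rfl fun c _ => ?_) Finset.sum_comm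
  refine Finset.sum_comm.trans
    (Finset.sum_congr rfl fun q _ => Finset.sum_congr rfl fun d _ => ?_)
  rw [g.upper_symm y c p, g.upper_symm y d q]
  ring

/-- `weylContr` contracts in the reversed order, hence the minus sign. The second term of `C ♦ f` is
the first one with the outer index and the second of the skewed indices exchanged. -/
lemma blackDiamond_eq {l : ℕ} {f : TensorField n M (l + 3)} (hf : ∀ y, IsAlt (f y)) :
    g.blackDiamond (l + 3) f = tailSkewF (-((((l : ℝ) + 3) - 2) / ((l : ℝ) + 3)) •
      (weylContr g f + permF (Equiv.swap 0 2) (weylContr g f))) := by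
  have h0 : ∀ y (i : Fin (l + 3) → Fin n),
      ∑ p, ∑ q, g.weylUpUp y (i 0) (i 1) p q * f y (cons p (cons q (tl (tl i))))
        = -weylContr g f y i := by
    intro y i
    have hi : i = cons (i 0) (cons (i 1) (tl (tl i))) := by
      conv_lhs => rw [← cons_tl i, ← cons_tl (tl i)]
      rfl
    conv_rhs => rw [hi, weylContr_apply]
    simp only [← Finset.sum_neg_distrib]
    refine Finset.sum_congr rfl fun p _ => Finset.sum_congr rfl fun q _ => ?_
    rw [(hf y).2 p q]
    ring
  funext y i
  unfold blackDiamond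
  show skew _ (tl i) = skew _ (tl i)
  congr 1
  funext b
  have h1 := h0 y (cons (i 0) b)
  have h2 := h0 y (cons (b 1) (cons (b 0) (cons (i 0) (tl (tl b)))))
  have h3 : (fun s => (cons (i 0) b) ((Equiv.swap 0 2 : Equiv.Perm (Fin (l + 3))) s))
      = cons (b 1) (cons (b 0) (cons (i 0) (tl (tl b)))) := by
    funext s
    refine Fin.cases ?_ (fun s => Fin.cases ?_ (fun s => Fin.cases ?_ (fun s => ?_) s) s) s
    · rfl
    · rfl
    · rfl
    · rw [Equiv.swap_apply_of_ne_of_ne]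
      · rfl
      · exact Fin.succ_ne_zero _
      · intro h
        have h' := congrArg Fin.val h
        simp only [Fin.val_succ] at h'
        change _ = 2 % (l + 3) at h'
        rw [Nat.mod_eq_of_lt (by omega)] at h'
        omega
  show _ * (_ + _) = -_ * (weylContr g f y (cons (i 0) b) + weylContr g f y
    (fun s => (cons (i 0) b) ((Equiv.swap 0 2 : Equiv.Perm (Fin (l + 3))) s)))
  rw [h3]
  refine (congrArg₂ (fun s t => _ * (s + t)) h1 h2).trans ?_
  ring

lemma smoothIn_blackDiamond {k : ℕ} {f : TensorField n M k} (hf : ∀ y, IsAlt (f y))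
    (hs : SmoothIn x f) : SmoothIn x (g.blackDiamond k f) := by
  match k, f, hf, hs with
  | 0, _, _, _ => exact smoothIn_zero
  | 1, _, _, _ => exact smoothIn_zero
  | 2, _, _, _ => exact smoothIn_zero
  | l + 3, f, hf, hs =>
    rw [blackDiamond_eq hf]
    exact smoothIn_tailSkewF (smoothIn_smul _ (smoothIn_add (smoothIn_weylContr hs)
      (smoothIn_permF _ (smoothIn_weylContr hs))))

end Metric

end CurvatureFields

/-! ## The second Bianchi identity -/

section SecondBianchi

variable {n : ℕ} {M : Type*} [TopologicalSpace M] [ChartedSpace (Coord n) M]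
  [IsManifold (𝓡 n) ∞ M]

lemma IsMetricOn.upper_symm {G : Coord n → Tensor n 2} {U : Set (Coord n)} (hG : IsMetricOn G U)
    {u : Coord n} (hu : u ∈ U) (a b : Fin n) : (toMatrix (G u))⁻¹ a b = (toMatrix (G u))⁻¹ b a := by
  have h : (toMatrix (G u)).IsSymm := by
    ext a b
    exact hG.symm u hu b a
  have h' := h.inv
  exact congrFun (congrFun h' b) a

lemma IsMetricOn.coordRiemann_eq {G : Coord n → Tensor n 2} {U : Set (Coord n)}
    (hG : IsMetricOn G U) {u : Coord n} (hu : u ∈ U) (a b c d : Fin n) :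
    coordRiemann G u a b c d = ∑ e, (toMatrix (G u))⁻¹ c e * coordRiemannLower G u ![a, b, e, d] := by
  have h : ∀ p, ∑ e, (toMatrix (G u))⁻¹ c e * G u ![e, p] = if c = p then 1 else 0 := fun p => by
    have hd : IsUnit (toMatrix (G u)).det := hG.det u hu
    have := congrFun (congrFun (Matrix.nonsing_inv_mul _ hd) c) p
    rwa [Matrix.mul_apply, Matrix.one_apply] at this
  have h2 : ∀ e, coordRiemannLower G u ![a, b, e, d]
      = ∑ p, G u ![e, p] * coordRiemann G u a b p d := fun e => rfl
  simp only [h2, Finset.mul_sum, ← mul_assoc]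
  rw [Finset.sum_comm]
  simp only [← Finset.sum_mul, h]
  simp

namespace Metric

variable {g : Metric n M} {x : M}

/-- The covector field with constant components `η` in the chart at `x`. -/
def constForm (x : M) (η : Tensor n 1) : TensorField n M 1 := fun y =>
  pull (chartJac x (extChartAt (𝓡 n) x y))⁻¹ η

lemma inChart_constForm (η : Tensor n 1) {u : Coord n} (hu : u ∈ (extChartAt (𝓡 n) x).target) :
    inChart x (constForm x η) u = η := by
  rw [inChart_eq_pull, constForm, (extChartAt (𝓡 n) x).right_inv hu, pull_mul,
    Matrix.nonsing_inv_mul _ (isUnit_det_chartJac hu), pull_one]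

lemma smoothIn_constForm (η : Tensor n 1) : SmoothIn x (constForm x η) :=
  SmoothIn.congr (smoothOn_const η) fun _ hu => inChart_constForm η hu

lemma constForm_self (η : Tensor n 1) : constForm x η x = η := by
  rw [← inChart_self x (constForm x η), inChart_constForm η (mem_extChartAt_target x)]

/-- The Ricci identity for a covector with constant components, stated as an equality of tensor
fields over the whole chart so that it can be differentiated covariantly. -/
lemma inChart_nabla_nabla_constForm (η : Tensor n 1) {u : Coord n}
    (hu : u ∈ (extChartAt (𝓡 n) x).target) :
    inChart x (g.nabla (g.nabla (constForm x η))
      - permF (Equiv.swap 0 1) (g.nabla (g.nabla (constForm x η)))) u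
    = inChart x ((-1 : ℝ) • contrF g (s := 3) (r := 0) (permF (Equiv.swap 2 3) g.curv)
        (constForm x η)) u := by
  have hG := g.isMetricOn x
  have hs := smoothIn_constForm (x := x) η
  have hη : SmoothOn (fun _ : Coord n => η) (extChartAt (𝓡 n) x).target := smoothOn_const η
  have h1 : ∀ v ∈ (extChartAt (𝓡 n) x).target, inChart x (g.nabla (constForm x η)) v
      = coordNabla (inChart x g.comp) (fun _ => η) v := fun v hv => by
    rw [inChart_nabla g hs hv]
    refine coordNabla_congr ?_
    filter_upwards [(isOpen_extChartAt_target x).mem_nhds hv] with w hw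
      using inChart_constForm η hw
  have h2 : inChart x (g.nabla (g.nabla (constForm x η))) u
      = coordNabla (inChart x g.comp) (coordNabla (inChart x g.comp) (fun _ => η)) u := by
    rw [inChart_nabla g (g.smoothIn_nabla hs) hu]
    refine coordNabla_congr ?_
    filter_upwards [(isOpen_extChartAt_target x).mem_nhds hu] with w hw using h1 w hw
  have h3 : ∀ b c d, inChart x (g.nabla (g.nabla (constForm x η))) u ![b, c, d]
      - inChart x (g.nabla (g.nabla (constForm x η))) u ![c, b, d]
      = -∑ p, coordRiemann (inChart x g.comp) u b c p d * η ![p] := fun b c d => by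
    rw [h2]
    have := hG.ricci_identity hu hη b c ![d]
    rwa [act_one] at this
  rw [sub_eq_add_neg, ← neg_one_smul ℝ (permF _ _), inChart_add, inChart_smul, inChart_smul,
    inChart_contrF hu, inChart_constForm η hu]
  refine tensor_ext_ins fun b => tensor_ext_ins fun c => tensor_ext_ins fun d => ?_
  funext i
  have hi : i = ![] := Subsingleton.elim _ _
  subst hi
  show inChart x (g.nabla (g.nabla (constForm x η))) u ![b, c, d]
    + (-1 : ℝ) * inChart x (permF (Equiv.swap 0 1) (g.nabla (g.nabla (constForm x η)))) u ![b, c, d]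
    = (-1 : ℝ) * (∑ p, ∑ q, ((toMatrix (inChart x g.comp u))⁻¹ p q *
      inChart x (permF (Equiv.swap 2 3) g.curv) u ![b, c, d, p]) • ins q η) ![]
  rw [inChart_permF]
  have e1 : (fun s => (![b, c, d] : Fin 3 → Fin n) ((Equiv.swap 0 1 : Equiv.Perm (Fin 3)) s))
      = ![c, b, d] := by
    funext s; fin_cases s <;> rfl
  have e2 : ∀ p, (fun s => (![b, c, d, p] : Fin 4 → Fin n) ((Equiv.swap 2 3 : Equiv.Perm (Fin 4)) s))
      = ![b, c, p, d] := fun p => by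
    funext s; fin_cases s <;> rfl
  simp only [inChart_permF, e2, inChart_curv g hu, Finset.sum_apply, Pi.smul_apply, smul_eq_mul]
  rw [e1, neg_one_mul, ← sub_eq_add_neg, h3, neg_one_mul]
  simp only [hG.coordRiemann_eq hu, Finset.sum_mul]
  rw [Finset.sum_comm]
  refine congrArg Neg.neg (Finset.sum_congr rfl fun p _ => Finset.sum_congr rfl fun q _ => ?_)
  rw [hG.upper_symm hu]
  rfl

/-- The second Bianchi identity. -/
lemma nabla_curv_bianchi (a b c d e : Fin n) :
    g.nabla g.curv x ![a, b, c, d, e] + g.nabla g.curv x ![b, c, a, d, e]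
      + g.nabla g.curv x ![c, a, b, d, e] = 0 := by
  -- With this covector at `x`, raising an index of the curvature and contracting with it reads off
  -- the component with index `d`.
  set η : Tensor n 1 := fun i => g.lower x (i 0) d with hη
  set w := constForm x η with hw
  have hs : SmoothIn x w := smoothIn_constForm η
  have hs1 := g.smoothIn_nabla hs
  have hs2 := g.smoothIn_nabla hs1
  have hS : SmoothIn x (permF (Equiv.swap 2 3) g.curv) := smoothIn_permF _ (g.smoothIn_curv x)
  have hc := nabla_congr g fun u hu => inChart_nabla_nabla_constForm (g := g) (x := x) η hu
  rw [nabla_sub hs2 (smoothIn_permF _ hs2),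
    nabla_smul _ (smoothIn_contrF (s := 3) (r := 0) hS hs)] at hc
  have h1 : ∀ a b c, g.nabla (g.nabla (g.nabla w)) x ![a, b, c, e]
      - g.nabla (g.nabla (g.nabla w)) x ![a, c, b, e]
      = -(g.nabla g.curv x ![a, b, c, d, e] + ∑ p, g.riemann x b c p e * g.nabla w x ![a, p]) := by
    intro a b c
    have hc' := congrFun hc ![a, b, c, e]
    have hp := nabla_permF (g := g) (Equiv.swap 0 1) hs2 a ![b, c, e]
    have e1 : (fun s => (![b, c, e] : Fin 3 → Fin n) ((Equiv.swap 0 1 : Equiv.Perm (Fin 3)) s))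
        = ![c, b, e] := by
      funext s; fin_cases s <;> rfl
    have e2 : ∀ p, (fun s => (![b, c, e, p] : Fin 4 → Fin n)
        ((Equiv.swap 2 3 : Equiv.Perm (Fin 4)) s)) = ![b, c, p, e] := fun p => by
      funext s; fin_cases s <;> rfl
    rw [e1] at hp
    have hcon := congrFun (nabla_contrF (g := g) (s := 3) (r := 0) hS hs a) ![b, c, e]
    have hcon1 : contr (g.comp x) (s := 3) (r := 0)
        (ins a (g.nabla (permF (Equiv.swap 2 3) g.curv) x)) (w x) ![b, c, e]
        = ∑ p, ∑ q, g.upper x p q * g.nabla g.curv x ![a, b, c, p, e] * g.lower x q d := by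
      show (∑ p, ∑ q, (g.upper x p q * g.nabla (permF (Equiv.swap 2 3) g.curv) x
        (cons a ![b, c, e, p])) • ins q (w x)) ![] = _
      simp only [nabla_permF _ (g.smoothIn_curv x), e2, Finset.sum_apply, Pi.smul_apply,
        smul_eq_mul, hw, constForm_self]
      rfl
    have hcon2 : contr (g.comp x) (s := 3) (r := 0)
        (permF (Equiv.swap 2 3) g.curv x) (ins a (g.nabla w x)) ![b, c, e]
        = ∑ p, g.riemann x b c p e * g.nabla w x ![a, p] := by
      show (∑ p, ∑ q, (g.upper x p q * g.curv x (fun s => (![b, c, e, p] : Fin 4 → Fin n)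
        ((Equiv.swap 2 3 : Equiv.Perm (Fin 4)) s))) • ins q (ins a (g.nabla w x))) ![] = _
      simp only [e2, Finset.sum_apply, Pi.smul_apply, smul_eq_mul, g.riemann_eq, Finset.sum_mul]
      rw [Finset.sum_comm]
      refine Finset.sum_congr rfl fun p _ => Finset.sum_congr rfl fun q _ => ?_
      rw [g.upper_symm]
      rfl
    have hδ : ∑ p, ∑ q, g.upper x p q * g.nabla g.curv x ![a, b, c, p, e] * g.lower x q d
        = g.nabla g.curv x ![a, b, c, d, e] := by
      have : ∀ p, ∑ q, g.upper x p q * g.nabla g.curv x ![a, b, c, p, e] * g.lower x q d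
          = (if p = d then 1 else 0) * g.nabla g.curv x ![a, b, c, p, e] := fun p => by
        rw [← g.sum_upper_lower, Finset.sum_mul]
        exact Finset.sum_congr rfl fun q _ => by ring
      simp only [this]
      simp
    rw [← hδ, ← hcon1, ← hcon2]
    refine Eq.trans (Eq.trans ?_ hc') ?_
    · exact congrArg (fun t => _ - t) hp.symm
    · refine (neg_one_mul _).trans (congrArg Neg.neg ?_)
      exact hcon
  have h2 : ∀ a b c, g.nabla (g.nabla (g.nabla w)) x ![a, b, c, e]
      - g.nabla (g.nabla (g.nabla w)) x ![b, a, c, e]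
      = -(∑ p, g.riemann x a b p c * g.nabla w x ![p, e]
        + ∑ p, g.riemann x a b p e * g.nabla w x ![c, p]) := fun a b c => by
    have := g.ricci_identity hs1 a b ![c, e]
    rwa [act_two] at this
  have h3 : ∑ p, g.riemann x a b p c * g.nabla w x ![p, e]
      + ∑ p, g.riemann x b c p a * g.nabla w x ![p, e]
      + ∑ p, g.riemann x c a p b * g.nabla w x ![p, e] = 0 := by
    rw [← Finset.sum_add_distrib, ← Finset.sum_add_distrib]
    refine Finset.sum_eq_zero fun p _ => ?_
    rw [← add_mul, ← add_mul, g.riemann_bianchi, zero_mul]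
  -- The cyclic sums of `∇_a [∇_b, ∇_c] w` and of `[∇_a, ∇_b] ∇_c w` are the same alternating sum of
  -- third derivatives. The terms where the curvature acts on the covector slot agree on both sides,
  -- those where it acts on the derivative slot vanish by `h3`, and the derivative of the curvature
  -- is left.
  linarith [h1 a b c, h1 b c a, h1 c a b, h2 a b c, h2 b c a, h2 c a b]

end Metric

end SecondBianchi

/-! ## Creation and annihilation operators and algebraic curvature tensors -/

section Sums

variable {ι V : Type*} [Fintype ι] [AddCommGroup V] [Module ℝ V]

lemma sum_eq_zero_of_antisymm {f : ι → ι → V} (h : ∀ a b, f a b = -f b a) :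
    ∑ a, ∑ b, f a b = 0 := by
  have h1 : ∑ a, ∑ b, f a b = -∑ a, ∑ b, f a b := by
    conv_lhs => rw [Finset.sum_comm]
    rw [← Finset.sum_neg_distrib]
    refine Finset.sum_congr rfl fun a _ => ?_
    rw [← Finset.sum_neg_distrib]
    exact Finset.sum_congr rfl fun b _ => h b a
  have h2 : (2 : ℝ) • ∑ a, ∑ b, f a b = 0 := by
    rw [two_smul]
    nth_rewrite 1 [h1]
    exact neg_add_cancel _
  exact (smul_eq_zero.1 h2).resolve_left two_ne_zero

lemma sum_eq_half {f h : ι → ι → V} (hf : ∀ a b, f a b + f b a = h a b) :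
    ∑ a, ∑ b, f a b = (1 / 2 : ℝ) • ∑ a, ∑ b, h a b := by
  simp only [← hf, Finset.sum_add_distrib]
  rw [Finset.sum_comm (f := fun a b => f b a)]
  module

lemma sum_eq_zero_of_cyclic {f : ι → ι → ι → V} (h : ∀ a b c, f a b c + f b c a + f c a b = 0) :
    ∑ a, ∑ b, ∑ c, f a b c = 0 := by
  have h1 : ∑ a, ∑ b, ∑ c, f b c a = ∑ a, ∑ b, ∑ c, f a b c := by
    rw [Finset.sum_comm]
    refine Finset.sum_congr rfl fun a _ => ?_
    rw [Finset.sum_comm]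
  have h2 : ∑ a, ∑ b, ∑ c, f c a b = ∑ a, ∑ b, ∑ c, f a b c := by
    refine Eq.trans (Finset.sum_congr rfl fun a _ => Finset.sum_comm) Finset.sum_comm
  have h3 : (3 : ℝ) • ∑ a, ∑ b, ∑ c, f a b c = 0 := by
    have : ∑ a, ∑ b, ∑ c, (f a b c + f b c a + f c a b) = 0 := by simp only [h, Finset.sum_const_zero]
    simp only [Finset.sum_add_distrib, h1, h2] at this
    rw [← this]
    module
  exact (smul_eq_zero.1 h3).resolve_left (by norm_num)

end Sums

/-- Creation and annihilation operators `ε^a`, `ι^a` on a vector space, for a scalar product `g`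
with inverse `K`. -/
structure Clifford (n : ℕ) (V : Type*) [AddCommGroup V] [Module ℝ V] where
  E : Fin n → V →ₗ[ℝ] V
  U : Fin n → V →ₗ[ℝ] V
  g : Fin n → Fin n → ℝ
  K : Fin n → Fin n → ℝ
  E_E : ∀ a b v, E a (E b v) = -E b (E a v)
  U_U : ∀ a b v, U a (U b v) = -U b (U a v)
  U_E : ∀ a b v, U a (E b v) = K a b • v - E b (U a v)
  g_symm : ∀ a b, g a b = g b a
  K_symm : ∀ a b, K a b = K b a
  g_K : ∀ a b, ∑ c, g a c * K c b = if a = b then 1 else 0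

namespace Clifford

variable {n : ℕ} {V : Type*} [AddCommGroup V] [Module ℝ V] (A : Clifford n V)

/-- `ε_c`. -/
def L (c : Fin n) : V →ₗ[ℝ] V := ∑ a, A.g c a • A.E a

/-- `ι_c`. -/
def I (c : Fin n) : V →ₗ[ℝ] V := ∑ a, A.g c a • A.U a

lemma L_apply (c : Fin n) (v : V) : A.L c v = ∑ a, A.g c a • A.E a v := by
  simp [L, LinearMap.sum_apply]

lemma I_apply (c : Fin n) (v : V) : A.I c v = ∑ a, A.g c a • A.U a v := by
  simp [I, LinearMap.sum_apply]

lemma K_g (a b : Fin n) : ∑ c, A.K a c * A.g c b = if a = b then 1 else 0 := by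
  have := A.g_K b a
  simp only [eq_comm (a := b)] at this
  rw [← this]
  exact Finset.sum_congr rfl fun c _ => by rw [A.K_symm, A.g_symm, mul_comm]

lemma sum_K_I (a : Fin n) (v : V) : ∑ c, A.K a c • A.I c v = A.U a v := by
  simp only [I_apply, Finset.smul_sum, smul_smul]
  rw [Finset.sum_comm]
  simp only [← Finset.sum_smul, A.K_g]
  simp

lemma E_L (a b : Fin n) (v : V) : A.E a (A.L b v) = -A.L b (A.E a v) := by
  simp only [L_apply, map_sum, map_smul, A.E_E a, smul_neg, Finset.sum_neg_distrib]

lemma U_I (a b : Fin n) (v : V) : A.U a (A.I b v) = -A.I b (A.U a v) := by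
  simp only [I_apply, map_sum, map_smul, A.U_U a, smul_neg, Finset.sum_neg_distrib]

lemma U_L (a b : Fin n) (v : V) :
    A.U a (A.L b v) = (if a = b then (1 : ℝ) else 0) • v - A.L b (A.U a v) := by
  simp only [L_apply, map_sum, map_smul, A.U_E a, smul_sub, Finset.sum_sub_distrib, smul_smul,
    ← Finset.sum_smul]
  congr 2
  rw [← A.K_g a b]
  exact Finset.sum_congr rfl fun c _ => by rw [A.g_symm, mul_comm]

lemma E_I (a b : Fin n) (v : V) :
    A.E a (A.I b v) = (if a = b then (1 : ℝ) else 0) • v - A.I b (A.E a v) := by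
  simp only [I_apply, map_sum, map_smul, A.U_E, smul_sub, Finset.sum_sub_distrib, smul_smul,
    ← Finset.sum_smul, A.g_K, eq_comm (a := b)]
  abel

lemma I_E (a b : Fin n) (v : V) :
    A.I b (A.E a v) = (if a = b then (1 : ℝ) else 0) • v - A.E a (A.I b v) := by
  rw [E_I]; abel

lemma sum_E_I_apply (b : Fin n) (v : Fin n → V) :
    ∑ c, A.E c (A.I b (v c)) = v b - A.I b (∑ c, A.E c (v c)) := by
  simp only [E_I, Finset.sum_sub_distrib, map_sum]
  simp

lemma sum_E_L_apply (b : Fin n) (v : Fin n → V) :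
    ∑ c, A.E c (A.L b (v c)) = -A.L b (∑ c, A.E c (v c)) := by
  simp only [E_L, Finset.sum_neg_distrib, map_sum]

lemma sum_E_L (v : V) : ∑ c, A.E c (A.L c v) = 0 := by
  simp only [L_apply, map_sum, map_smul]
  exact sum_eq_zero_of_antisymm fun a b => by rw [A.E_E, A.g_symm, smul_neg]

lemma sum_U_I_apply (c : Fin n) (v : Fin n → V) :
    ∑ b, A.U b (A.I c (v b)) = -A.I c (∑ b, A.U b (v b)) := by
  simp only [U_I, Finset.sum_neg_distrib, map_sum]

lemma sum_U_I (v : V) : ∑ c, A.U c (A.I c v) = 0 := by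
  simp only [I_apply, map_sum, map_smul]
  exact sum_eq_zero_of_antisymm fun a b => by rw [A.U_U, A.g_symm, smul_neg]

lemma sum_U_L_apply (c : Fin n) (v : Fin n → V) :
    ∑ b, A.U b (A.L c (v b)) = v c - A.L c (∑ b, A.U b (v b)) := by
  simp only [U_L, Finset.sum_sub_distrib, map_sum]
  simp

lemma sum_L_U (v : V) : ∑ c, A.L c (A.U c v) = ∑ c, A.E c (A.I c v) := by
  simp only [I_apply, L_apply, map_sum, map_smul]
  rw [Finset.sum_comm]
  simp only [A.g_symm]

/-- Vectors of degree `q`. -/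
def HasDeg (q : ℝ) (v : V) : Prop := ∑ c, A.E c (A.I c v) = q • v

variable {A}

lemma HasDeg.U {q : ℝ} {v : V} (h : A.HasDeg q v) (a : Fin n) : A.HasDeg (q - 1) (A.U a v) := by
  unfold HasDeg at *
  have h1 : ∀ c, A.E c (A.I c (A.U a v)) = A.U a (A.E c (A.I c v)) - A.K a c • A.I c v := fun c => by
    rw [show A.I c (A.U a v) = -A.U a (A.I c v) by rw [U_I, neg_neg], map_neg, U_E]
    abel
  simp only [h1, Finset.sum_sub_distrib, sum_K_I, ← map_sum, h, map_smul]
  module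

lemma HasDeg.E {q : ℝ} {v : V} (h : A.HasDeg q v) (a : Fin n) : A.HasDeg (q + 1) (A.E a v) := by
  unfold HasDeg at *
  have h1 : ∀ c, A.E c (A.I c (A.E a v)) = A.E a (A.E c (A.I c v))
      + (if a = c then (1 : ℝ) else 0) • A.E c v := fun c => by
    rw [A.I_E, map_sub, map_smul, A.E_E c a]
    abel
  simp only [h1, Finset.sum_add_distrib, ← map_sum, h, map_smul]
  simp
  module

lemma HasDeg.sum {ι : Type*} {s : Finset ι} {q : ℝ} {v : ι → V} (h : ∀ i ∈ s, A.HasDeg q (v i)) :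
    A.HasDeg q (∑ i ∈ s, v i) := by
  unfold HasDeg at *
  simp only [map_sum]
  rw [Finset.sum_comm, Finset.smul_sum]
  exact Finset.sum_congr rfl h

lemma HasDeg.smul {q : ℝ} {v : V} (h : A.HasDeg q v) (a : ℝ) : A.HasDeg q (a • v) := by
  unfold HasDeg at *
  simp only [map_smul, ← Finset.smul_sum, h]
  rw [smul_comm]

/-- The operator complementary to the degree: anticommuting, `ι^b ε_b = n - ε_b ι^b`. This is the
origin of the factors `n - k` and `n - k + 1`. -/
lemma HasDeg.sum_U_L {q : ℝ} {v : V} (h : A.HasDeg q v) :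
    ∑ b, A.U b (A.L b v) = ((n : ℝ) - q) • v := by
  simp only [U_L, Finset.sum_sub_distrib, sum_L_U]
  rw [show ∑ c, A.E c (A.I c v) = q • v from h, sub_smul]
  simp [← Nat.cast_smul_eq_nsmul ℝ]

end Clifford

/-! ## The action of the curvature -/

namespace Clifford

variable {n : ℕ} {V : Type*} [AddCommGroup V] [Module ℝ V]

/-- A pair of a trace-free algebraic curvature tensor `C` and a symmetric `P` with trace `J`. -/
structure CurvData (A : Clifford n V) where
  C : Fin n → Fin n → Fin n → Fin n → ℝ
  P : Fin n → Fin n → ℝ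
  J : ℝ
  C_antisymm : ∀ a b c d, C a b c d = -C b a c d
  C_antisymm' : ∀ a b c d, C a b c d = -C a b d c
  C_pair : ∀ a b c d, C a b c d = C c d a b
  C_bianchi : ∀ a b c d, C a b c d + C b d c a + C d a c b = 0
  C_trace : ∀ a b, ∑ c, ∑ e, A.K c e * C c a e b = 0
  P_symm : ∀ a b, P a b = P b a
  P_trace : ∑ a, ∑ b, A.K a b * P a b = J

namespace CurvData

variable {A : Clifford n V} (D : CurvData A)

/-- `R_{abcd}`. -/
def R (a b c d : Fin n) : ℝ := D.C a b c d + (A.g c a * D.P b d - A.g c b * D.P a d)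
  + (A.g d b * D.P a c - A.g d a * D.P b c)

/-- `P_{bd} ε^d`. -/
def PE (b : Fin n) (v : V) : V := ∑ d, D.P b d • A.E d v

/-- `P_c{}^q ι_q`. -/
def PU (c : Fin n) : V →ₗ[ℝ] V := ∑ q, D.P c q • A.U q

/-- `P_c{}^q ε^c ι_q`. -/
def Pop : V →ₗ[ℝ] V := ∑ c, A.E c ∘ₗ D.PU c

/-- `C_{abc}{}^q ι_q`. -/
def CU (a b c : Fin n) (v : V) : V := ∑ q, D.C a b c q • A.U q v

/-- `R_{bc}{}^q{}_d ε^d ι_q`. -/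
def Rop (b c : Fin n) (v : V) : V := ∑ d, A.E d (∑ q, D.R b c q d • A.U q v)

/-- `C_{deb}{}^q ε^d ε^e ι_q`. -/
def Cop (b : Fin n) (v : V) : V := ∑ d, ∑ e, A.E d (A.E e (D.CU d e b v))

/-- `C_{cd}{}^{bq} ε^d ι_q ι_b`. -/
def X (c : Fin n) (v : V) : V := -∑ d, ∑ b, A.E d (A.U b (D.CU c d b v))

/-- `C_{de}{}^{bq} ε^d ε^e ι_b ι_q`. -/
def W (v : V) : V := ∑ d, ∑ e, ∑ b, A.E d (A.E e (A.U b (D.CU d e b v)))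

lemma PU_apply (c : Fin n) (v : V) : D.PU c v = ∑ q, D.P c q • A.U q v := by
  simp [PU, LinearMap.sum_apply]

lemma Pop_apply (v : V) : D.Pop v = ∑ c, A.E c (D.PU c v) := by
  simp [Pop, LinearMap.sum_apply]

variable {D}

lemma hasDeg_PU {q : ℝ} {v : V} (h : A.HasDeg q v) (c : Fin n) : A.HasDeg (q - 1) (D.PU c v) := by
  rw [PU_apply]
  exact HasDeg.sum fun a _ => (h.U a).smul _

lemma hasDeg_W {q : ℝ} {v : V} (h : A.HasDeg q v) : A.HasDeg q (D.W v) := by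
  refine HasDeg.sum fun d _ => HasDeg.sum fun e _ => HasDeg.sum fun b _ => ?_
  have h1 : A.HasDeg (q - 1) (D.CU d e b v) := HasDeg.sum fun a _ => (h.U a).smul _
  have h2 := ((h1.U b).E e).E d
  rwa [show q - 1 - 1 + 1 + 1 = q by ring] at h2

lemma sum_R (b c d : Fin n) (v : V) : ∑ q, D.R b c q d • A.U q v
    = -D.CU b c d v + D.P c d • A.I b v - D.P b d • A.I c v + A.g d c • D.PU b v
      - A.g d b • D.PU c v := by
  simp only [R, CU, I_apply, PU_apply, Finset.smul_sum, ← Finset.sum_sub_distrib,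
    ← Finset.sum_add_distrib, ← Finset.sum_neg_distrib]
  refine Finset.sum_congr rfl fun q _ => ?_
  rw [D.C_antisymm' b c q d, A.g_symm q b, A.g_symm q c]
  module

lemma CU_cyclic (a b c : Fin n) (v : V) : D.CU a b c v + D.CU b c a v + D.CU c a b v = 0 := by
  simp only [CU, ← Finset.sum_add_distrib, ← add_smul]
  refine Finset.sum_eq_zero fun q _ => ?_
  have := D.C_bianchi a b q c
  rw [D.C_antisymm' a b q c, D.C_antisymm' b c q a, D.C_antisymm' c a q b] at this
  rw [show D.C a b c q + D.C b c a q + D.C c a b q = 0 by linarith, zero_smul]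

lemma CU_antisymm (a b c : Fin n) (v : V) : D.CU a b c v = -D.CU b a c v := by
  simp only [CU, D.C_antisymm a b, neg_smul, Finset.sum_neg_distrib]

lemma CU_trace (a : Fin n) (v : V) : ∑ c, ∑ e, A.K c e • D.CU c a e v = 0 := by
  have h : ∀ c, ∑ e, A.K c e • D.CU c a e v = ∑ q, (∑ e, A.K c e * D.C c a e q) • A.U q v :=
    fun c => by
    simp only [CU, Finset.smul_sum, smul_smul, Finset.sum_smul]
    exact Finset.sum_comm
  simp only [h]
  rw [Finset.sum_comm]
  simp only [← Finset.sum_smul, D.C_trace, zero_smul, Finset.sum_const_zero]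

lemma sum_P_E_E (v : V) : ∑ c, ∑ d, D.P c d • A.E c (A.E d v) = 0 :=
  sum_eq_zero_of_antisymm fun a b => by rw [A.E_E, D.P_symm, smul_neg]

lemma sum_E_PE (v : V) : ∑ c, A.E c (D.PE c v) = 0 := by
  simp only [PE, map_sum, map_smul]
  exact sum_P_E_E v

lemma sum_U_PU (v : V) : ∑ c, A.U c (D.PU c v) = 0 := by
  simp only [PU_apply, map_sum, map_smul]
  exact sum_eq_zero_of_antisymm fun a b => by rw [A.U_U, D.P_symm, smul_neg]

lemma sum_P_U (d : Fin n) (v : V) : ∑ b, D.P b d • A.U b v = D.PU d v := by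
  rw [PU_apply]
  simp only [D.P_symm]

lemma sum_U_PE (v : V) : ∑ b, A.U b (D.PE b v) = D.J • v - D.Pop v := by
  simp only [PE, map_sum, map_smul, U_E, smul_sub, Finset.sum_sub_distrib, smul_smul,
    ← Finset.sum_smul, Pop_apply, PU_apply]
  congr 1
  · rw [← D.P_trace]
    simp only [mul_comm]
  · rw [Finset.sum_comm]
    simp only [D.P_symm]

lemma _root_.ConformalKilling.Clifford.E_cyclic (a b c : Fin n) (v : V) :
    A.E b (A.E c (A.E a v)) = A.E a (A.E b (A.E c v)) := by
  rw [A.E_E c a, map_neg, A.E_E b a, neg_neg]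

/-- A product of three creation operators is invariant under cyclic permutation, so only the cyclic
sum of the Weyl tensor is seen. -/
lemma sum_E_Cop (v : V) : ∑ b, A.E b (D.Cop b v) = 0 := by
  simp only [Cop, map_sum]
  refine sum_eq_zero_of_cyclic fun b d e => ?_
  rw [A.E_cyclic d e b, A.E_cyclic b d e, A.E_cyclic b d e, ← map_add, ← map_add, ← map_add,
    ← map_add, ← map_add, ← map_add, CU_cyclic, map_zero, map_zero, map_zero]

/-- The Bianchi identity converts the Weyl part into half of `Cop`. Two of the four Schouten terms
pair a symmetric tensor with two creation operators and vanish; one of the others is evaluated by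
the degree, and the last gives the term with `Pop`. -/
lemma sum_E_Rop {q : ℝ} {v : V} (h : A.HasDeg q v) (b : Fin n) :
    ∑ c, A.E c (D.Rop b c v) = (1 / 2 : ℝ) • D.Cop b v + q • D.PE b v + A.L b (D.Pop v) := by
  have h1 : ∑ c, ∑ d, A.E c (A.E d (-D.CU b c d v)) = (1 / 2 : ℝ) • D.Cop b v := by
    refine sum_eq_half fun c d => ?_
    rw [A.E_E d c, ← sub_eq_add_neg, ← map_sub, ← map_sub]
    congr 2
    have := CU_cyclic (D := D) b c d v
    rw [CU_antisymm d b] at this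
    rw [eq_neg_of_add_eq_zero_left (a := D.CU b c d v) (b := D.CU c d b v + -D.CU b d c v)
      (by rw [← add_assoc]; exact this)]
    abel
  have h2 : ∑ c, ∑ d, A.E c (A.E d (D.P c d • A.I b v)) = 0 := by
    simp only [map_smul]
    exact sum_P_E_E _
  have h3 : ∑ c, ∑ d, A.E c (A.E d (D.P b d • A.I c v)) = -(q • D.PE b v) := by
    have : ∀ c d, A.E c (A.E d (D.P b d • A.I c v)) = -(D.P b d • A.E d (A.E c (A.I c v))) :=
      fun c d => by rw [map_smul, map_smul, A.E_E, smul_neg]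
    simp only [this, Finset.sum_neg_distrib]
    rw [Finset.sum_comm]
    simp only [← Finset.smul_sum, ← map_sum]
    rw [show ∑ c, A.E c (A.I c v) = q • v from h]
    simp only [PE, map_smul, Finset.smul_sum, smul_comm q]
  have h4 : ∑ c, ∑ d, A.E c (A.E d (A.g d c • D.PU b v)) = 0 := by
    simp only [map_smul]
    exact sum_eq_zero_of_antisymm fun a b => by rw [A.E_E, A.g_symm, smul_neg]
  have h5 : ∑ c, ∑ d, A.E c (A.E d (A.g d b • D.PU c v)) = -A.L b (D.Pop v) := by
    rw [Pop_apply, ← A.sum_E_L_apply]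
    simp only [L_apply, map_sum, map_smul, A.g_symm b]
  simp only [Rop, sum_R, map_sub, map_add, map_sum, Finset.sum_sub_distrib,
    Finset.sum_add_distrib]
  rw [h1, h2, h3, h4, h5]
  abel

/-- The algebraic form of the fact that the exterior derivative squares to zero; it is what removes
or computes the totally skew part of each unknown derivative. -/
lemma sum_E_E_Rop {q : ℝ} {v : V} (h : A.HasDeg q v) :
    ∑ b, A.E b (∑ c, A.E c (D.Rop b c v)) = 0 := by
  simp only [sum_E_Rop h, map_add, map_smul, Finset.sum_add_distrib, ← Finset.smul_sum,
    sum_E_Cop, sum_E_PE, sum_E_L]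
  simp

lemma sum_K_CU_left (a : Fin n) (v : V) : ∑ b, ∑ d, A.K b d • D.CU b a d v = 0 := CU_trace a v

lemma sum_K_CU_right (a : Fin n) (v : V) : ∑ b, ∑ d, A.K b d • D.CU a d b v = 0 := by
  rw [Finset.sum_comm]
  have h : ∀ d b, A.K b d • D.CU a d b v = -(A.K d b • D.CU d a b v) := fun d b => by
    rw [CU_antisymm, A.K_symm, smul_neg]
  simp only [h, Finset.sum_neg_distrib, CU_trace, neg_zero]

/-- Moving `ι^b` past `ε^d` yields a trace part, in which the Weyl tensor disappears, and a
remainder, in which pair symmetry and Bianchi reduce it to half of `X`. The multiples of `PU` add up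
to `q - n`, since `PU` lowers the degree by one. -/
lemma sum_U_Rop {q : ℝ} {v : V} (h : A.HasDeg q v) (c : Fin n) :
    ∑ b, A.U b (D.Rop b c v) = -((n - q : ℝ) • D.PU c v) - D.J • A.I c v
      + (1 / 2 : ℝ) • D.X c v + A.I c (D.Pop v) := by
  have hK : ∑ b, ∑ d, A.K b d * A.g d b = n := by
    simp only [K_g]
    simp
  have f1 : ∑ b, ∑ d, A.K b d • D.P c d • A.I b v = D.PU c v := by
    rw [Finset.sum_comm, PU_apply]
    refine Finset.sum_congr rfl fun d _ => ?_
    rw [← A.sum_K_I, Finset.smul_sum]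
    exact Finset.sum_congr rfl fun b _ => by rw [smul_comm, A.K_symm]
  have f2 : ∑ b, ∑ d, A.K b d • D.P b d • A.I c v = D.J • A.I c v := by
    simp only [smul_smul, ← Finset.sum_smul, D.P_trace]
  have f3 : ∑ b, ∑ d, A.K b d • A.g d c • D.PU b v = D.PU c v := by
    simp only [smul_smul, ← Finset.sum_smul, K_g]
    simp
  have f4 : ∑ b, ∑ d, A.K b d • A.g d b • D.PU c v = (n : ℝ) • D.PU c v := by
    simp only [smul_smul, ← Finset.sum_smul, hK]
  have s0 : ∑ b, ∑ d, A.E d (A.U b (D.CU b c d v)) = (1 / 2 : ℝ) • D.X c v := by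
    rw [Finset.sum_comm]
    have : ∀ d, ∑ b, A.U b (D.CU b c d v) = (1 / 2 : ℝ) • ∑ b, A.U b (-D.CU c d b v) := by
      intro d
      simp only [CU, map_sum, map_neg, map_smul, ← Finset.sum_neg_distrib]
      refine sum_eq_half fun a b => ?_
      rw [A.U_U b a, smul_neg, ← sub_eq_add_neg, ← sub_smul, ← neg_smul]
      congr 1
      have := D.C_bianchi c a d b
      rw [D.C_antisymm c a, D.C_pair a b, D.C_antisymm d c] at this
      linarith
    simp only [← map_sum, this, map_smul, ← Finset.smul_sum, X, map_neg, Finset.sum_neg_distrib]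
  have s1 : ∑ b, ∑ d, A.E d (A.U b (D.P c d • A.I b v)) = 0 := by
    rw [Finset.sum_comm]
    simp only [map_smul, ← Finset.smul_sum, ← map_sum, sum_U_I, map_zero, smul_zero,
      Finset.sum_const_zero]
  have s2 : ∑ b, ∑ d, A.E d (A.U b (D.P b d • A.I c v)) = A.I c (D.Pop v) - D.PU c v := by
    rw [Finset.sum_comm]
    have : ∀ d, ∑ b, A.U b (D.P b d • A.I c v) = -A.I c (D.PU d v) := fun d => by
      simp only [← sum_P_U d, map_smul, U_I, smul_neg, Finset.sum_neg_distrib, map_sum]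
    simp only [← map_sum, this, map_neg, Finset.sum_neg_distrib]
    rw [A.sum_E_I_apply, Pop_apply]
    abel
  have s3 : ∑ b, ∑ d, A.E d (A.U b (A.g d c • D.PU b v)) = 0 := by
    rw [Finset.sum_comm]
    simp only [map_smul, ← Finset.smul_sum, ← map_sum, sum_U_PU, map_zero, smul_zero,
      Finset.sum_const_zero]
  have s4 : ∑ b, ∑ d, A.E d (A.U b (A.g d b • D.PU c v)) = (q - 1) • D.PU c v := by
    rw [← show ∑ e, A.E e (A.I e (D.PU c v)) = _ from hasDeg_PU h c, ← A.sum_L_U]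
    simp only [L_apply, map_smul, A.g_symm]
  simp only [Rop, map_sum, U_E, sum_R, Finset.sum_sub_distrib]
  simp only [smul_sub, smul_add, smul_neg, map_sub, map_add, map_neg, Finset.sum_sub_distrib,
    Finset.sum_add_distrib, Finset.sum_neg_distrib, f1, f2, f3, f4, s0, s1, s2, s3, s4,
    sum_K_CU_left]
  module

/-- Both terms in which `ι^b` hits a creation operator are traces of the Weyl tensor. -/
lemma sum_U_Cop (v : V) : ∑ b, A.U b (D.Cop b v) = D.W v := by
  have h1 : ∑ b, ∑ d, ∑ e, A.K b d • A.E e (D.CU d e b v) = 0 := by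
    refine Eq.trans (Finset.sum_congr rfl fun b _ => Finset.sum_comm) ?_
    rw [Finset.sum_comm]
    simp only [← map_smul, ← map_sum]
    refine Finset.sum_eq_zero fun e _ => ?_
    rw [Finset.sum_comm]
    simp only [A.K_symm, CU_trace, map_zero]
  have h2 : ∑ b, ∑ d, ∑ e, A.K b e • A.E d (D.CU d e b v) = 0 := by
    rw [Finset.sum_comm]
    simp only [← map_smul, ← map_sum, sum_K_CU_right, map_zero, Finset.sum_const_zero]
  have h3 : ∑ b, ∑ d, ∑ e, A.E d (A.E e (A.U b (D.CU d e b v))) = D.W v := by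
    rw [Finset.sum_comm]
    exact Finset.sum_congr rfl fun d _ => Finset.sum_comm
  simp only [Cop, map_sum, U_E, map_sub, map_smul, Finset.sum_sub_distrib, h1, h2, h3]
  abel

lemma sum_E_X (v : V) : ∑ c, A.E c (D.X c v) = -D.W v := by
  simp only [X, map_sum, map_neg, Finset.sum_neg_distrib, W]

/-- The trace term pairs the skew indices of the Weyl tensor with the symmetric inverse metric; in
the other term three annihilation operators see only a cyclic sum. -/
lemma sum_U_X (v : V) : ∑ c, A.U c (D.X c v) = 0 := by
  have h1 : ∑ c, ∑ d, ∑ b, A.K c d • A.U b (D.CU c d b v) = 0 := by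
    refine sum_eq_zero_of_antisymm fun c d => ?_
    rw [← Finset.sum_neg_distrib]
    exact Finset.sum_congr rfl fun b _ => by rw [CU_antisymm, A.K_symm, map_neg, smul_neg]
  have h2 : ∑ c, ∑ d, ∑ b, A.E d (A.U c (A.U b (D.CU c d b v))) = 0 := by
    rw [Finset.sum_comm]
    refine Finset.sum_eq_zero fun d _ => ?_
    simp only [← map_sum, CU]
    rw [← map_zero (A.E d)]
    congr 1
    simp only [map_sum, map_smul]
    refine sum_eq_zero_of_cyclic fun c b q => ?_
    have e1 : A.U b (A.U q (A.U c v)) = A.U c (A.U b (A.U q v)) := by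
      rw [A.U_U q c, map_neg, A.U_U b c, neg_neg]
    have e2 : A.U q (A.U c (A.U b v)) = A.U c (A.U b (A.U q v)) := by
      rw [A.U_U q c, A.U_U q b, map_neg, neg_neg]
    rw [e1, e2, ← add_smul, ← add_smul]
    have h1 := D.C_bianchi q b d c
    rw [D.C_pair q b, D.C_pair b c, D.C_pair c q, D.C_antisymm d c q b, D.C_antisymm d q b c,
      D.C_antisymm d b c q, D.C_antisymm' c d q b, D.C_antisymm' q d b c,
      D.C_antisymm' b d c q] at h1
    rw [show D.C c d b q + D.C b d q c + D.C q d c b = 0 by linarith, zero_smul]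
  simp only [X, map_neg, map_sum, U_E, Finset.sum_neg_distrib, Finset.sum_sub_distrib, h1, h2]
  simp

end CurvData

end Clifford

/-! ## The algebra of the prolongation -/

namespace Clifford

namespace CurvData

variable {n : ℕ} {V : Type*} [AddCommGroup V] [Module ℝ V] {A : Clifford n V} {D : CurvData A}
  {k : ℝ} {σ μ ν ρ : V} {M N Q S : Fin n → V}

/-- The equation for `∇μ`, from the integrability condition of the equation for `∇σ`. -/
theorem solve_first (hk : 0 < k) (hσ : A.HasDeg k σ) (hM : ∀ b, A.HasDeg (k + 1) (M b))
    (hint : ∀ b c, -D.Rop b c σ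
      = A.I c (M b) - A.I b (M c) + (1 / k) • (A.L c (N b) - A.L b (N c)))
    (hρ : ∑ c, A.E c (N c) = -(k * k) • ρ - k • D.Pop σ) (b : Fin n) :
    M b = A.L b ρ - D.PE b σ - (1 / (2 * k)) • D.Cop b σ := by
  set d := ∑ c, A.E c (M c) with hd
  -- Applying `ε^c` and summing: the degree `k + 1` of `M b`, less the one copy from anticommuting
  -- past `ι_b`, gives the coefficient `k`.
  have h1 : ∀ b, -∑ c, A.E c (D.Rop b c σ)
      = k • M b + A.I b d + (1 / k) • A.L b (∑ c, A.E c (N c)) := by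
    intro b
    rw [← Finset.sum_neg_distrib]
    simp only [← map_neg, hint, map_add, map_sub, map_smul, Finset.sum_add_distrib,
      Finset.sum_sub_distrib, ← Finset.smul_sum, A.sum_E_L, A.sum_E_L_apply, A.sum_E_I_apply]
    rw [show ∑ c, A.E c (A.I c (M b)) = _ from hM b, map_neg]
    module
  -- A second skewing removes the curvature and every term with a factor `ε_b`, leaving `k d + (k +
  -- 2) d = 0`.
  have h2 : d = 0 := by
    have h := sum_E_E_Rop (D := D) hσ
    have h' : ∑ b, A.E b (-∑ c, A.E c (D.Rop b c σ)) = 0 := by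
      simp only [map_neg, Finset.sum_neg_distrib, h, neg_zero]
    simp only [h1, map_add, map_smul, Finset.sum_add_distrib, ← Finset.smul_sum, A.sum_E_L] at h'
    have hdd : A.HasDeg (k + 1 + 1) d := HasDeg.sum fun c _ => (hM c).E c
    rw [show ∑ c, A.E c (A.I c d) = _ from hdd, ← hd] at h'
    have : (2 * k + 2) • d = 0 := by rw [← h']; module
    exact (smul_eq_zero.1 this).resolve_left (by positivity)
  have h3 := h1 b
  rw [h2, sum_E_Rop hσ, hρ, map_zero, map_sub, map_smul, map_smul] at h3
  have h4 : k • M b = k • (A.L b ρ - D.PE b σ - (1 / (2 * k)) • D.Cop b σ) := by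
    have e1 : (1 / k) * (k * k) = k := by field_simp
    have e2 : (1 / k) * k = 1 := by field_simp
    have e3 : k * (1 / (2 * k)) = 1 / 2 := by field_simp
    rw [smul_sub, smul_sub, smul_smul, e3]
    rw [smul_sub, smul_smul, smul_smul, mul_neg, e1, e2] at h3
    linear_combination (norm := module) (-1 : ℝ) • h3
  exact smul_right_injective V hk.ne' h4

/-- The equation for `∇ν`, from the integrability condition of the equation for `∇σ`. -/
theorem solve_second (hk : 0 < k) (hkn : k < n) (hσ : A.HasDeg k σ) (hρ : A.HasDeg k ρ)
    (hN : ∀ b, A.HasDeg (k - 1) (N b))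
    (hint : ∀ b c, -D.Rop b c σ
      = A.I c (M b) - A.I b (M c) + (1 / k) • (A.L c (N b) - A.L b (N c)))
    (hM : ∀ b, M b = A.L b ρ - D.PE b σ - (1 / (2 * k)) • D.Cop b σ) (c : Fin n) :
    N c = -k • (A.I c ρ + D.PU c σ)
      + (1 / (2 * (n - k))) • (k • D.X c σ + A.I c (D.W σ)) := by
  set δ := ∑ b, A.U b (N b) with hδ
  have hMt : ∑ b, A.U b (M b) = (n - k) • ρ - (D.J • σ - D.Pop σ) - (1 / (2 * k)) • D.W σ := by
    simp only [hM, map_sub, map_smul, Finset.sum_sub_distrib, ← Finset.smul_sum, sum_U_PE,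
      sum_U_Cop, hρ.sum_U_L]
  -- Contraction in the first index instead. The unknown `M` enters only through its trace, which is
  -- known from the formula just solved for; the coefficient of `N c` is `1 - (n - (k - 1)) = -(n -
  -- k)`.
  have h1 : ∀ c, -∑ b, A.U b (D.Rop b c σ) = -A.I c (∑ b, A.U b (M b))
      + (1 / k) • (-(n - k) • N c - A.L c δ) := by
    intro c
    rw [← Finset.sum_neg_distrib]
    simp only [← map_neg, hint, map_add, map_sub, map_smul, Finset.sum_add_distrib,
      Finset.sum_sub_distrib, ← Finset.smul_sum, A.sum_U_I, A.sum_U_L_apply, A.sum_U_I_apply,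
      (hN c).sum_U_L]
    module
  have h2 : ∀ c, ((n - k) / k) • N c = -(n - k) • (A.I c ρ + D.PU c σ) + (1 / 2 : ℝ) • D.X c σ
      + (1 / (2 * k)) • A.I c (D.W σ) - (1 / k) • A.L c δ := by
    intro c
    have := h1 c
    rw [sum_U_Rop hσ, hMt] at this
    simp only [map_sub, map_smul] at this
    rw [smul_sub, smul_smul] at this
    have e1 : (1 / k) * -(n - k) = -((n - k) / k) := by ring
    rw [e1] at this
    linear_combination (norm := module) (1 : ℝ) • this
  -- Contracting again kills all curvature terms and the term with `ρ`; what is left is a multiple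
  -- of `δ` whose coefficient is positive because `k < n`.
  have h3 : δ = 0 := by
    have h : ∑ c, A.U c (((n - k) / k) • N c) = -(1 / k) • ((n - (k - 1 - 1)) • δ) := by
      have hdd : A.HasDeg (k - 1 - 1) δ := HasDeg.sum fun c _ => (hN c).U c
      simp only [h2, map_sub, map_add, map_smul, Finset.sum_sub_distrib, Finset.sum_add_distrib,
        ← Finset.smul_sum, A.sum_U_I, sum_U_PU, sum_U_X, hdd.sum_U_L]
      module
    simp only [map_smul, ← Finset.smul_sum, ← hδ] at h
    have h' : (((n - k) / k) + (1 / k) * (n - (k - 1 - 1))) • δ = 0 := by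
      rw [add_smul, h, mul_smul]
      module
    refine (smul_eq_zero.1 h').resolve_left (ne_of_gt ?_)
    have : 0 < (n : ℝ) - k := by linarith
    have : 0 < (n : ℝ) - (k - 1 - 1) := by linarith
    positivity
  have hnk : (n : ℝ) - k ≠ 0 := by linarith
  have h4 := h2 c
  rw [h3, map_zero, smul_zero, sub_zero] at h4
  have h5 : N c = (k / (n - k)) • (((n - k) / k) • N c) := by
    rw [smul_smul, show k / (n - k) * ((n - k) / k) = 1 by field_simp, one_smul]
  rw [h5, h4]
  simp only [smul_add, smul_smul]
  have e1 : k / (n - k) * -(n - k) = -k := by field_simp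
  have e2 : k / (n - k) * (1 / 2) = 1 / (2 * (n - k)) * k := by field_simp
  have e3 : k / (n - k) * (1 / (2 * k)) = 1 / (2 * (n - k)) := by field_simp
  rw [e1, e2, e3]
  module

/-- The equation for `∇ρ`, from the integrability condition of the equation for `∇ν`. -/
theorem solve_third (hk : 0 < k) (hν : A.HasDeg (k - 1) ν) (hμ : A.HasDeg (k + 1) μ)
    (hQ : ∀ b, A.HasDeg k (Q b)) (hS : ∀ b, S b = A.I b μ + (1 / k) • A.L b ν)
    {T F : Fin n → Fin n → V} (hT : ∀ b c, T b c = -T c b) (hF : ∀ b, ∑ c, A.E c (F b c) = 0)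
    (hint : ∀ b c, -D.Rop b c ν
      = -k • (A.I c (Q b) - A.I b (Q c) + T b c + D.PU c (S b) - D.PU b (S c)) + F b c - F c b)
    (b : Fin n) :
    (k * (k - 1)) • Q b = -(k - 1) • ∑ c, A.E c (T b c)
      + (1 / 2 : ℝ) • ∑ d, ∑ c, A.E d (A.E c (A.I b (T d c)))
      - (k * (k - 1)) • D.PU b μ + (1 / 2 : ℝ) • D.Cop b ν + (k - 1) • D.PE b ν
      - ∑ c, A.E c (F c b) := by
  have hPUL : ∀ b c v, D.PU c (A.L b v) = D.P c b • v - A.L b (D.PU c v) := by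
    intro b c v
    simp only [PU_apply, A.U_L, smul_sub, Finset.sum_sub_distrib, map_sum, map_smul]
    simp
  have hPUI : ∀ b c v, D.PU c (A.I b v) = -A.I b (D.PU c v) := by
    intro b c v
    simp only [PU_apply, A.U_I, smul_neg, Finset.sum_neg_distrib, map_sum, map_smul]
  have hPopS : ∀ b, ∑ c, A.E c (D.PU c (S b))
      = -D.PU b μ + A.I b (D.Pop μ) + (1 / k) • (D.PE b ν + A.L b (D.Pop ν)) := by
    intro b
    simp only [hS, map_add, map_smul, hPUL, hPUI, map_neg, map_sub, Finset.sum_add_distrib,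
      Finset.sum_neg_distrib, Finset.sum_sub_distrib, ← Finset.smul_sum, A.sum_E_I_apply,
      A.sum_E_L_apply, ← Pop_apply, D.P_symm _ b]
    rw [show ∑ c, D.P b c • A.E c ν = D.PE b ν from rfl]
    module
  have hPUS : ∀ b, ∑ c, A.E c (D.PU b (S c)) = -k • D.PU b μ + (1 / k) • D.PE b ν := by
    intro b
    have hd : ∑ c, A.E c (A.I c (D.PU b μ)) = _ := hasDeg_PU hμ b
    simp only [hS, map_add, map_smul, hPUL, hPUI, map_neg, map_sub, Finset.sum_add_distrib,
      Finset.sum_neg_distrib, Finset.sum_sub_distrib, ← Finset.smul_sum, A.sum_E_L, hd]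
    rw [show ∑ c, D.P b c • A.E c ν = D.PE b ν from rfl]
    module
  set d := ∑ c, A.E c (Q c) with hd
  set t := ∑ d, ∑ c, A.E d (A.E c (T d c)) with ht
  -- Here `Q b` has degree `k`, so its coefficient is `k - 1` instead of `k`. The relation says
  -- nothing about it when `k = 1`, hence the separate treatment of degree one.
  have h1 : ∀ b, -∑ c, A.E c (D.Rop b c ν)
      = -k • ((k - 1) • Q b + A.I b d + ∑ c, A.E c (T b c)
        + (∑ c, A.E c (D.PU c (S b)) - ∑ c, A.E c (D.PU b (S c)))) - ∑ c, A.E c (F c b) := by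
    intro b
    have hq : ∑ c, A.E c (A.I c (Q b)) = _ := hQ b
    rw [← Finset.sum_neg_distrib]
    simp only [← map_neg, hint]
    simp only [map_add, map_sub, map_smul, Finset.sum_add_distrib,
      Finset.sum_sub_distrib, ← Finset.smul_sum, A.sum_E_I_apply, hF, hq]
    module
  -- The totally skew part is no longer zero: after the second skewing a Cotton contribution `t` and
  -- a Schouten term in `μ` remain.
  have h2 : d = -(1 / (2 * k)) • t - D.Pop μ := by
    have h := sum_E_E_Rop (D := D) hν
    have h' : ∑ b, A.E b (-∑ c, A.E c (D.Rop b c ν)) = 0 := by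
      simp only [map_neg, Finset.sum_neg_distrib, h, neg_zero]
    have hdd : ∑ c, A.E c (A.I c d) = _ := HasDeg.sum fun c _ => (hQ c).E c
    have hF' : ∑ b, ∑ c, A.E b (A.E c (F c b)) = 0 := by
      rw [Finset.sum_comm]
      refine Finset.sum_eq_zero fun c _ => ?_
      simp only [A.E_E _ c, Finset.sum_neg_distrib, ← map_sum, hF, map_zero, neg_zero]
    have hm : ∑ b, A.E b (A.I b (D.Pop μ)) = (k + 1) • D.Pop μ := by
      have : A.HasDeg (k + 1 - 1 + 1) (D.Pop μ) := by
        rw [Pop_apply]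
        exact HasDeg.sum fun c _ => (hasDeg_PU hμ c).E c
      rwa [sub_add_cancel] at this
    simp only [h1, hPopS, hPUS, map_add, map_sub, map_neg, map_smul, Finset.sum_add_distrib,
      Finset.sum_sub_distrib, Finset.sum_neg_distrib, ← Finset.smul_sum, A.sum_E_L, sum_E_PE, hdd,
      ← Pop_apply, hm, ← hd, map_sum, hF', ← ht] at h'
    have h3 : (2 * k) • d = -t - (2 * k) • D.Pop μ := by
      have h4 : k • ((2 * k) • d) = k • (-t - (2 * k) • D.Pop μ) := by
        linear_combination (norm := module) (-1 : ℝ) • h'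
      exact smul_right_injective V hk.ne' h4
    have h5 : d = (1 / (2 * k)) • ((2 * k) • d) := by
      rw [smul_smul, show 1 / (2 * k) * (2 * k) = 1 by field_simp, one_smul]
    rw [h5, h3, smul_sub, smul_smul, show 1 / (2 * k) * (2 * k) = 1 by field_simp]
    module
  -- Substituting `d` brings in `ι_b t`; moving `ι_b` inward produces the two different Cotton terms
  -- of the equation for `∇ρ`.
  have hIt : A.I b t = (2 : ℝ) • ∑ c, A.E c (T b c)
      + ∑ d, ∑ c, A.E d (A.E c (A.I b (T d c))) := by
    have e : ∀ d c, A.I b (A.E d (A.E c (T d c))) = (if d = b then (1 : ℝ) else 0) • A.E c (T d c)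
        - (if c = b then (1 : ℝ) else 0) • A.E d (T d c) + A.E d (A.E c (A.I b (T d c))) := by
      intro d c
      rw [A.I_E, A.I_E, map_sub, map_smul]
      abel
    simp only [ht, map_sum, e, Finset.sum_add_distrib, Finset.sum_sub_distrib]
    have e1 : ∑ d, ∑ c, (if d = b then (1 : ℝ) else 0) • A.E c (T d c) = ∑ c, A.E c (T b c) := by
      rw [Finset.sum_comm]
      simp
    have e2 : ∑ d, ∑ c, (if c = b then (1 : ℝ) else 0) • A.E d (T d c)
        = -∑ c, A.E c (T b c) := by
      simp [hT _ b]
    rw [e1, e2]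
    module
  have h3 := h1 b
  rw [hPopS, hPUS, h2, sum_E_Rop hν, map_sub, map_smul, hIt] at h3
  have e1 : k * (1 / (2 * k)) = 1 / 2 := by field_simp
  simp only [smul_sub, smul_add, smul_smul] at h3
  have e2 : -k * -(1 / (2 * k)) = 1 / 2 := by field_simp
  have e3 : -k * (1 / k) = -1 := by field_simp
  have e4 : -k * (-(1 / (2 * k)) * 2) = 1 := by field_simp
  simp only [e2, e3, e4] at h3
  linear_combination (norm := module) (1 : ℝ) • h3

end CurvData

end Clifford

/-! ## Alternating arrays of all ranks -/

section AltSeq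

variable {n : ℕ}

/-- Sequences of alternating arrays, one of each rank. -/
abbrev AltSeq (n : ℕ) := (r : ℕ) → altSpace n r

/-- Exterior multiplication. -/
def extOp (p : Fin n) : AltSeq n →ₗ[ℝ] AltSeq n where
  toFun T
    | 0 => 0
    | r + 1 => ⟨ext p (T r : Tensor n r), (T r).2.ext p⟩
  map_add' S T := by
    funext r
    cases r with
    | zero => exact (add_zero _).symm
    | succ r => exact Subtype.ext (ext_add p _ _)
  map_smul' c T := by
    funext r
    cases r with
    | zero => exact (smul_zero c).symm
    | succ r => exact Subtype.ext (ext_smul p c _)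

/-- Interior multiplication. -/
def insOp (p : Fin n) : AltSeq n →ₗ[ℝ] AltSeq n where
  toFun T r := ⟨ins p (T (r + 1) : Tensor n (r + 1)), (T (r + 1)).2.ins p⟩
  map_add' _ _ := rfl
  map_smul' _ _ := rfl

lemma insOp_insOp (p q : Fin n) (T : AltSeq n) : insOp p (insOp q T) = -insOp q (insOp p T) :=
  funext fun r => Subtype.ext ((T (r + 2)).2.ins_ins p q)

lemma extOp_extOp (p q : Fin n) (T : AltSeq n) : extOp p (extOp q T) = -extOp q (extOp p T) := by
  funext r
  match r with
  | 0 => exact neg_zero.symm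
  | 1 => exact Subtype.ext (((extL 0 p).map_zero).trans
      (neg_eq_zero.2 (extL 0 q).map_zero).symm)
  | r + 2 => exact Subtype.ext (ext_ext p q _)

lemma insOp_extOp (p q : Fin n) (T : AltSeq n) :
    insOp q (extOp p T) = (if q = p then (1 : ℝ) else 0) • T - extOp p (insOp q T) := by
  funext r
  refine Subtype.ext ?_
  cases r with
  | zero => exact (ins_ext_zero p q _).trans (sub_zero _).symm
  | succ r => exact ins_ext p q _

/-- The alternating part of an array, as a sequence with one nonzero entry. -/
def emb {r : ℕ} : Tensor n r →ₗ[ℝ] AltSeq n :=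
  LinearMap.single ℝ (fun r => altSpace n r) r ∘ₗ
    (skewL n r).codRestrict (altSpace n r) isAlt_skew

lemma emb_apply_self {r : ℕ} (T : Tensor n r) : (emb T r : Tensor n r) = skew T := by
  simp only [emb, LinearMap.comp_apply, LinearMap.coe_single, Pi.single_eq_same]
  rfl

lemma emb_apply_ne {r s : ℕ} (h : s ≠ r) (T : Tensor n r) : emb T s = 0 :=
  Pi.single_eq_of_ne h _

lemma emb_skew {r : ℕ} (T : Tensor n r) : emb (skew T) = emb T := by
  funext s
  by_cases h : s = r
  · subst h
    refine Subtype.ext ?_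
    rw [emb_apply_self, emb_apply_self, (isAlt_skew T).skew_eq]
  · rw [emb_apply_ne h, emb_apply_ne h]

/-- Placing all ranks in one vector space makes creation and annihilation genuine endomorphisms;
this brings identities back to arrays. -/
lemma emb_injective {r : ℕ} {S T : Tensor n r} (hS : IsAlt S) (hT : IsAlt T) (h : emb S = emb T) :
    S = T := by
  have := congrArg (fun A : AltSeq n => (A r : Tensor n r)) h
  simpa only [emb_apply_self, hS.skew_eq, hT.skew_eq] using this

lemma insOp_emb {r : ℕ} {T : Tensor n (r + 1)} (hT : IsAlt T) (p : Fin n) :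
    insOp p (emb T) = emb (ins p T) := by
  funext s
  by_cases h : s = r
  · subst h
    refine Subtype.ext ?_
    rw [emb_apply_self, (hT.ins p).skew_eq]
    show ins p (emb T (s + 1) : Tensor n (s + 1)) = _
    rw [emb_apply_self, hT.skew_eq]
  · rw [emb_apply_ne h]
    refine Subtype.ext ?_
    show ins p (emb T (s + 1) : Tensor n (s + 1)) = _
    rw [emb_apply_ne (by omega)]
    rfl

lemma insOp_emb_zero (T : Tensor n 0) (p : Fin n) : insOp p (emb T) = 0 := by
  funext s
  refine Subtype.ext ?_
  show ins p (emb T (s + 1) : Tensor n (s + 1)) = _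
  rw [emb_apply_ne (by omega)]
  rfl

lemma extOp_emb {r : ℕ} {T : Tensor n r} (hT : IsAlt T) (p : Fin n) :
    extOp p (emb T) = emb (ext p T) := by
  funext s
  cases s with
  | zero => exact (emb_apply_ne (by omega) _).symm
  | succ s =>
    refine Subtype.ext ?_
    show ext p (emb T s : Tensor n s) = _
    by_cases h : s = r
    · subst h
      rw [emb_apply_self, emb_apply_self, hT.skew_eq, (hT.ext p).skew_eq]
    · rw [emb_apply_ne h, emb_apply_ne (by omega)]
      exact (extL s p).map_zero

/-- The dictionary entry for skewed index expressions: skewing with total weight one over `r + 1`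
indices is an average of creation operators, which accounts for the factors `1 / (r + 1)` below. -/
lemma emb_succ {r : ℕ} (T : Tensor n (r + 1)) :
    emb T = ((r : ℝ) + 1)⁻¹ • ∑ p, extOp p (emb (ins p T)) := by
  rw [← emb_skew T, skew_succ, map_smul, map_sum]
  congr 1
  refine Finset.sum_congr rfl fun p _ => ?_
  rw [← extOp_emb (isAlt_skew _), emb_skew]

lemma sum_extOp_insOp_emb : ∀ {r : ℕ} {T : Tensor n r}, IsAlt T →
    ∑ p, extOp p (insOp p (emb T)) = (r : ℝ) • emb T
  | 0, T, _ => by simp [insOp_emb_zero]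
  | r + 1, T, h => by
    rw [emb_succ T, smul_smul, Nat.cast_add_one, mul_inv_cancel₀ (Nat.cast_add_one_ne_zero r),
      one_smul, ← emb_succ]
    simp only [insOp_emb h]

/-- On alternating arrays the derivation attached to an endomorphism is `∑ B_a{}^p ε^a ι_p`; it is
first shown at the level of arrays by induction on the rank with the anticommutation relation. -/
lemma emb_act (B : Fin n → Fin n → ℝ) : ∀ {r : ℕ} {T : Tensor n r}, IsAlt T →
    emb (act B T) = ∑ a, extOp a (∑ p, B a p • insOp p (emb T))
  | 0, T, _ => by simp [insOp_emb_zero, act_rank_zero]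
  | r + 1, T, h => by
    suffices hs : act B T = ∑ a, ext a (∑ p, B a p • ins p T) by
      rw [hs, map_sum]
      refine Finset.sum_congr rfl fun a _ => ?_
      rw [← extOp_emb (IsAlt.sum fun p _ => (h.ins p).smul _)]
      simp only [map_sum, map_smul, insOp_emb h]
    induction r with
    | zero =>
      refine tensor_ext_ins fun q => ?_
      rw [ins_act, act_rank_zero, add_zero, ins_sum]
      simp only [ins_ext_zero]
      simp
    | succ r ih =>
      refine tensor_ext_ins fun q => ?_
      rw [ins_act, ih _ (h.ins q), ins_sum]
      simp only [ins_ext, ins_sum, ins_smul, h.ins_ins q, smul_neg,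
        Finset.sum_neg_distrib, ext_neg, sub_neg_eq_add]
      simp [Finset.sum_add_distrib]

end AltSeq

/-! ### Creation and annihilation operators of a metric at a point, and the Ricci identity for
forms. -/

section AtPoint

variable {n : ℕ} {M : Type*} [TopologicalSpace M] [ChartedSpace (Coord n) M]
  [IsManifold (𝓡 n) ∞ M]

namespace Metric

variable (g : Metric n M) (x : M)

/-- Creation and annihilation operators for the metric at a point. -/
def clifford : Clifford n (AltSeq n) where
  E := extOp
  U q := ∑ p, g.upper x q p • insOp p
  g := g.lower x
  K := g.upper x
  E_E := extOp_extOp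
  U_U a b v := by
    simp only [LinearMap.sum_apply, LinearMap.smul_apply, map_sum, map_smul, Finset.smul_sum]
    rw [Finset.sum_comm, ← Finset.sum_neg_distrib]
    refine Finset.sum_congr rfl fun p _ => ?_
    rw [← Finset.sum_neg_distrib]
    refine Finset.sum_congr rfl fun q _ => ?_
    rw [insOp_insOp, smul_neg, smul_neg, smul_comm]
  U_E a b v := by
    simp only [LinearMap.sum_apply, LinearMap.smul_apply, map_sum, map_smul, insOp_extOp, smul_sub,
      Finset.sum_sub_distrib]
    simp
  g_symm := g.lower_symm x
  K_symm := g.upper_symm x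
  g_K := g.sum_lower_upper x

lemma clifford_U (q : Fin n) (v : AltSeq n) :
    (g.clifford x).U q v = ∑ p, g.upper x q p • insOp p v := by
  simp [clifford, LinearMap.sum_apply]

/-- Raising and lowering the index cancel, so lowered annihilation operators are plain insertions.
-/
lemma clifford_I (c : Fin n) (v : AltSeq n) : (g.clifford x).I c v = insOp c v := by
  rw [Clifford.I_apply]
  simp only [clifford_U, Finset.smul_sum, smul_smul]
  rw [Finset.sum_comm]
  simp only [← Finset.sum_smul]
  have : ∀ p, ∑ a, (g.clifford x).g c a * g.upper x a p = if c = p then 1 else 0 :=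
    g.sum_lower_upper x c
  simp [this]

/-- The Weyl and Schouten tensors at a point. -/
def curvData (hn : 3 ≤ n) : Clifford.CurvData (g.clifford x) where
  C := g.weyl x
  P := g.schouten x
  J := g.traceSchouten x
  C_antisymm := g.weyl_antisymm
  C_antisymm' := g.weyl_antisymm'
  C_pair := g.weyl_pair
  C_bianchi := g.weyl_bianchi
  C_trace := g.weyl_trace hn
  P_symm := g.schouten_symm x
  P_trace := g.sum_upper_mul_schouten hn

variable {g x}

lemma hasDeg_emb {r : ℕ} {T : Tensor n r} (h : IsAlt T) : (g.clifford x).HasDeg r (emb T) := by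
  unfold Clifford.HasDeg
  simp only [clifford_I]
  exact sum_extOp_insOp_emb h

lemma I_emb {r : ℕ} {T : Tensor n (r + 1)} (h : IsAlt T) (c : Fin n) :
    (g.clifford x).I c (emb T) = emb (ins c T) := by
  rw [clifford_I, insOp_emb h]

lemma I_emb_zero (T : Tensor n 0) (c : Fin n) : (g.clifford x).I c (emb T) = 0 := by
  rw [clifford_I, insOp_emb_zero]

lemma emb_act_riemann (hn : 3 ≤ n) {r : ℕ} {T : Tensor n r} (h : IsAlt T) (b c : Fin n) :
    emb (act (fun a p => g.riemann x b c p a) T) = (g.curvData x hn).Rop b c (emb T) := by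
  rw [emb_act _ h]
  refine Finset.sum_congr rfl fun a _ => congrArg (extOp a) ?_
  have hR : ∀ q, (g.curvData x hn).R b c q a = g.riemannLower x b c q a := fun q =>
    (g.riemannLower_eq_weyl b c q a).symm
  simp only [clifford_U, hR, Finset.smul_sum, smul_smul, g.riemann_eq, Finset.sum_smul]
  rw [Finset.sum_comm]
  refine Finset.sum_congr rfl fun q _ => Finset.sum_congr rfl fun p _ => ?_
  rw [g.upper_symm, mul_comm]

/-- The Ricci identity for forms. -/
lemma ricci_identity_emb (hn : 3 ≤ n) {r : ℕ} {T : TensorField n M r} (hT : SmoothIn x T)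
    (h : IsAlt (T x)) (b c : Fin n) :
    emb (ins c (ins b (g.nabla (g.nabla T) x))) - emb (ins b (ins c (g.nabla (g.nabla T) x)))
      = -(g.curvData x hn).Rop b c (emb (T x)) := by
  rw [← emb_act_riemann hn h, ← map_sub, ← map_neg]
  congr 1
  funext i
  exact g.ricci_identity hT b c i

end Metric

end AtPoint

/-! ## The prolonged system in terms of creation and annihilation operators -/

section Translation

variable {n : ℕ} {M : Type*} [TopologicalSpace M] [ChartedSpace (Coord n) M]
  [IsManifold (𝓡 n) ∞ M] {g : Metric n M} {x : M} {m : ℕ}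

namespace Clifford.CurvData

variable {V : Type*} [AddCommGroup V] [Module ℝ V] {A : Clifford n V} {D : CurvData A}

/-- Moving `ι_c` to the left past the two creation operators costs one copy of `X` for each of them,
with equal signs by antisymmetry of the Weyl tensor. -/
lemma sum_E_E_I_U (c : Fin n) (v : V) :
    ∑ d, ∑ e, ∑ b, A.E d (A.E e (A.I c (A.U b (D.CU d e b v)))) = A.I c (D.W v)
      + (2 : ℝ) • D.X c v := by
  have h : ∀ d e b, A.I c (A.E d (A.E e (A.U b (D.CU d e b v))))
      = (if d = c then (1 : ℝ) else 0) • A.E e (A.U b (D.CU d e b v))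
        - (if e = c then (1 : ℝ) else 0) • A.E d (A.U b (D.CU d e b v))
        + A.E d (A.E e (A.I c (A.U b (D.CU d e b v)))) := by
    intro d e b
    rw [A.I_E, A.I_E, map_sub, map_smul]
    abel
  have h1 : ∑ d, ∑ e, ∑ b, (if d = c then (1 : ℝ) else 0) • A.E e (A.U b (D.CU d e b v))
      = -D.X c v := by
    rw [X, neg_neg]
    simp only [← Finset.smul_sum]
    simp
  have h2 : ∑ d, ∑ e, ∑ b, (if e = c then (1 : ℝ) else 0) • A.E d (A.U b (D.CU d e b v))
      = D.X c v := by
    simp only [← Finset.smul_sum]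
    simp only [X, ite_smul, one_smul, zero_smul, Finset.sum_ite_eq', Finset.mem_univ, if_true]
    simp only [← Finset.sum_neg_distrib]
    refine Finset.sum_congr rfl fun d _ => Finset.sum_congr rfl fun b _ => ?_
    rw [CU_antisymm, map_neg, map_neg]
  simp only [W, map_sum, h, Finset.sum_add_distrib, Finset.sum_sub_distrib, h1, h2]
  module

end Clifford.CurvData

namespace Metric

lemma sum_smul_U_emb (f : Fin n → ℝ) {r : ℕ} {T : Tensor n (r + 1)} (hT : IsAlt T) :
    ∑ q, f q • (g.clifford x).U q (emb T)
      = emb (∑ p, (∑ q, f q * g.upper x q p) • ins p T) := by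
  simp only [clifford_U, insOp_emb hT, Finset.smul_sum, map_sum, map_smul, Finset.sum_smul,
    smul_smul]
  exact Finset.sum_comm

lemma CU_emb (hn : 3 ≤ n) (a b c : Fin n) {r : ℕ} {T : Tensor n (r + 1)} (hT : IsAlt T) :
    (g.curvData x hn).CU a b c (emb T) = emb (∑ p, g.weylUp x a b c p • ins p T) :=
  sum_smul_U_emb _ hT

lemma PU_emb (hn : 3 ≤ n) (c : Fin n) {r : ℕ} {T : Tensor n (r + 1)} (hT : IsAlt T) :
    (g.curvData x hn).PU c (emb T) = emb (∑ p, g.schoutenUp x c p • ins p T) := by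
  rw [Clifford.CurvData.PU_apply]
  exact sum_smul_U_emb _ hT

lemma U_CU_emb (hn : 3 ≤ n) (a b : Fin n) {r : ℕ} {T : Tensor n (r + 2)} (hT : IsAlt T) :
    ∑ p, (g.clifford x).U p ((g.curvData x hn).CU a b p (emb T))
      = -emb (∑ p, ∑ q, g.weylUpUp x a b p q • ins q (ins p T)) := by
  have h : ∀ c, (g.clifford x).U c ((g.curvData x hn).CU a b c (emb T))
      = emb (∑ p, ∑ q, (g.upper x c p * g.weylUp x a b c q) • ins p (ins q T)) := fun c => by
    rw [CU_emb hn a b c hT, clifford_U]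
    simp only [map_sum, map_smul, insOp_emb (hT.ins _), Finset.smul_sum, smul_smul]
  have h' : ∀ p q, g.weylUpUp x a b p q • ins q (ins p T)
      = -∑ c, (g.upper x c p * g.weylUp x a b c q) • ins p (ins q T) := fun p q => by
    rw [weylUpUp, hT.ins_ins q p, smul_neg, Finset.sum_smul]
    simp only [g.upper_symm x p]
  simp only [h, h', ← map_sum, ← map_neg, Finset.sum_neg_distrib, neg_neg]
  congr 1
  rw [Finset.sum_comm]
  exact Finset.sum_congr rfl fun p _ => Finset.sum_comm

lemma emb_lower_mul (c : Fin n) (T : Tensor n m) :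
    emb (fun a : Fin (m + 1) → Fin n => g.lower x c (a 0) * T (tl a))
      = (1 / ((m : ℝ) + 1)) • (g.clifford x).L c (emb T) := by
  rw [emb_succ, one_div, Clifford.L_apply]
  congr 1
  refine Finset.sum_congr rfl fun a _ => ?_
  rw [← map_smul]
  refine (congrArg _ (map_smul emb (g.lower x c a) T)).trans ?_
  rw [map_smul]
  exact (map_smul _ _ _).symm

lemma emb_sigmaRHS (c : Fin n) {μ : TensorField n M (m + 2)} {ν : TensorField n M m}
    (hμ : IsAlt (μ x)) : emb (ins c (g.sigmaRHS μ ν x))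
      = (g.clifford x).I c (emb (μ x)) + (1 / ((m : ℝ) + 1)) • (g.clifford x).L c (emb (ν x)) := by
  rw [I_emb hμ, ← emb_lower_mul, ← emb_skew (fun a : Fin (m + 1) → Fin n => g.lower x c (a 0) * ν x (tl a)), ← map_add]
  rfl

lemma emb_weyl_skew (hn : 3 ≤ n) (c : Fin n) {r : ℕ} {T : Tensor n (r + 1)} (hT : IsAlt T) :
    emb (fun b : Fin (r + 2) → Fin n =>
        ∑ p, g.weylUp x (b 0) (b 1) c p * T (cons p (tl (tl b))))
      = (1 / (((r : ℝ) + 1) * ((r : ℝ) + 2))) • (g.curvData x hn).Cop c (emb T) := by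
  have h : ∀ a b, ins b (ins a (fun b : Fin (r + 2) → Fin n =>
      ∑ p, g.weylUp x (b 0) (b 1) c p * T (cons p (tl (tl b)))))
      = ∑ p, g.weylUp x a b c p • ins p T := fun a b => by
    funext i
    simp only [Finset.sum_apply, Pi.smul_apply, smul_eq_mul]
    rfl
  rw [emb_succ]
  simp only [emb_succ (r := r), h, ← CU_emb hn _ _ c hT, Clifford.CurvData.Cop, map_smul, map_sum,
    Finset.smul_sum, smul_smul]
  refine Finset.sum_congr rfl fun a _ => Finset.sum_congr rfl fun b _ => ?_
  congr 1
  push_cast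
  field_simp
  ring

lemma emb_muRHS (hn : 3 ≤ n) (c : Fin n) {σ ρ : TensorField n M (m + 1)} (hσ : IsAlt (σ x)) :
    emb (ins c (g.muRHS σ ρ x)) = (g.clifford x).L c (emb (ρ x))
      - (g.curvData x hn).PE c (emb (σ x))
      - (1 / (2 * ((m : ℝ) + 1))) • (g.curvData x hn).Cop c (emb (σ x)) := by
  have h0 : ins c (g.muRHS σ ρ x) = (((m : ℝ) + 1) + 1) • skew (
      (fun b : Fin (m + 2) → Fin n => g.lower x c (b 0) * ρ x (tl b))
      - (fun b : Fin (m + 2) → Fin n => g.schouten x c (b 0) * σ x (tl b))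
      - (1 / 2 : ℝ) • fun b : Fin (m + 2) → Fin n =>
        ∑ p, g.weylUp x (b 0) (b 1) c p * σ x (cons p (tl (tl b)))) := rfl
  have h1 : emb (fun b : Fin (m + 2) → Fin n => g.schouten x c (b 0) * σ x (tl b))
      = (1 / ((m : ℝ) + 2)) • (g.curvData x hn).PE c (emb (σ x)) := by
    rw [emb_succ, one_div, show ((m + 1 : ℕ) : ℝ) + 1 = m + 2 by push_cast; ring]
    congr 1
    refine Finset.sum_congr rfl fun a _ => ?_
    refine (congrArg _ (map_smul emb (g.schouten x c a) (σ x))).trans ?_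
    rw [map_smul]
    rfl
  rw [h0, map_smul, emb_skew, map_sub, map_sub, map_smul, h1, emb_lower_mul, emb_weyl_skew hn c hσ]
  simp only [smul_sub, smul_smul]
  have e1 : ((m : ℝ) + 1 + 1) * (1 / (((m + 1 : ℕ) : ℝ) + 1)) = 1 := by push_cast; field_simp
  have e2 : ((m : ℝ) + 1 + 1) * (1 / ((m : ℝ) + 2)) = 1 := by field_simp; ring
  have e3 : ((m : ℝ) + 1 + 1) * (1 / 2 * (1 / (((m : ℝ) + 1) * ((m : ℝ) + 2))))
      = 1 / (2 * ((m : ℝ) + 1)) := by field_simp; ring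
  rw [e1, e2, e3, one_smul, one_smul]

lemma emb_weyl_weyl_skew (hn : 3 ≤ n) (c : Fin n) {r : ℕ} {T : Tensor n (r + 2)} (hT : IsAlt T) :
    emb (fun b : Fin (r + 1) → Fin n =>
        ∑ p, ∑ q, g.weylUpUp x c (b 0) p q * T (cons p (cons q (tl b))))
      = (1 / ((r : ℝ) + 1)) • (g.curvData x hn).X c (emb T) := by
  have h : ∀ a, ins a (fun b : Fin (r + 1) → Fin n =>
      ∑ p, ∑ q, g.weylUpUp x c (b 0) p q * T (cons p (cons q (tl b))))
      = ∑ p, ∑ q, g.weylUpUp x c a p q • ins q (ins p T) := fun a => by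
    funext i
    simp only [Finset.sum_apply, Pi.smul_apply, smul_eq_mul]
    rfl
  rw [emb_succ, one_div]
  congr 1
  simp only [h, Clifford.CurvData.X, ← map_sum, U_CU_emb hn c _ hT, map_neg,
    Finset.sum_neg_distrib, neg_neg]
  rfl

lemma emb_weyl_weyl_skew' (hn : 3 ≤ n) (c : Fin n) {r : ℕ} {T : Tensor n (r + 3)} (hT : IsAlt T) :
    emb (fun b : Fin (r + 2) → Fin n =>
        ∑ p, ∑ q, g.weylUpUp x (b 1) (b 0) p q * T (cons p (cons q (cons c (tl (tl b))))))
      = (1 / (((r : ℝ) + 1) * ((r : ℝ) + 2))) • ((g.clifford x).I c ((g.curvData x hn).W (emb T))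
        + (2 : ℝ) • (g.curvData x hn).X c (emb T)) := by
  have h : ∀ a b, ins b (ins a (fun b : Fin (r + 2) → Fin n =>
      ∑ p, ∑ q, g.weylUpUp x (b 1) (b 0) p q * T (cons p (cons q (cons c (tl (tl b)))))))
      = ins c (∑ p, ∑ q, g.weylUpUp x b a p q • ins q (ins p T)) := fun a b => by
    funext i
    simp only [ins_sum, Finset.sum_apply]
    rfl
  have hA : ∀ a b, IsAlt (∑ p, ∑ q, g.weylUpUp x b a p q • ins q (ins p T)) := fun a b =>
    IsAlt.sum fun p _ => IsAlt.sum fun q _ => ((hT.ins p).ins q).smul _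
  have h' : ∀ a b, emb (ins c (∑ p, ∑ q, g.weylUpUp x b a p q • ins q (ins p T)))
      = ∑ p, (g.clifford x).I c
        ((g.clifford x).U p ((g.curvData x hn).CU a b p (emb T))) := fun a b => by
    rw [← I_emb (g := g) (x := x) (hA a b) c, ← neg_eq_iff_eq_neg.2 (U_CU_emb (g := g) (x := x) hn b a hT), ← map_sum,
      ← Finset.sum_neg_distrib]
    congr 1
    refine Finset.sum_congr rfl fun p _ => ?_
    rw [Clifford.CurvData.CU_antisymm, map_neg, neg_neg]
  rw [← Clifford.CurvData.sum_E_E_I_U, emb_succ]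
  simp only [emb_succ (r := r), h, h', map_smul, map_sum, Finset.smul_sum, smul_smul]
  refine Finset.sum_congr rfl fun a _ => Finset.sum_congr rfl fun b _ =>
    Finset.sum_congr rfl fun p _ => ?_
  congr 1
  push_cast
  field_simp
  ring

/-- The factor `k (k - 1)` occurs in the equation for `∇ν` anyway and makes one formula valid in all
degrees, including `k = 1` and `k = 2`, where the left side is zero. -/
lemma emb_blackDiamond (hn : 3 ≤ n) (c : Fin n) : ∀ {m : ℕ} {σ : TensorField n M (m + 1)},
    IsAlt (σ x) → (((m : ℝ) + 1) * m) • emb (ins c (g.blackDiamond (m + 1) σ x))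
      = ((m : ℝ) + 1) • (g.curvData x hn).X c (emb (σ x))
        + (g.clifford x).I c ((g.curvData x hn).W (emb (σ x)))
  | 0, σ, h => by
    have hU : ∀ a b p q, (g.clifford x).U q ((g.curvData x hn).CU a b p (emb (σ x))) = 0 :=
      fun a b p q => by
      rw [CU_emb hn a b p h, clifford_U]
      simp only [insOp_emb_zero, smul_zero, Finset.sum_const_zero]
    simp [Clifford.CurvData.X, Clifford.CurvData.W, hU]
  | 1, σ, h => by
    have hI : ∀ a b p, (g.clifford x).I c ((g.clifford x).U p
        ((g.curvData x hn).CU a b p (emb (σ x)))) = 0 := fun a b p => by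
      rw [CU_emb hn a b p h, clifford_U, map_sum]
      refine Finset.sum_eq_zero fun q _ => ?_
      rw [map_smul, insOp_emb (IsAlt.sum fun p _ => (h.ins p).smul _), I_emb_zero, smul_zero]
    -- Three annihilation operators kill a two-form, so the left side of this identity is zero and
    -- it becomes the required cancellation for `k = 2`.
    have h2 := Clifford.CurvData.sum_E_E_I_U (D := g.curvData x hn) c (emb (σ x))
    simp only [hI, map_zero, Finset.sum_const_zero] at h2
    have h0 : ins c (g.blackDiamond (1 + 1) σ x) = 0 := rfl
    rw [h0, map_zero, smul_zero, h2]
    push_cast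
    module
  | l + 2, σ, h => by
    have h0 : ins c (g.blackDiamond (l + 3) σ x) = skew (((((l : ℝ) + 3) - 2) / ((l : ℝ) + 3)) •
        ((fun b : Fin (l + 2) → Fin n =>
          ∑ p, ∑ q, g.weylUpUp x c (b 0) p q * σ x (cons p (cons q (tl b))))
        + fun b : Fin (l + 2) → Fin n => ∑ p, ∑ q, g.weylUpUp x (b 1) (b 0) p q *
          σ x (cons p (cons q (cons c (tl (tl b))))))) := rfl
    rw [h0, emb_skew, map_smul, map_add, emb_weyl_weyl_skew hn c h, emb_weyl_weyl_skew' hn c h]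
    push_cast
    match_scalars <;> field_simp <;> ring

lemma emb_nuRHS (hn : 3 ≤ n) (c : Fin n) {σ ρ : TensorField n M (m + 1)}
    (hσ : IsAlt (σ x)) (hρ : IsAlt (ρ x)) :
    emb (ins c (g.nuRHS σ ρ x)) = -((m : ℝ) + 1) •
        ((g.clifford x).I c (emb (ρ x)) + (g.curvData x hn).PU c (emb (σ x)))
      + (1 / (2 * ((n : ℝ) - ((m : ℝ) + 1)))) •
        (((m : ℝ) + 1) • (g.curvData x hn).X c (emb (σ x))
          + (g.clifford x).I c ((g.curvData x hn).W (emb (σ x)))) := by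
  have h0 : ins c (g.nuRHS σ ρ x) = -((m : ℝ) + 1) •
      (ins c (ρ x) + ∑ p, g.schoutenUp x c p • ins p (σ x))
      + (((m : ℝ) + 1) * (((m : ℝ) + 1) - 1) / (2 * ((n : ℝ) - ((m : ℝ) + 1)))) •
        ins c (g.blackDiamond (m + 1) σ x) := by
    funext i
    simp only [Pi.add_apply, Pi.smul_apply, Finset.sum_apply, smul_eq_mul]
    rfl
  rw [h0, ← emb_blackDiamond hn c hσ, PU_emb hn c hσ, I_emb hρ, map_add, map_smul, map_smul,
    map_add, smul_smul]
  congr 2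
  ring

end Metric

end Translation

/-! ## The first three equations of the prolonged system -/

section Prolongation

variable {n : ℕ} {M : Type*} [TopologicalSpace M] [ChartedSpace (Coord n) M]
  [IsManifold (𝓡 n) ∞ M] {g : Metric n M} {x : M} {m : ℕ}

namespace Metric

lemma sigmaRHS_eq (μ : TensorField n M (m + 2)) (ν : TensorField n M m) :
    g.sigmaRHS μ ν = μ + tailSkewF (r := m + 1) (outerF (s := 2) g.comp ν) := rfl

lemma outer_zero_left : ∀ {s r : ℕ} (T : Tensor n r), outer (0 : Tensor n s) T = 0
  | 0, _, T => zero_smul ℝ T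
  | s + 1, r, T => by
    refine tensor_ext_ins fun a => ?_
    rw [ins_outer]
    exact outer_zero_left T

/-- The metric is parallel and `∇` commutes with skewing, so the derivative falls on `μ` and `ν`
only. -/
lemma emb_nabla_sigmaRHS {μ : TensorField n M (m + 2)} {ν : TensorField n M m}
    (hμ : ∀ y, IsAlt (μ y)) (hμs : SmoothIn x μ) (hνs : SmoothIn x ν) (b c : Fin n) :
    emb (ins c (ins b (g.nabla (g.sigmaRHS μ ν) x)))
      = (g.clifford x).I c (emb (ins b (g.nabla μ x)))
        + (1 / ((m : ℝ) + 1)) • (g.clifford x).L c (emb (ins b (g.nabla ν x))) := by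
  have ho : SmoothIn x (outerF (s := 2) g.comp ν) := smoothIn_outerF (g.smooth x) hνs
  have h1 : ins c (ins b (g.nabla (g.sigmaRHS μ ν) x)) = ins c (ins b (g.nabla μ x))
      + skew (fun a : Fin (m + 1) → Fin n => g.lower x c (a 0) * ins b (g.nabla ν x) (tl a)) := by
    rw [sigmaRHS_eq, nabla_add hμs (smoothIn_tailSkewF (r := m + 1) ho), ins_add,
      nabla_tailSkewF (r := m + 1) ho, nabla_outerF (s := 2) (S := g.comp) (g.smooth x) hνs, nabla_comp]
    rw [show outer (s := 2) (ins b ((0 : TensorField n M 3) x)) (ν x) = 0 from outer_zero_left _,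
      zero_add]
    rfl
  rw [h1, map_add, emb_skew, emb_lower_mul, I_emb (isAlt_ins_nabla hμs hμ b)]

/-- Integrability of the equation for `∇σ`. -/
lemma integrability_sigma (hn : 3 ≤ n) {σ : TensorField n M (m + 1)} {μ : TensorField n M (m + 2)}
    {ν : TensorField n M m} (hσ : ∀ y, IsAlt (σ y)) (hσs : SmoothIn x σ)
    (hμ : ∀ y, IsAlt (μ y)) (hμs : SmoothIn x μ) (hνs : SmoothIn x ν)
    (h : g.nabla σ = g.sigmaRHS μ ν) (b c : Fin n) :
    -(g.curvData x hn).Rop b c (emb (σ x))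
      = (g.clifford x).I c (emb (ins b (g.nabla μ x)))
        - (g.clifford x).I b (emb (ins c (g.nabla μ x)))
        + (1 / ((m : ℝ) + 1)) • ((g.clifford x).L c (emb (ins b (g.nabla ν x)))
          - (g.clifford x).L b (emb (ins c (g.nabla ν x)))) := by
  rw [← ricci_identity_emb hn hσs (hσ x), h, emb_nabla_sigmaRHS hμ hμs hνs,
    emb_nabla_sigmaRHS hμ hμs hνs]
  module

lemma ins_contr_two (S : Tensor n 2) (T : Tensor n (m + 1)) (c : Fin n) :
    ins c (contr (g.comp x) (s := 1) S T) = ∑ q, (∑ p, S ![c, p] * g.upper x p q) • ins q T := by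
  simp only [Finset.sum_smul]
  rw [Finset.sum_comm]
  show ∑ p, ∑ q, (g.upper x p q * S ![c, p]) • ins q T = _
  simp only [mul_comm]

lemma emb_ins_contr_two (S : Tensor n 2) {T : Tensor n (m + 1)} (hT : IsAlt T) (c : Fin n) :
    emb (ins c (contr (g.comp x) (s := 1) S T))
      = ∑ p, S ![c, p] • (g.clifford x).U p (emb T) := by
  rw [ins_contr_two, sum_smul_U_emb _ hT]

/-- The two projections subtracted in the conformal Killing operator are the `μ` term and the `ν`
term; even the constants `k / (n - k + 1)` match. -/
lemma isConformalKilling_iff {σ : TensorField n M (m + 1)} :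
    g.IsConformalKilling σ ↔ g.nabla σ = g.sigmaRHS (g.muOf σ) (g.nuOf σ) := by
  have h : ∀ x i, g.cartanPart (g.nabla σ) x i
      = g.nabla σ x i - g.sigmaRHS (g.muOf σ) (g.nuOf σ) x i := by
    intro x i
    have h1 : (fun a : Fin (m + 1) → Fin n => g.lower x (i 0) (a 0) * g.nuOf σ x (tl a))
        = (((m : ℝ) + 1) / ((n : ℝ) - ((m : ℝ) + 1) + 1)) •
          (fun a : Fin (m + 1) → Fin n => g.lower x (i 0) (a 0) * g.trace (g.nabla σ) x (tl a)) := by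
      funext a
      simp only [nuOf, Pi.smul_apply, smul_eq_mul]
      ring
    simp only [sigmaRHS, h1, skew_smul, cartanPart, muOf, Pi.smul_apply, smul_eq_mul]
    ring
  unfold IsConformalKilling
  simp only [h, sub_eq_zero]
  exact ⟨fun h => funext fun x => funext fun i => h x i, fun h x i => congrFun (congrFun h x) i⟩

lemma cartanPart_eq_zero {σ : TensorField n M (m + 1)} (h : g.IsConformalKilling σ) :
    g.cartanPart (g.nabla σ) = 0 := funext fun x => funext fun i => h x i

lemma isAlt_muOf (σ : TensorField n M (m + 1)) (y : M) : IsAlt (g.muOf σ y) := isAlt_skew _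

lemma isAlt_nuOf {σ : TensorField n M (m + 1)} (hσ : ∀ y, IsAlt (σ y)) (hσs : ∀ y, SmoothIn y σ)
    (y : M) : IsAlt (g.nuOf σ y) := by
  have h : g.nuOf σ y = (((m : ℝ) + 1) / ((n : ℝ) - ((m : ℝ) + 1) + 1)) •
      g.trace (g.nabla σ) y := rfl
  rw [h, trace_eq]
  exact (IsAlt.sum fun p _ => IsAlt.sum fun q _ =>
    ((isAlt_ins_nabla (hσs y) hσ p).ins q).smul _).smul _

lemma isAlt_rhoOf (σ : TensorField n M (m + 1)) (y : M) : IsAlt (g.rhoOf σ y) := isAlt_skew _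

lemma smoothIn_muOf {σ : TensorField n M (m + 1)} (hσs : SmoothIn x σ) :
    SmoothIn x (g.muOf σ) := smoothIn_skewF (g.smoothIn_nabla hσs)

lemma smoothIn_trace_nabla {σ : TensorField n M (m + 1)} (hσs : SmoothIn x σ) :
    SmoothIn x (g.trace (g.nabla σ)) := smoothIn_trace (g.smoothIn_nabla hσs)

lemma smoothIn_nuOf {σ : TensorField n M (m + 1)} (hσs : SmoothIn x σ) :
    SmoothIn x (g.nuOf σ) := smoothIn_smul _ (smoothIn_trace_nabla hσs)

/-- On solutions the divergence of the Cartan part is zero, so the summand with coefficient `1 /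
(nk)` drops out. -/
lemma rhoOf_eq {σ : TensorField n M (m + 1)} (h : g.IsConformalKilling σ) :
    g.rhoOf σ = skewF (-(1 / ((n : ℝ) - ((m : ℝ) + 1) + 1)) • g.nabla (g.trace (g.nabla σ))
      - contrF g (s := 1) g.schoutenF σ) := by
  funext x
  unfold rhoOf
  rw [cartanPart_eq_zero h, nabla_zero]
  show skew _ = skew _
  congr 1
  funext a
  have h1 : g.trace (0 : TensorField n M (m + 3)) x a = 0 := by
    simp [trace]
  have h2 : contrF g (s := 1) g.schoutenF σ x a
      = ∑ p, g.schoutenUp x (a 0) p * σ x (cons p (tl a)) := by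
    have := congrFun (ins_contr_two (g := g) (x := x) (g.schoutenF x) (σ x) (a 0)) (tl a)
    simp only [Finset.sum_apply, Pi.smul_apply, smul_eq_mul] at this
    conv_lhs => rw [← cons_tl a]
    exact this
  have h3 : (-(1 / ((n : ℝ) - ((m : ℝ) + 1) + 1)) • g.nabla (g.trace (g.nabla σ))
      - contrF g (s := 1) g.schoutenF σ) x a
      = -(1 / ((n : ℝ) - ((m : ℝ) + 1) + 1)) * g.nabla (g.trace (g.nabla σ)) x a
        - contrF g (s := 1) g.schoutenF σ x a := rfl
  rw [h3, h2]
  have h4 := congrArg (fun t => 1 / ((n : ℝ) * ((m : ℝ) + 1)) * t) h1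
  simp only [mul_zero] at h4
  refine (congrArg (fun t => t - _ - _) h4).trans ?_
  ring

lemma smoothIn_rhoOf {σ : TensorField n M (m + 1)} (hσs : SmoothIn x σ)
    (h : g.IsConformalKilling σ) : SmoothIn x (g.rhoOf σ) := by
  rw [rhoOf_eq h]
  exact smoothIn_skewF (smoothIn_sub
    (smoothIn_smul _ (g.smoothIn_nabla (smoothIn_trace_nabla hσs)))
    (smoothIn_contrF (s := 1) smoothIn_schoutenF hσs))

/-- The definition of `ρ` rearranged: it prescribes the skew part of `∇ν`, the one datum that the
integrability condition for `σ` leaves undetermined. The bound on the degree makes `n - k + 1`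
nonzero. -/
lemma sum_E_nabla_nuOf (hn : 3 ≤ n) (hk : m + 1 ≤ n - 1) {σ : TensorField n M (m + 1)}
    (hσ : ∀ y, IsAlt (σ y)) (hσs : SmoothIn x σ) (h : g.IsConformalKilling σ) :
    ∑ c, (g.clifford x).E c (emb (ins c (g.nabla (g.nuOf σ) x)))
      = -(((m : ℝ) + 1) * ((m : ℝ) + 1)) • emb (g.rhoOf σ x)
        - ((m : ℝ) + 1) • (g.curvData x hn).Pop (emb (σ x)) := by
  have hm : (m : ℝ) + 1 ≤ (n : ℝ) - 1 := by
    have : m + 1 + 1 ≤ n := by omega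
    have : ((m + 1 + 1 : ℕ) : ℝ) ≤ n := by exact_mod_cast this
    push_cast at this
    linarith
  have hm1 : (m : ℝ) + 1 ≠ 0 := by positivity
  have hm2 : (n : ℝ) - ((m : ℝ) + 1) + 1 ≠ 0 := by linarith
  have h1 : g.nabla (g.nuOf σ) x = (((m : ℝ) + 1) / ((n : ℝ) - ((m : ℝ) + 1) + 1)) •
      g.nabla (g.trace (g.nabla σ)) x := nabla_smul _ (smoothIn_trace_nabla hσs)
  have h2 : emb (g.rhoOf σ x) = -(1 / ((n : ℝ) - ((m : ℝ) + 1) + 1)) •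
      (((m : ℝ) + 1)⁻¹ • ∑ c, extOp c (emb (ins c (g.nabla (g.trace (g.nabla σ)) x))))
      - ((m : ℝ) + 1)⁻¹ • (g.curvData x hn).Pop (emb (σ x)) := by
    have h3 : g.rhoOf σ x = skew (-(1 / ((n : ℝ) - ((m : ℝ) + 1) + 1)) •
        g.nabla (g.trace (g.nabla σ)) x - contr (g.comp x) (s := 1) (g.schoutenF x) (σ x)) :=
      congrFun (rhoOf_eq h) x
    have h4 : emb (contr (g.comp x) (s := 1) (g.schoutenF x) (σ x))
        = ((m : ℝ) + 1)⁻¹ • (g.curvData x hn).Pop (emb (σ x)) := by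
      rw [emb_succ, Clifford.CurvData.Pop_apply]
      simp only [emb_ins_contr_two _ (hσ x), Clifford.CurvData.PU_apply]
      rfl
    rw [h3, emb_skew, map_sub, h4, map_smul, ← emb_succ]
  rw [h2, h1]
  simp only [ins_smul, map_smul, ← Finset.smul_sum]
  show _ • ∑ c, extOp c _ = _
  match_scalars <;> field_simp
  ring

/-- Skewing over all indices annihilates the trace term, and the degree `k + 1` of `μ` cancels the
normalisation. -/
lemma eq_muOf {σ : TensorField n M (m + 1)} {μ : TensorField n M (m + 2)}
    {ν : TensorField n M m} (hμ : ∀ y, IsAlt (μ y))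
    (h : g.nabla σ = g.sigmaRHS μ ν) : g.muOf σ = μ := by
  funext x
  refine emb_injective (isAlt_skew _) (hμ x) ?_
  rw [muOf, emb_skew, emb_succ, h]
  simp only [emb_sigmaRHS _ (hμ x), map_add, map_smul, Finset.sum_add_distrib, ← Finset.smul_sum]
  rw [show ∑ c, extOp c ((g.clifford x).I c (emb (μ x))) = _ from hasDeg_emb (hμ x),
    show ∑ c, extOp c ((g.clifford x).L c (emb (ν x))) = 0 from (g.clifford x).sum_E_L _]
  match_scalars
  field_simp
  ring

lemma emb_trace {r : ℕ} {T : TensorField n M (r + 2)} (h : ∀ c, IsAlt (ins c (T x))) :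
    emb (g.trace T x) = ∑ p, (g.clifford x).U p (emb (ins p (T x))) := by
  rw [trace_eq, traceWith]
  simp only [map_sum, map_smul, clifford_U, insOp_emb (h _)]
  rfl

/-- Taking the trace annihilates the skew term, and the contraction of the other term multiplies `ν`
by `(n - k + 1) / k`. -/
lemma eq_nuOf (hk : m + 1 ≤ n - 1) {σ : TensorField n M (m + 1)} {μ : TensorField n M (m + 2)}
    {ν : TensorField n M m} (hσ : ∀ y, IsAlt (σ y)) (hσs : ∀ y, SmoothIn y σ)
    (hμ : ∀ y, IsAlt (μ y)) (hν : ∀ y, IsAlt (ν y))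
    (h : g.nabla σ = g.sigmaRHS μ ν) : g.nuOf σ = ν := by
  funext x
  refine emb_injective (isAlt_nuOf hσ hσs x) (hν x) ?_
  have hm : (m : ℝ) + 1 ≤ (n : ℝ) := by
    have : m + 1 ≤ n := by omega
    exact_mod_cast this
  have hm2 : (n : ℝ) - ((m : ℝ) + 1) + 1 ≠ 0 := by linarith
  have h0 : g.nuOf σ x = (((m : ℝ) + 1) / ((n : ℝ) - ((m : ℝ) + 1) + 1)) •
      g.trace (g.nabla σ) x := rfl
  rw [h0, map_smul, emb_trace (isAlt_ins_nabla (hσs x) hσ), h]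
  simp only [emb_sigmaRHS _ (hμ x), map_add, map_smul, Finset.sum_add_distrib, ← Finset.smul_sum,
    Clifford.sum_U_I, (hasDeg_emb (hν x)).sum_U_L]
  match_scalars
  field_simp
  ring

/-- Skewing the equation for `∇ν` determines `ρ`: the Weyl terms contribute `-k W + k W = 0`, and
what is left agrees with `sum_E_nabla_nuOf`. -/
lemma eq_rhoOf (hn : 3 ≤ n) (hk : m + 1 ≤ n - 1) {σ ρ : TensorField n M (m + 1)}
    {ν : TensorField n M m} (hσ : ∀ y, IsAlt (σ y)) (hσs : ∀ y, SmoothIn y σ)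
    (hρ : ∀ y, IsAlt (ρ y)) (hCK : g.IsConformalKilling σ) (hν : g.nuOf σ = ν)
    (h : g.nabla ν = g.nuRHS σ ρ) : g.rhoOf σ = ρ := by
  funext x
  refine emb_injective (isAlt_rhoOf σ x) (hρ x) ?_
  have h1 := sum_E_nabla_nuOf hn hk hσ (hσs x) hCK
  have hW := Clifford.CurvData.hasDeg_W (D := g.curvData x hn) (hasDeg_emb (hσ x))
  rw [hν, h] at h1
  simp only [emb_nuRHS hn _ (hσ x) (hρ x), map_add, map_smul, Finset.sum_add_distrib,
    ← Finset.smul_sum, Clifford.CurvData.sum_E_X] at h1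
  rw [show ∑ c, (g.clifford x).E c ((g.clifford x).I c (emb (ρ x))) = _ from hasDeg_emb (hρ x),
    show ∑ c, (g.clifford x).E c ((g.clifford x).I c ((g.curvData x hn).W (emb (σ x)))) = _
      from hW, ← Clifford.CurvData.Pop_apply] at h1
  have h2 : (((m : ℝ) + 1) * ((m : ℝ) + 1)) • emb (g.rhoOf σ x)
      = (((m : ℝ) + 1) * ((m : ℝ) + 1)) • emb (ρ x) := by
    push_cast at h1
    linear_combination (norm := module) (1 : ℝ) • h1
  exact smul_right_injective _ (by positivity) h2

/-! ### The equations for `∇μ` and `∇ν` of a conformal Killing form. -/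

section ConformalKillingForms

variable {σ ρ : TensorField n M (m + 1)}

lemma isAlt_ins_muRHS (c : Fin n) : IsAlt (ins c (g.muRHS σ ρ x)) :=
  (isAlt_skew (fun b : Fin (m + 2) → Fin n => g.lower x c (b 0) * ρ x (tl b)
      - g.schouten x c (b 0) * σ x (tl b)
      - (1 / 2) * ∑ p, g.weylUp x (b 0) (b 1) c p * σ x (cons p (tl (tl b))))).smul
    (((m : ℝ) + 1) + 1)

lemma isAlt_ins_blackDiamond : ∀ {k : ℕ} (σ : TensorField n M (k + 1)) (c : Fin n),
    IsAlt (ins c (g.blackDiamond (k + 1) σ x))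
  | 0, _, _ => trivial
  | 1, _, _ => trivial
  | l + 2, σ, c => isAlt_skew (fun b : Fin (l + 2) → Fin n =>
        (((l : ℝ) + 3) - 2) / ((l : ℝ) + 3) *
          ((∑ p, ∑ q, g.weylUpUp x c (b 0) p q * σ x (cons p (cons q (tl b))))
            + ∑ p, ∑ q, g.weylUpUp x (b 1) (b 0) p q *
                σ x (cons p (cons q (cons c (tl (tl b)))))))

lemma nuRHS_eq : g.nuRHS σ ρ = (-((m : ℝ) + 1)) • (ρ + contrF g (s := 1) g.schoutenF σ)
    + (((m : ℝ) + 1) * (((m : ℝ) + 1) - 1) / (2 * ((n : ℝ) - ((m : ℝ) + 1)))) •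
      g.blackDiamond (m + 1) σ := by
  funext x
  refine tensor_ext_ins fun c => ?_
  have h : ins c (((-((m : ℝ) + 1)) • (ρ + contrF g (s := 1) g.schoutenF σ)
    + (((m : ℝ) + 1) * (((m : ℝ) + 1) - 1) / (2 * ((n : ℝ) - ((m : ℝ) + 1)))) •
      g.blackDiamond (m + 1) σ) x) = (-((m : ℝ) + 1)) • (ins c (ρ x)
      + ins c (contr (g.comp x) (s := 1) (g.schoutenF x) (σ x)))
    + (((m : ℝ) + 1) * (((m : ℝ) + 1) - 1) / (2 * ((n : ℝ) - ((m : ℝ) + 1)))) •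
      ins c (g.blackDiamond (m + 1) σ x) := rfl
  rw [h, ins_contr_two]
  funext i
  simp only [Pi.add_apply, Pi.smul_apply, Finset.sum_apply, smul_eq_mul]
  rfl

lemma isAlt_ins_nuRHS (hσ : IsAlt (σ x)) (hρ : IsAlt (ρ x)) (c : Fin n) :
    IsAlt (ins c (g.nuRHS σ ρ x)) := by
  rw [nuRHS_eq]
  refine IsAlt.add (IsAlt.smul _ (IsAlt.add (hρ.ins c) ?_))
    (IsAlt.smul _ (isAlt_ins_blackDiamond σ c))
  show IsAlt (ins c (contr (g.comp x) (s := 1) (g.schoutenF x) (σ x)))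
  rw [ins_contr_two]
  exact IsAlt.sum fun p _ => (hσ.ins p).smul _

lemma nabla_muOf (hn : 3 ≤ n) (hk : m + 1 ≤ n - 1) (hσ : ∀ y, IsAlt (σ y))
    (hσs : ∀ y, SmoothIn y σ) (h : g.IsConformalKilling σ) :
    g.nabla (g.muOf σ) = g.muRHS σ (g.rhoOf σ) := by
  funext x
  refine tensor_ext_ins fun c => ?_
  have hA := isAlt_ins_nabla (g := g) (smoothIn_muOf (g := g) (hσs x)) (isAlt_muOf σ)
  refine emb_injective (hA c) (isAlt_ins_muRHS c) ?_
  refine Eq.trans ?_ (emb_muRHS hn c (hσ x)).symm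
  refine Clifford.CurvData.solve_first (D := g.curvData x hn)
    (N := fun b => emb (ins b (g.nabla (g.nuOf σ) x)))
    (M := fun b => emb (ins b (g.nabla (g.muOf σ) x)))
    (by positivity) ?_ ?_ ?_ ?_ c
  · exact_mod_cast hasDeg_emb (g := g) (hσ x)
  · intro b
    have := hasDeg_emb (g := g) (x := x) (hA b)
    rw [show ((m + 2 : ℕ) : ℝ) = (m : ℝ) + 1 + 1 by push_cast; ring] at this
    exact this
  · exact integrability_sigma hn hσ (hσs x) (isAlt_muOf σ) (smoothIn_muOf (hσs x))
      (smoothIn_nuOf (hσs x)) (isConformalKilling_iff.1 h)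
  · exact sum_E_nabla_nuOf hn hk hσ (hσs x) h

lemma nabla_nuOf (hn : 3 ≤ n) (hk : m + 1 ≤ n - 1) (hσ : ∀ y, IsAlt (σ y))
    (hσs : ∀ y, SmoothIn y σ) (h : g.IsConformalKilling σ) :
    g.nabla (g.nuOf σ) = g.nuRHS σ (g.rhoOf σ) := by
  funext x
  refine tensor_ext_ins fun c => ?_
  have hA := isAlt_ins_nabla (g := g) (smoothIn_nuOf (g := g) (hσs x)) (isAlt_nuOf hσ hσs)
  refine emb_injective (hA c) (isAlt_ins_nuRHS (hσ x) (isAlt_rhoOf σ x) c) ?_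
  refine Eq.trans ?_ (emb_nuRHS hn c (hσ x) (isAlt_rhoOf σ x)).symm
  have hmn : (m : ℝ) + 1 < n := by
    have : m + 1 < n := by omega
    exact_mod_cast this
  refine Clifford.CurvData.solve_second (D := g.curvData x hn)
    (N := fun b => emb (ins b (g.nabla (g.nuOf σ) x)))
    (M := fun b => emb (ins b (g.nabla (g.muOf σ) x)))
    (by positivity) hmn ?_ ?_ ?_ ?_ ?_ c
  · exact_mod_cast hasDeg_emb (g := g) (hσ x)
  · exact_mod_cast hasDeg_emb (g := g) (isAlt_rhoOf σ x)
  · intro b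
    have := hasDeg_emb (g := g) (x := x) (hA b)
    rwa [← add_sub_cancel_right (m : ℝ) 1] at this
  · exact integrability_sigma hn hσ (hσs x) (isAlt_muOf σ) (smoothIn_muOf (hσs x))
      (smoothIn_nuOf (hσs x)) (isConformalKilling_iff.1 h)
  · intro b
    rw [nabla_muOf hn hk hσ hσs h, emb_muRHS hn b (hσ x)]

end ConformalKillingForms

end Metric

end Prolongation

/-! ## The equation for `ρ`, in degrees at least two -/

section Prolongation

variable {n : ℕ} {M : Type*} [TopologicalSpace M] [ChartedSpace (Coord n) M]
  [IsManifold (𝓡 n) ∞ M] {g : Metric n M} {x : M} {l : ℕ}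

namespace Metric

/-- `A^q{}_{bc} ι_q T`. -/
def cottonContr (g : Metric n M) (x : M) (b c : Fin n) {r : ℕ} (T : Tensor n (r + 1)) :
    Tensor n r := ∑ p, g.cottonUp x p b c • ins p T

lemma cotton_antisymm (a b c : Fin n) : g.cotton x a b c = -g.cotton x a c b := by
  unfold cotton
  ring

lemma cottonContr_antisymm (b c : Fin n) {r : ℕ} (T : Tensor n (r + 1)) :
    cottonContr g x b c T = -cottonContr g x c b T := by
  unfold cottonContr cottonUp
  rw [← Finset.sum_neg_distrib]
  refine Finset.sum_congr rfl fun p _ => ?_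
  rw [← neg_smul, ← Finset.sum_neg_distrib]
  congr 1
  refine Finset.sum_congr rfl fun q _ => ?_
  rw [cotton_antisymm q b c]
  ring

lemma isAlt_cottonContr (b c : Fin n) {r : ℕ} {T : Tensor n (r + 1)} (hT : IsAlt T) :
    IsAlt (cottonContr g x b c T) := IsAlt.sum fun p _ => (hT.ins p).smul _

lemma emb_cottonContr (b c : Fin n) {r : ℕ} {T : Tensor n (r + 1)} (hT : IsAlt T) :
    emb (cottonContr g x b c T) = ∑ q, g.cotton x q b c • (g.clifford x).U q (emb T) := by
  rw [sum_smul_U_emb _ hT]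
  unfold cottonContr cottonUp
  simp only [g.upper_symm x, mul_comm]

lemma emb_skew_comb {r : ℕ} (a b : ℝ) (f₁ f₂ f₃ f₄ f₅ f₆ : Tensor n r) :
    emb (skew (f₁ - f₂ + a • f₃ - f₄ + a • f₅ - b • f₆))
      = emb f₁ - emb f₂ + a • emb f₃ - emb f₄ + a • emb f₅ - b • emb f₆ := by
  rw [emb_skew, map_sub, map_add, map_sub, map_add, map_sub, map_smul, map_smul, map_smul]

lemma emb_second_index {r : ℕ} (T : Tensor n (r + 3)) (c : Fin n) :
    emb (fun a : Fin (r + 2) → Fin n => T (cons (a 0) (cons c (tl a))))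
      = (1 / ((r : ℝ) + 2)) • ∑ a, (g.clifford x).E a (emb (ins c (ins a T))) := by
  rw [emb_succ, one_div, show ((r + 1 : ℕ) : ℝ) + 1 = (r : ℝ) + 2 by push_cast; ring]
  rfl

lemma emb_rhoRHS (hn : 3 ≤ n) (c : Fin n) {σ : TensorField n M (l + 2)}
    {μ : TensorField n M (l + 3)} {ν : TensorField n M (l + 1)}
    (hσ : IsAlt (σ x)) (hμ : IsAlt (μ x)) (hν : IsAlt (ν x)) :
    emb (ins c (g.rhoRHS (l + 1) σ μ ν x))
      = (1 / ((l : ℝ) + 2)) • (g.curvData x hn).PE c (emb (ν x))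
        - (g.curvData x hn).PU c (emb (μ x))
        + (1 / 2 : ℝ) • (1 / (((l : ℝ) + 1) * ((l : ℝ) + 2))) • ∑ a, ∑ b, (g.clifford x).E a
          ((g.clifford x).E b ((g.clifford x).I c (emb (cottonContr g x a b (σ x)))))
        - (1 / ((l : ℝ) + 2)) • ∑ a, (g.clifford x).E a (emb (cottonContr g x c a (σ x)))
        + (1 / 2 : ℝ) • (1 / (((l : ℝ) + 1) * ((l : ℝ) + 2))) •
          (g.curvData x hn).Cop c (emb (ν x))
        - (((l : ℝ) + 2) / (2 * ((n : ℝ) - ((l : ℝ) + 2)))) • (1 / ((l : ℝ) + 2)) •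
          ∑ a, (g.clifford x).E a (emb (ins c (ins a (g.nabla (g.blackDiamond (l + 2) σ) x)))) := by
  have h0 : ins c (g.rhoRHS (l + 1) σ μ ν x) = skew (
      (fun a : Fin (l + 2) → Fin n => g.schouten x c (a 0) * ν x (tl a))
      - (fun a : Fin (l + 2) → Fin n => ∑ p, g.schoutenUp x c p * μ x (cons p a))
      + (1 / 2 : ℝ) • (fun a : Fin (l + 2) → Fin n =>
        ∑ p, g.cottonUp x p (a 0) (a 1) * σ x (cons p (cons c (tl (tl a)))))
      - (fun a : Fin (l + 2) → Fin n => ∑ p, g.cottonUp x p c (a 0) * σ x (cons p (tl a)))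
      + (1 / 2 : ℝ) • (fun a : Fin (l + 2) → Fin n =>
        ∑ p, g.weylUp x (a 0) (a 1) c p * ν x (cons p (tl (tl a))))
      - (((l : ℝ) + 2) / (2 * ((n : ℝ) - ((l : ℝ) + 2)))) • (fun a : Fin (l + 2) → Fin n =>
        g.nabla (g.blackDiamond (l + 2) σ) x (cons (a 0) (cons c (tl a))))) := by
    refine Eq.trans (b := skew fun a : Fin (l + 2) → Fin n =>
        g.schouten x c (a 0) * ν x (tl a)
          - (∑ p, g.schoutenUp x c p * μ x (cons p a))
          + (1 / 2) * (∑ p, g.cottonUp x p (a 0) (a 1) * σ x (cons p (cons c (tl (tl a)))))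
          - (∑ p, g.cottonUp x p c (a 0) * σ x (cons p (tl a)))
          + (1 / 2) * (∑ p, g.weylUp x (a 0) (a 1) c p * ν x (cons p (tl (tl a))))
          - ((l : ℝ) + 2) / (2 * ((n : ℝ) - ((l : ℝ) + 2))) *
              g.nabla (g.blackDiamond (l + 2) σ) x (cons (a 0) (cons c (tl a)))) rfl
      (congrArg skew (funext fun a => ?_))
    simp only [Pi.add_apply, Pi.sub_apply, Pi.smul_apply, smul_eq_mul]
  have hl : ((l + 1 : ℕ) : ℝ) + 1 = (l : ℝ) + 2 := by push_cast; ring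
  have h1 : emb (fun a : Fin (l + 2) → Fin n => g.schouten x c (a 0) * ν x (tl a))
      = (1 / ((l : ℝ) + 2)) • (g.curvData x hn).PE c (emb (ν x)) := by
    rw [emb_succ, one_div, hl]
    congr 1
    refine Finset.sum_congr rfl fun a _ => ?_
    refine (congrArg _ (map_smul emb (g.schouten x c a) (ν x))).trans ?_
    rw [map_smul]
    rfl
  have h2 : emb (fun a : Fin (l + 2) → Fin n => ∑ p, g.schoutenUp x c p * μ x (cons p a))
      = (g.curvData x hn).PU c (emb (μ x)) := by
    rw [PU_emb hn c hμ]
    congr 1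
    funext a
    simp only [Finset.sum_apply, Pi.smul_apply, smul_eq_mul]
    rfl
  have h3 : emb (fun a : Fin (l + 2) → Fin n =>
        ∑ p, g.cottonUp x p (a 0) (a 1) * σ x (cons p (cons c (tl (tl a)))))
      = (1 / (((l : ℝ) + 1) * ((l : ℝ) + 2))) • ∑ a, ∑ b, (g.clifford x).E a
          ((g.clifford x).E b ((g.clifford x).I c (emb (cottonContr g x a b (σ x))))) := by
    have h : ∀ a b, ins b (ins a (fun a : Fin (l + 2) → Fin n =>
        ∑ p, g.cottonUp x p (a 0) (a 1) * σ x (cons p (cons c (tl (tl a))))))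
        = ins c (cottonContr g x a b (σ x)) := fun a b => by
      funext i
      simp only [cottonContr, ins_sum, Finset.sum_apply]
      rfl
    have hI : ∀ a b, (g.clifford x).I c (emb (cottonContr g x a b (σ x)))
        = emb (ins c (cottonContr g x a b (σ x))) := fun a b =>
      I_emb (isAlt_cottonContr _ _ hσ) c
    have he : ∀ a, emb (ins a (fun a : Fin (l + 2) → Fin n =>
        ∑ p, g.cottonUp x p (a 0) (a 1) * σ x (cons p (cons c (tl (tl a))))))
        = ((l : ℝ) + 1)⁻¹ • ∑ b, extOp b (emb (ins c (cottonContr g x a b (σ x)))) := fun a => by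
      rw [emb_succ]
      simp only [h]
    rw [emb_succ, hl]
    simp only [he, hI, map_smul, map_sum, Finset.smul_sum, smul_smul]
    refine Finset.sum_congr rfl fun a _ => Finset.sum_congr rfl fun b _ => ?_
    refine congrArg₂ HSMul.hSMul ?_ rfl
    field_simp
  have h4 : emb (fun a : Fin (l + 2) → Fin n =>
        ∑ p, g.cottonUp x p c (a 0) * σ x (cons p (tl a)))
      = (1 / ((l : ℝ) + 2)) • ∑ a, (g.clifford x).E a (emb (cottonContr g x c a (σ x))) := by
    rw [emb_succ, one_div, hl]
    congr 1
    refine Finset.sum_congr rfl fun a _ => ?_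
    refine congrArg (extOp a) (congrArg emb ?_)
    funext i
    simp only [cottonContr, Finset.sum_apply]
    rfl
  rw [h0]
  refine (emb_skew_comb _ _ _ _ _ _ _ _).trans ?_
  rw [h1, h2, h3, h4, emb_second_index (g := g) (x := x), emb_weyl_skew hn c hν]

/-- The totally skew part of `C ♦ σ` is a multiple of `k ε^c X_c + ε^c ι_c W`, in which the first
term is `-k W` and the second is `k W` by degree. -/
lemma skewF_blackDiamond (hn : 3 ≤ n) {σ : TensorField n M (l + 2)} (hσ : ∀ y, IsAlt (σ y)) :
    skewF (g.blackDiamond (l + 2) σ) = 0 := by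
  funext y
  refine emb_injective (isAlt_skew _) IsAlt.zero ?_
  show emb (skew (g.blackDiamond (l + 2) σ y)) = emb 0
  have hW : ∑ c, (g.clifford y).E c ((g.clifford y).I c ((g.curvData y hn).W (emb (σ y)))) = _ :=
    Clifford.CurvData.hasDeg_W (D := g.curvData y hn) (hasDeg_emb (hσ y))
  have h : ((((l + 1 : ℕ) : ℝ) + 1) * ((l + 1 : ℕ) : ℝ)) • ∑ c, (g.clifford y).E c
      (emb (ins c (g.blackDiamond (l + 2) σ y))) = 0 := by
    have e : ∀ c, ((((l + 1 : ℕ) : ℝ) + 1) * ((l + 1 : ℕ) : ℝ)) • (g.clifford y).E c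
        (emb (ins c (g.blackDiamond (l + 2) σ y)))
        = (g.clifford y).E c ((((l + 1 : ℕ) : ℝ) + 1) • (g.curvData y hn).X c (emb (σ y))
        + (g.clifford y).I c ((g.curvData y hn).W (emb (σ y)))) := fun c => by
      rw [← map_smul, emb_blackDiamond hn _ (hσ y)]
    rw [Finset.smul_sum]
    simp only [e, map_add, map_smul,
      Finset.sum_add_distrib, ← Finset.smul_sum, Clifford.CurvData.sum_E_X, hW]
    push_cast
    module
  rw [emb_skew, emb_succ, map_zero]
  rw [show ∑ p, extOp p (emb (ins p (g.blackDiamond (l + 2) σ y))) = 0 from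
    (smul_eq_zero.1 h).resolve_left (by positivity), smul_zero]

/-- Covariant differentiation commutes with skewing. This is the hypothesis on `F` that keeps the
derivative of `C ♦ σ` from entering twice in `solve_third`. -/
lemma sum_E_nabla_blackDiamond (hn : 3 ≤ n) {σ : TensorField n M (l + 2)}
    (hσ : ∀ y, IsAlt (σ y)) (hσs : SmoothIn x σ) (b : Fin n) :
    ∑ c, (g.clifford x).E c (emb (ins c (ins b (g.nabla (g.blackDiamond (l + 2) σ) x)))) = 0 := by
  have h := nabla_skewF (g := g) (smoothIn_blackDiamond (g := g) hσ hσs)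
  rw [skewF_blackDiamond hn hσ, nabla_zero] at h
  have h1 : emb (ins b (g.nabla (g.blackDiamond (l + 2) σ) x)) = 0 := by
    rw [← emb_skew, ← ins_tailSkew, ← h]
    exact map_zero emb
  rw [emb_succ] at h1
  exact (smul_eq_zero.1 h1).resolve_left (by positivity)

/-- The equation for `∇ν` differentiated by the Leibniz rules. The summand with the derivative of
the Schouten tensor becomes the Cotton term once the two derivatives are skewed. -/
lemma emb_nabla_nabla_nuOf (hn : 3 ≤ n) (hk : l + 2 ≤ n - 1) {σ : TensorField n M (l + 2)}
    (hσ : ∀ y, IsAlt (σ y)) (hσs : ∀ y, SmoothIn y σ) (h : g.IsConformalKilling σ) (b c : Fin n) :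
    emb (ins c (ins b (g.nabla (g.nabla (g.nuOf σ)) x)))
      = -((l : ℝ) + 2) • ((g.clifford x).I c (emb (ins b (g.nabla (g.rhoOf σ) x)))
        + ∑ q, g.nabla g.schoutenF x ![b, c, q] • (g.clifford x).U q (emb (σ x))
        + (g.curvData x hn).PU c (emb (ins b (g.nabla σ x))))
      + (((l : ℝ) + 2) * ((l : ℝ) + 1) / (2 * ((n : ℝ) - ((l : ℝ) + 2)))) •
        emb (ins c (ins b (g.nabla (g.blackDiamond (l + 2) σ) x))) := by
  have hρs := smoothIn_rhoOf (g := g) (hσs x) h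
  have hPs := smoothIn_contrF (g := g) (s := 1) (smoothIn_schoutenF (g := g)) (hσs x)
  rw [nabla_nuOf (m := l + 1) hn hk hσ hσs h, nuRHS_eq,
    nabla_add (smoothIn_smul _ (smoothIn_add hρs hPs))
      (smoothIn_smul _ (smoothIn_blackDiamond hσ (hσs x))),
    nabla_smul _ (smoothIn_add hρs hPs), nabla_smul _ (smoothIn_blackDiamond hσ (hσs x)),
    nabla_add hρs hPs]
  simp only [ins_add, ins_smul, map_add, map_smul]
  have hc : emb (ins c (ins b (g.nabla (contrF g (s := 1) g.schoutenF σ) x)))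
      = ∑ q, g.nabla g.schoutenF x ![b, c, q] • (g.clifford x).U q (emb (σ x))
        + (g.curvData x hn).PU c (emb (ins b (g.nabla σ x))) := by
    rw [nabla_contrF (s := 1) smoothIn_schoutenF (hσs x), ins_add, map_add,
      emb_ins_contr_two _ (hσ x), emb_ins_contr_two _ (isAlt_ins_nabla (hσs x) hσ b),
      Clifford.CurvData.PU_apply]
    rfl
  rw [hc, I_emb (isAlt_ins_nabla hρs (isAlt_rhoOf σ) b)]
  push_cast
  module

lemma isAlt_ins_rhoRHS {σ : TensorField n M (l + 2)} {μ : TensorField n M (l + 3)}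
    {ν : TensorField n M (l + 1)} (c : Fin n) : IsAlt (ins c (g.rhoRHS (l + 1) σ μ ν x)) :=
  isAlt_skew fun a : Fin (l + 2) → Fin n =>
        g.schouten x c (a 0) * ν x (tl a)
          - (∑ p, g.schoutenUp x c p * μ x (cons p a))
          + (1 / 2) * (∑ p, g.cottonUp x p (a 0) (a 1) * σ x (cons p (cons c (tl (tl a)))))
          - (∑ p, g.cottonUp x p c (a 0) * σ x (cons p (tl a)))
          + (1 / 2) * (∑ p, g.weylUp x (a 0) (a 1) c p * ν x (cons p (tl (tl a))))
          - ((l : ℝ) + 2) / (2 * ((n : ℝ) - ((l : ℝ) + 2))) *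
              g.nabla (g.blackDiamond (l + 2) σ) x (cons (a 0) (cons c (tl a)))

/-- The integrability condition of the equation for `∇ν`, solved by `solve_third` with the Cotton
contraction as `T` and the derivative of `C ♦ σ` as `F`. -/
lemma nabla_rhoOf_of_two_le (hn : 3 ≤ n) (hk : l + 2 ≤ n - 1) {σ : TensorField n M (l + 2)}
    (hσ : ∀ y, IsAlt (σ y)) (hσs : ∀ y, SmoothIn y σ) (h : g.IsConformalKilling σ) :
    g.nabla (g.rhoOf σ) = g.rhoRHS (l + 1) σ (g.muOf σ) (g.nuOf σ) := by
  funext x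
  refine tensor_ext_ins fun c => ?_
  have hνA := isAlt_nuOf (g := g) hσ hσs
  have hμA := isAlt_muOf (g := g) σ
  have hA := isAlt_ins_nabla (g := g) (smoothIn_rhoOf (g := g) (hσs x) h) (isAlt_rhoOf σ)
  refine emb_injective (hA c) (isAlt_ins_rhoRHS c) ?_
  have hl : ((l + 1 : ℕ) : ℝ) + 1 = (l : ℝ) + 2 := by push_cast; ring
  set κ := ((l : ℝ) + 2) * ((l : ℝ) + 1) / (2 * ((n : ℝ) - ((l : ℝ) + 2))) with hκ
  have key := Clifford.CurvData.solve_third (D := g.curvData x hn) (k := (l : ℝ) + 2)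
    (ν := emb (g.nuOf σ x)) (μ := emb (g.muOf σ x))
    (Q := fun b => emb (ins b (g.nabla (g.rhoOf σ) x)))
    (S := fun b => emb (ins b (g.nabla σ x)))
    (T := fun b c => emb (cottonContr g x b c (σ x)))
    (F := fun b c => κ • emb (ins c (ins b (g.nabla (g.blackDiamond (l + 2) σ) x))))
    (by positivity) ?_ ?_ ?_ ?_ ?_ ?_ ?_ c
  · rw [emb_rhoRHS hn c (hσ x) (hμA x) (hνA x)]
    -- `solve_third` gives `k (k - 1) ∇ρ`, and this factor can be cancelled exactly because `k ≥ 2`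
    -- here.
    have hk0 : ((l : ℝ) + 2) * ((l : ℝ) + 2 - 1) ≠ 0 := by
      have : (l : ℝ) + 2 - 1 = l + 1 := by ring
      rw [this]
      positivity
    have hnl : (n : ℝ) - ((l : ℝ) + 2) ≠ 0 := by
      have : l + 2 < n := by omega
      have : ((l + 2 : ℕ) : ℝ) < n := by exact_mod_cast this
      push_cast at this
      linarith
    refine smul_right_injective _ hk0 ?_
    simp only
    rw [key]
    simp only [map_smul, ← Finset.smul_sum, hκ]
    have e : (l : ℝ) + 2 - 1 = l + 1 := by ring
    rw [e]
    match_scalars <;> field_simp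
  · have := hasDeg_emb (g := g) (x := x) (hνA x)
    rwa [show ((l + 1 : ℕ) : ℝ) = (l : ℝ) + 2 - 1 by push_cast; ring] at this
  · have := hasDeg_emb (g := g) (x := x) (hμA x)
    rwa [show ((l + 1 + 2 : ℕ) : ℝ) = (l : ℝ) + 2 + 1 by push_cast; ring] at this
  · intro b
    have := hasDeg_emb (g := g) (x := x) (hA b)
    rwa [show ((l + 1 + 1 : ℕ) : ℝ) = (l : ℝ) + 2 by push_cast; ring] at this
  · intro b
    rw [isConformalKilling_iff.1 h, emb_sigmaRHS b (hμA x), hl]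
  · intro b c
    rw [cottonContr_antisymm, map_neg]
  · intro b
    simp only [map_smul, ← Finset.smul_sum]
    rw [sum_E_nabla_blackDiamond hn hσ (hσs x), smul_zero]
  · intro b c
    rw [← ricci_identity_emb hn (smoothIn_nuOf (hσs x)) (hνA x),
      emb_nabla_nabla_nuOf hn hk hσ hσs h, emb_nabla_nabla_nuOf hn hk hσ hσs h,
      emb_cottonContr b c (hσ x)]
    have hcot : ∑ q, g.cotton x q b c • (g.clifford x).U q (emb (σ x))
        = ∑ q, g.nabla g.schoutenF x ![b, c, q] • (g.clifford x).U q (emb (σ x))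
          - ∑ q, g.nabla g.schoutenF x ![c, b, q] • (g.clifford x).U q (emb (σ x)) := by
      rw [← Finset.sum_sub_distrib]
      refine Finset.sum_congr rfl fun q _ => ?_
      rw [show g.cotton x q b c = g.nabla g.schoutenF x ![b, c, q]
        - g.nabla g.schoutenF x ![c, b, q] from rfl]
      module
    rw [hcot]
    module

end Metric

end Prolongation

/-! ## The equation for `ρ`, in degree one -/

section DegreeOne

variable {n : ℕ} {M : Type*} [TopologicalSpace M] [ChartedSpace (Coord n) M]
  [IsManifold (𝓡 n) ∞ M] {g : Metric n M} {x : M}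

namespace Metric

/-- Covariant differentiation commutes with permutations of the indices, so algebraic symmetries of
the curvature pass to its derivative. -/
lemma nabla_curv_antisymm (e a b c d : Fin n) :
    g.nabla g.curv x ![e, a, b, c, d] = -g.nabla g.curv x ![e, b, a, c, d] := by
  have h : g.curv = (-1 : ℝ) • permF (Equiv.swap 0 1) g.curv := by
    funext y i
    show g.riemannLower y (i 0) (i 1) (i 2) (i 3) = -1 * g.riemannLower y (i 1) (i 0) (i 2) (i 3)
    rw [g.riemannLower_antisymm]
    ring
  have h1 := nabla_smul (g := g) (-1) (smoothIn_permF (Equiv.swap 0 1) (g.smoothIn_curv x))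
  rw [← h] at h1
  refine (congrFun h1 ![e, a, b, c, d]).trans ((congrArg (fun t => (-1 : ℝ) * t)
    (nabla_permF (Equiv.swap 0 1) (g.smoothIn_curv x) e ![a, b, c, d])).trans ?_)
  rw [show (fun s => (![a, b, c, d] : Fin 4 → Fin n) ((Equiv.swap 0 1 : Equiv.Perm (Fin 4)) s))
    = ![b, a, c, d] by funext s; fin_cases s <;> rfl]
  exact neg_one_mul (α := ℝ) _

lemma nabla_curv_pair (e a b c d : Fin n) :
    g.nabla g.curv x ![e, a, b, c, d] = g.nabla g.curv x ![e, c, d, a, b] := by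
  have h : g.curv = permF (Equiv.swap 0 2 * Equiv.swap 1 3) g.curv := by
    funext y i
    exact g.riemannLower_pair y (i 0) (i 1) (i 2) (i 3)
  conv_lhs => rw [h]
  refine (nabla_permF (Equiv.swap 0 2 * Equiv.swap 1 3) (g.smoothIn_curv x) e
    ![a, b, c, d]).trans ?_
  rw [show (fun s => (![a, b, c, d] : Fin 4 → Fin n)
    ((Equiv.swap 0 2 * Equiv.swap 1 3 : Equiv.Perm (Fin 4)) s))
    = ![c, d, a, b] by funext s; fin_cases s <;> rfl]

lemma nabla_curv_antisymm' (e a b c d : Fin n) :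
    g.nabla g.curv x ![e, a, b, c, d] = -g.nabla g.curv x ![e, a, b, d, c] := by
  rw [nabla_curv_pair, nabla_curv_antisymm, nabla_curv_pair]

lemma nabla_ricciF (c p b : Fin n) : g.nabla g.ricciF x ![c, p, b]
    = ∑ a, ∑ e, g.upper x a e * g.nabla g.curv x ![c, a, p, e, b] := by
  have h := congrFun (nabla_trace (g := g)
    (smoothIn_permF (Equiv.swap 1 2) (g.smoothIn_curv x)) c) ![p, b]
  rw [← ricciF_eq] at h
  refine h.trans ?_
  simp only [traceWith, Finset.sum_apply, Pi.smul_apply, smul_eq_mul]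
  refine Finset.sum_congr rfl fun a _ => Finset.sum_congr rfl fun e _ => ?_
  refine congrArg (fun t => g.upper x a e * t)
    ((nabla_permF (Equiv.swap 1 2) (g.smoothIn_curv x) c ![a, e, p, b]).trans ?_)
  rw [show (fun s => (![a, e, p, b] : Fin 4 → Fin n) ((Equiv.swap 1 2 : Equiv.Perm (Fin 4)) s))
    = ![a, p, e, b] by funext s; fin_cases s <;> rfl]

/-- The contracted second Bianchi identity. -/
lemma sum_nabla_curv (c p b : Fin n) :
    ∑ a, ∑ e, g.upper x a e * g.nabla g.curv x ![a, c, p, e, b]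
      = g.nabla g.ricciF x ![c, p, b] - g.nabla g.ricciF x ![p, c, b] := by
  rw [nabla_ricciF, nabla_ricciF, ← Finset.sum_sub_distrib]
  refine Finset.sum_congr rfl fun a _ => ?_
  rw [← Finset.sum_sub_distrib]
  refine Finset.sum_congr rfl fun e _ => ?_
  have h := nabla_curv_bianchi (g := g) (x := x) a c p e b
  rw [nabla_curv_antisymm c p a] at h
  rw [← mul_sub]
  congr 1
  linarith

section

variable {σ : TensorField n M 1} {μ : TensorField n M 2} {ν : TensorField n M 0}

lemma nabla_sigma_apply (h : g.nabla σ = g.sigmaRHS μ ν) (y : M)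
    (c d : Fin n) : g.nabla σ y ![c, d] = μ y ![c, d] + g.lower y c d * ν y ![] := by
  rw [h]
  show μ y ![c, d] + skew _ ![d] = _
  rw [IsAlt.skew_eq (r := 1) trivial]
  rfl

lemma nabla_nabla_sigma_apply (h : g.nabla σ = g.sigmaRHS μ ν) (hμs : SmoothIn x μ)
    (hνs : SmoothIn x ν) (b c d : Fin n) :
    g.nabla (g.nabla σ) x ![b, c, d]
      = g.nabla μ x ![b, c, d] + g.lower x c d * g.nabla ν x ![b] := by
  have ho : SmoothIn x (outerF (s := 2) g.comp ν) := smoothIn_outerF (g.smooth x) hνs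
  have h0 : g.sigmaRHS μ ν = μ + outerF (s := 2) g.comp ν := by
    rw [sigmaRHS_eq]
    congr 1
    funext y
    refine tensor_ext_ins fun c => ?_
    exact IsAlt.skew_eq (r := 1) (T := ins c (outerF (s := 2) g.comp ν y)) trivial
  have h1 : ins b (g.nabla (outerF (s := 2) g.comp ν) x)
      = outer (s := 2) (g.comp x) (ins b (g.nabla ν x)) := by
    refine (nabla_outerF (g := g) (s := 2) (S := g.comp) (g.smooth x) hνs b).trans ?_
    rw [nabla_comp]
    refine (congrArg (fun t => t + _) (outer_zero_left (s := 2) (ν x))).trans ?_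
    exact zero_add _
  rw [h, h0, nabla_add hμs ho]
  exact congrArg (fun t => g.nabla μ x ![b, c, d] + t) (congrFun h1 ![c, d])

/-- The equation for `∇μ` in degree one. -/
lemma nabla_mu_apply (hσs : SmoothIn x σ) (hμ : ∀ y, IsAlt (μ y)) (hμs : SmoothIn x μ)
    (hνs : SmoothIn x ν) (h : g.nabla σ = g.sigmaRHS μ ν) (c a b : Fin n) :
    g.nabla μ x ![c, a, b] = ∑ p, g.riemann x a b p c * σ x ![p]
      + g.lower x b c * g.nabla ν x ![a] - g.lower x a c * g.nabla ν x ![b] := by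
  have hanti : ∀ a b c, g.nabla μ x ![a, b, c] = -g.nabla μ x ![a, c, b] := fun a b c =>
    (isAlt_ins_nabla hμs hμ a).2 b c ![]
  have hY : ∀ b c d, g.nabla μ x ![b, c, d] - g.nabla μ x ![c, b, d]
      = -∑ p, g.riemann x b c p d * σ x ![p] - g.lower x c d * g.nabla ν x ![b]
        + g.lower x b d * g.nabla ν x ![c] := fun b c d => by
    have h1 := g.ricci_identity hσs b c ![d]
    rw [act_one] at h1
    have h2 := nabla_nabla_sigma_apply h hμs hνs b c d
    have h3 := nabla_nabla_sigma_apply h hμs hνs c b d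
    have h4 : g.nabla (g.nabla σ) x ![b, c, d] - g.nabla (g.nabla σ) x ![c, b, d]
      = -∑ p, g.riemann x b c p d * σ x ![p] := h1
    linarith
  have hB : ∑ p, g.riemann x c a p b * σ x ![p] + ∑ p, g.riemann x a b p c * σ x ![p]
      + ∑ p, g.riemann x b c p a * σ x ![p] = 0 := by
    rw [← Finset.sum_add_distrib, ← Finset.sum_add_distrib]
    refine Finset.sum_eq_zero fun p _ => ?_
    rw [← add_mul, ← add_mul, g.riemann_bianchi, zero_mul]
  have e1 := hY c a b
  have e2 := hY b c a
  have e3 := hY a b c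
  rw [g.lower_symm x c b] at e1
  rw [g.lower_symm x c a, g.lower_symm x b a] at e2
  -- As in Koszul's formula, `∇μ` is skew in its last two indices and `hY` prescribes its part skew
  -- in the first two; the cyclic combination recovers all of it, and Bianchi collapses the three
  -- curvature terms to one.
  linarith [hanti a b c, hanti b a c, hanti c a b]

/-- The derivative of the equation for `∇μ` in degree one. -/
lemma nabla_nabla_mu_apply (hσs : ∀ y, SmoothIn y σ) (hμ : ∀ y, IsAlt (μ y))
    (hμs : ∀ y, SmoothIn y μ) (hνs : ∀ y, SmoothIn y ν) (h : g.nabla σ = g.sigmaRHS μ ν)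
    (d c a b : Fin n) :
    g.nabla (g.nabla μ) x ![d, c, a, b]
      = ∑ p, ∑ q, g.upper x p q * g.nabla g.curv x ![d, a, b, p, c] * σ x ![q]
        + ∑ p, ∑ q, g.upper x p q * g.riemannLower x a b p c * g.nabla σ x ![d, q]
        + g.lower x b c * g.nabla (g.nabla ν) x ![d, a]
        - g.lower x a c * g.nabla (g.nabla ν) x ![d, b] := by
  have r1 : ∀ c a b p : Fin n, (fun s => (![c, a, b, p] : Fin 4 → Fin n)
      ((finRotate 4 : Equiv.Perm (Fin 4)) s)) = ![a, b, p, c] := fun c a b p => by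
    funext s; fin_cases s <;> rfl
  have r2 : ∀ c a b : Fin n, (fun s => (![c, a, b] : Fin 3 → Fin n)
      (((finRotate 3).symm : Equiv.Perm (Fin 3)) s)) = ![b, c, a] := fun c a b => by
    funext s; fin_cases s <;> rfl
  have r3 : ∀ c a b : Fin n, (fun s => (![c, a, b] : Fin 3 → Fin n)
      ((Equiv.swap 0 1 : Equiv.Perm (Fin 3)) s)) = ![a, c, b] := fun c a b => by
    funext s; fin_cases s <;> rfl
  set N := g.nabla ν with hN
  have hNs : SmoothIn x N := g.smoothIn_nabla (hνs x)
  have hRs : SmoothIn x (permF (finRotate 4) g.curv) := smoothIn_permF _ (g.smoothIn_curv x)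
  have hos : SmoothIn x (outerF (s := 2) (r := 1) g.comp N) := smoothIn_outerF (g.smooth x) hNs
  have hcs : SmoothIn x (contrF g (s := 3) (r := 0) (permF (finRotate 4) g.curv) σ) :=
    smoothIn_contrF hRs (hσs x)
  -- The equation for `∇μ` rewritten as an identity of tensor fields built from contractions,
  -- products and permutations, to which the Leibniz rules apply.
  have hE : g.nabla μ = contrF g (s := 3) (r := 0) (permF (finRotate 4) g.curv) σ
      + permF (r := 3) (finRotate 3).symm (outerF (s := 2) (r := 1) g.comp N)
      - permF (r := 3) (Equiv.swap 0 1) (outerF (s := 2) (r := 1) g.comp N) := by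
    funext y
    refine tensor_ext_ins fun c => tensor_ext_ins fun a => tensor_ext_ins fun b => ?_
    funext i
    have hi : i = ![] := Subsingleton.elim _ _
    subst hi
    refine (nabla_mu_apply (hσs y) hμ (hμs y) (hνs y) h c a b).trans ?_
    show _ = (∑ p, ∑ q, (g.upper y p q * g.curv y (fun s => (![c, a, b, p] : Fin 4 → Fin n)
        ((finRotate 4 : Equiv.Perm (Fin 4)) s))) • ins q (σ y)) ![]
      + outer (s := 2) (r := 1) (g.comp y) (N y) (fun s => (![c, a, b] : Fin 3 → Fin n)
        (((finRotate 3).symm : Equiv.Perm (Fin 3)) s))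
      - outer (s := 2) (r := 1) (g.comp y) (N y) (fun s => (![c, a, b] : Fin 3 → Fin n)
        ((Equiv.swap 0 1 : Equiv.Perm (Fin 3)) s))
    simp only [r1, Finset.sum_apply, Pi.smul_apply, smul_eq_mul]
    rw [r2, r3]
    refine congrArg₂ HSub.hSub (congrArg₂ HAdd.hAdd ?_ rfl) rfl
    simp only [g.riemann_eq, Finset.sum_mul]
    rw [Finset.sum_comm]
    refine Finset.sum_congr rfl fun p _ => Finset.sum_congr rfl fun q _ => ?_
    rw [g.upper_symm]
    rfl
  have ho : ins d (g.nabla (outerF (s := 2) (r := 1) g.comp N) x)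
      = outer (s := 2) (r := 1) (g.comp x) (ins d (g.nabla N x)) := by
    refine (nabla_outerF (g := g) (s := 2) (S := g.comp) (g.smooth x) hNs d).trans ?_
    rw [nabla_comp]
    refine (congrArg (fun t : Tensor n 3 => HAdd.hAdd (γ := Tensor n 3) t
      (outer (s := 2) (r := 1) (g.comp x) (ins d (g.nabla N x))))
      (outer_zero_left (s := 2) (N x))).trans ?_
    exact zero_add _
  have hc : ins d (g.nabla (contrF g (s := 3) (r := 0) (permF (finRotate 4) g.curv) σ) x)
      ![c, a, b] = ∑ p, ∑ q, g.upper x p q * g.nabla g.curv x ![d, a, b, p, c] * σ x ![q]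
        + ∑ p, ∑ q, g.upper x p q * g.riemannLower x a b p c * g.nabla σ x ![d, q] := by
    refine (congrFun (nabla_contrF (g := g) (s := 3) (r := 0) hRs (hσs x) d) ![c, a, b]).trans ?_
    refine congrArg₂ (fun s t : ℝ => s + t) ?_ ?_
    · show (∑ p, ∑ q, (g.upper x p q * g.nabla (permF (finRotate 4) g.curv) x
        (cons d ![c, a, b, p])) • ins q (σ x)) ![] = _
      simp only [nabla_permF _ (g.smoothIn_curv x), r1, Finset.sum_apply, Pi.smul_apply,
        smul_eq_mul]
      rfl
    · show (∑ p, ∑ q, (g.upper x p q * g.curv x (fun s => (![c, a, b, p] : Fin 4 → Fin n)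
        ((finRotate 4 : Equiv.Perm (Fin 4)) s))) • ins q (ins d (g.nabla σ x))) ![] = _
      simp only [r1, Finset.sum_apply, Pi.smul_apply, smul_eq_mul]
      rfl
  have h1 := nabla_permF (g := g) (x := x) (r := 3) (finRotate 3).symm hos d ![c, a, b]
  have h2 := nabla_permF (g := g) (x := x) (r := 3) (Equiv.swap 0 1) hos d ![c, a, b]
  rw [r2] at h1
  rw [r3] at h2
  have h1' := h1.trans (congrFun ho ![b, c, a])
  have h2' := h2.trans (congrFun ho ![a, c, b])
  rw [hE, nabla_sub (smoothIn_add hcs (smoothIn_permF _ hos)) (smoothIn_permF _ hos),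
    nabla_add hcs (smoothIn_permF _ hos)]
  exact congrArg₂ HSub.hSub (congrArg₂ HAdd.hAdd hc h1') h2'

end

end Metric

end DegreeOne

/-! ### Degree one: the contracted Ricci identity for `μ`. -/

section DegreeOne

lemma sum_comm_pairs {ι : Type*} [Fintype ι] (F : ι → ι → ι → ι → ℝ) :
    ∑ d, ∑ a, ∑ p, ∑ q, F d a p q = ∑ p, ∑ q, ∑ d, ∑ a, F d a p q := by
  calc _ = ∑ d, ∑ p, ∑ a, ∑ q, F d a p q := Finset.sum_congr rfl fun d _ => Finset.sum_comm
    _ = ∑ p, ∑ d, ∑ a, ∑ q, F d a p q := Finset.sum_comm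
    _ = ∑ p, ∑ d, ∑ q, ∑ a, F d a p q := Finset.sum_congr rfl fun p _ =>
      Finset.sum_congr rfl fun d _ => Finset.sum_comm
    _ = _ := Finset.sum_congr rfl fun p _ => Finset.sum_comm

variable {n : ℕ} {M : Type*} [TopologicalSpace M] [ChartedSpace (Coord n) M]
  [IsManifold (𝓡 n) ∞ M] {g : Metric n M} {x : M}

namespace Metric

lemma sum_upper_lower_mul (c : Fin n) (X : Fin n → ℝ) :
    ∑ d, ∑ a, g.upper x d a * (g.lower x a c * X d) = X c := by
  simp only [← mul_assoc, ← Finset.sum_mul, g.sum_upper_lower]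
  simp

lemma sum_upper_mul_swap (F : Fin n → Fin n → ℝ) :
    ∑ d, ∑ a, g.upper x d a * F d a = ∑ d, ∑ a, g.upper x d a * F a d := by
  rw [Finset.sum_comm]
  exact Finset.sum_congr rfl fun a _ => Finset.sum_congr rfl fun d _ => by rw [g.upper_symm x a d]

lemma nabla_ricciF_symm (c p b : Fin n) :
    g.nabla g.ricciF x ![c, p, b] = g.nabla g.ricciF x ![c, b, p] := by
  have h : g.ricciF = permF (Equiv.swap 0 1) g.ricciF := by
    funext y i
    exact g.ricci_symm y (i 0) (i 1)
  conv_lhs => rw [h]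
  refine (nabla_permF (Equiv.swap 0 1) smoothIn_ricciF c ![p, b]).trans ?_
  rw [show (fun s => (![p, b] : Fin 2 → Fin n) ((Equiv.swap 0 1 : Equiv.Perm (Fin 2)) s))
    = ![b, p] by funext s; fin_cases s <;> rfl]

section

variable {σ : TensorField n M 1} {μ : TensorField n M 2} {ν : TensorField n M 0}

/-- The contracted Ricci identity for `μ` in degree one. -/
lemma contracted_ricci_mu (hσs : ∀ y, SmoothIn y σ) (hμ : ∀ y, IsAlt (μ y))
    (hμs : ∀ y, SmoothIn y μ) (hνs : ∀ y, SmoothIn y ν) (h : g.nabla σ = g.sigmaRHS μ ν)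
    (c b : Fin n) :
    ((n : ℝ) - 2) * g.nabla (g.nabla ν) x ![c, b]
      + g.lower x c b * ∑ d, ∑ a, g.upper x d a * g.nabla (g.nabla ν) x ![d, a]
      + ∑ p, ∑ q, g.upper x p q * (g.nabla g.ricciF x ![p, c, b] * σ x ![q])
      + ∑ p, ∑ q, g.upper x p q * (g.ricci x b p * μ x ![c, q])
      - ∑ p, ∑ q, g.upper x p q * (g.ricci x c q * μ x ![p, b])
      + 2 * g.ricci x c b * ν x ![] = 0 := by
  have hE : ∀ d a, g.nabla (g.nabla μ) x ![d, c, a, b] - g.nabla (g.nabla μ) x ![c, d, a, b]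
      = -(∑ p, g.riemann x d c p a * μ x ![p, b] + ∑ p, g.riemann x d c p b * μ x ![a, p]) :=
    fun d a => by
      have h1 := g.ricci_identity (hμs x) d c ![a, b]
      rw [act_two] at h1
      exact h1
  have hS : ∀ c d, g.nabla σ x ![c, d] = μ x ![c, d] + g.lower x c d * ν x ![] :=
    nabla_sigma_apply h x
  have hμ2 : ∀ a b, μ x ![a, b] = -μ x ![b, a] := fun a b => (hμ x).2 a b ![]
  simp only [nabla_nabla_mu_apply hσs hμ hμs hνs h] at hE
  -- The identity `hE` is traced over `d` and `a`: the `A` terms come from `∇_d ∇_c μ`, the `B`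
  -- terms from the opposite order, and the `C` terms from the curvature acting on `μ`. The
  -- contracted second Bianchi identity produces two derivatives of the Ricci tensor here, one of
  -- which is cancelled by `B1`.
  have A1 : ∑ d, ∑ a, g.upper x d a *
      ∑ p, ∑ q, g.upper x p q * g.nabla g.curv x ![d, a, b, p, c] * σ x ![q]
      = ∑ p, ∑ q, g.upper x p q * (g.nabla g.ricciF x ![p, c, b] * σ x ![q])
        - ∑ p, ∑ q, g.upper x p q * (g.nabla g.ricciF x ![c, p, b] * σ x ![q]) := by
    simp only [Finset.mul_sum]
    rw [sum_comm_pairs]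
    simp only [← Finset.sum_sub_distrib]
    refine Finset.sum_congr rfl fun p _ => Finset.sum_congr rfl fun q _ => ?_
    rw [← mul_sub, ← sub_mul, ← sum_nabla_curv p c b]
    simp only [Finset.sum_mul, Finset.mul_sum]
    refine Finset.sum_congr rfl fun d _ => Finset.sum_congr rfl fun a _ => ?_
    rw [nabla_curv_pair d a b p c]
    ring
  have A2 : ∑ d, ∑ a, g.upper x d a *
      ∑ p, ∑ q, g.upper x p q * g.riemannLower x a b p c * g.nabla σ x ![d, q]
      = (∑ d, ∑ a, ∑ p, ∑ q, g.upper x d a * g.upper x p q * g.riemannLower x a b p c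
          * μ x ![d, q]) + g.ricci x c b * ν x ![] := by
    have e : g.ricci x c b * ν x ![] = ∑ d, ∑ a, g.upper x d a * ∑ p, ∑ q, g.upper x p q *
        (g.lower x q d * (g.riemannLower x a b p c * ν x ![])) := by
      simp only [fun d a => sum_upper_lower_mul (g := g) (x := x) d
        fun p => g.riemannLower x a b p c * ν x ![]]
      rw [g.ricci_symm, g.ricci_eq, sum_upper_mul_swap]
      simp only [Finset.sum_mul, mul_assoc]
    rw [e]
    simp only [Finset.mul_sum, ← Finset.sum_add_distrib]
    refine Finset.sum_congr rfl fun d _ => Finset.sum_congr rfl fun a _ =>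
      Finset.sum_congr rfl fun p _ => Finset.sum_congr rfl fun q _ => ?_
    rw [hS, g.lower_symm x d q]
    ring
  have A3 : ∑ d, ∑ a, g.upper x d a * (g.lower x b c * g.nabla (g.nabla ν) x ![d, a])
      = g.lower x c b * ∑ d, ∑ a, g.upper x d a * g.nabla (g.nabla ν) x ![d, a] := by
    simp only [Finset.mul_sum]
    refine Finset.sum_congr rfl fun d _ => Finset.sum_congr rfl fun a _ => ?_
    rw [g.lower_symm x b c]
    ring
  have A4 := sum_upper_lower_mul (g := g) (x := x) c fun d => g.nabla (g.nabla ν) x ![d, b]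
  have B1 : ∑ d, ∑ a, g.upper x d a *
      ∑ p, ∑ q, g.upper x p q * g.nabla g.curv x ![c, a, b, p, d] * σ x ![q]
      = -∑ p, ∑ q, g.upper x p q * (g.nabla g.ricciF x ![c, p, b] * σ x ![q]) := by
    simp only [Finset.mul_sum]
    rw [sum_comm_pairs]
    simp only [← Finset.sum_neg_distrib]
    refine Finset.sum_congr rfl fun p _ => Finset.sum_congr rfl fun q _ => ?_
    rw [nabla_ricciF_symm, nabla_ricciF c b p, sum_upper_mul_swap]
    simp only [Finset.sum_mul, Finset.mul_sum, ← Finset.sum_neg_distrib]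
    refine Finset.sum_congr rfl fun d _ => Finset.sum_congr rfl fun a _ => ?_
    rw [nabla_curv_antisymm' c d b p a]
    ring
  have B2 : ∑ d, ∑ a, g.upper x d a *
      ∑ p, ∑ q, g.upper x p q * g.riemannLower x a b p d * g.nabla σ x ![c, q]
      = -(∑ p, ∑ q, g.upper x p q * (g.ricci x b p * μ x ![c, q])) - g.ricci x c b * ν x ![] := by
    have e : g.ricci x c b * ν x ![]
        = ∑ p, ∑ q, g.upper x p q * (g.lower x q c * (g.ricci x b p * ν x ![])) := by
      rw [sum_upper_lower_mul c fun p => g.ricci x b p * ν x ![], g.ricci_symm]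
    simp only [Finset.mul_sum]
    rw [sum_comm_pairs, e]
    simp only [← Finset.sum_neg_distrib, ← Finset.sum_sub_distrib]
    refine Finset.sum_congr rfl fun p _ => Finset.sum_congr rfl fun q _ => ?_
    rw [g.ricci_eq, sum_upper_mul_swap, hS, g.lower_symm x q c]
    simp only [Finset.sum_mul, Finset.mul_sum, ← Finset.sum_neg_distrib, ← Finset.sum_sub_distrib]
    refine Finset.sum_congr rfl fun d _ => Finset.sum_congr rfl fun a _ => ?_
    rw [g.riemannLower_antisymm' x d b p a]
    ring
  have B3 : ∑ d, ∑ a, g.upper x d a * (g.lower x b d * g.nabla (g.nabla ν) x ![c, a])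
      = g.nabla (g.nabla ν) x ![c, b] := by
    rw [sum_upper_mul_swap]
    simp only [g.lower_symm x b]
    exact sum_upper_lower_mul b fun d => g.nabla (g.nabla ν) x ![c, d]
  have B4 : ∑ d, ∑ a, g.upper x d a * (g.lower x a d * g.nabla (g.nabla ν) x ![c, b])
      = n * g.nabla (g.nabla ν) x ![c, b] := by
    rw [← g.sum_upper_mul_lower (x := x)]
    simp only [Finset.sum_mul]
    refine Finset.sum_congr rfl fun d _ => Finset.sum_congr rfl fun a _ => ?_
    rw [g.lower_symm x a d]
    ring
  have C1 : ∑ d, ∑ a, g.upper x d a * ∑ p, g.riemann x d c p a * μ x ![p, b]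
      = -∑ p, ∑ q, g.upper x p q * (g.ricci x c q * μ x ![p, b]) := by
    simp only [g.riemann_eq, Finset.mul_sum, Finset.sum_mul]
    rw [sum_comm_pairs]
    simp only [← Finset.sum_neg_distrib]
    refine Finset.sum_congr rfl fun p _ => Finset.sum_congr rfl fun q _ => ?_
    rw [g.ricci_eq]
    simp only [Finset.sum_mul, Finset.mul_sum, ← Finset.sum_neg_distrib]
    refine Finset.sum_congr rfl fun d _ => Finset.sum_congr rfl fun a _ => ?_
    rw [g.riemannLower_antisymm' x d c q a]
    ring
  -- Pair symmetry of the curvature and skewness of `μ` turn this into the full contraction of the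
  -- curvature with `μ` in `A2`, so that the two cancel and only Ricci terms survive.
  have C2 : ∑ d, ∑ a, g.upper x d a * ∑ p, g.riemann x d c p b * μ x ![a, p]
      = -∑ d, ∑ a, ∑ p, ∑ q, g.upper x d a * g.upper x p q * g.riemannLower x a b p c
          * μ x ![d, q] := by
    have e : ∑ d, ∑ a, ∑ p, ∑ q, g.upper x d a * g.upper x p q * g.riemannLower x a b p c
          * μ x ![d, q] = ∑ d, ∑ a, ∑ p, ∑ q, g.upper x d a * g.upper x p q *
            g.riemannLower x q b d c * μ x ![p, a] := by
      rw [sum_comm_pairs]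
      refine Finset.sum_congr rfl fun d _ => Finset.sum_congr rfl fun a _ =>
        Finset.sum_congr rfl fun p _ => Finset.sum_congr rfl fun q _ => by ring
    rw [e]
    simp only [g.riemann_eq, Finset.mul_sum, Finset.sum_mul, ← Finset.sum_neg_distrib]
    refine Finset.sum_congr rfl fun d _ => Finset.sum_congr rfl fun a _ =>
      Finset.sum_congr rfl fun p _ => Finset.sum_congr rfl fun q _ => ?_
    rw [g.riemannLower_pair x q b d c, hμ2 p a]
    ring
  have hT := Finset.sum_congr (rfl : (Finset.univ : Finset (Fin n)) = Finset.univ)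
    fun d _ => Finset.sum_congr (rfl : (Finset.univ : Finset (Fin n)) = Finset.univ)
      fun a _ => congrArg (fun t => g.upper x d a * t) (hE d a)
  simp only [mul_add, mul_sub, mul_neg, Finset.sum_add_distrib, Finset.sum_sub_distrib,
    Finset.sum_neg_distrib] at hT
  rw [A1, A2, A3, A4, B1, B2, B3, B4, C1, C2] at hT
  linarith

end

end Metric

end DegreeOne

/-! ### Degree one: the second derivative of `ν` and the equation for `∇ρ`. -/

section DegreeOne

variable {n : ℕ} {M : Type*} [TopologicalSpace M] [ChartedSpace (Coord n) M]
  [IsManifold (𝓡 n) ∞ M] {g : Metric n M} {x : M}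

namespace Metric

/-- The trace `J` of the Schouten tensor, as a tensor field. -/
def traceSchoutenF (g : Metric n M) : TensorField n M 0 := g.trace g.schoutenF

lemma nabla_ricciF_eq (hn : 3 ≤ n) (p c b : Fin n) : g.nabla g.ricciF x ![p, c, b]
    = ((n : ℝ) - 2) * g.nabla g.schoutenF x ![p, c, b]
      + g.lower x c b * g.nabla g.traceSchoutenF x ![p] := by
  have hJ : SmoothIn x g.traceSchoutenF := smoothIn_trace (r := 0) smoothIn_schoutenF
  have ho : SmoothIn x (outerF (s := 2) g.comp g.traceSchoutenF) := smoothIn_outerF (g.smooth x) hJ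
  have h0 : g.ricciF = ((n : ℝ) - 2) • g.schoutenF + outerF (s := 2) g.comp g.traceSchoutenF := by
    funext y i
    refine (g.ricci_eq_schouten hn (i 0) (i 1)).trans ?_
    rw [← g.sum_upper_mul_schouten hn, mul_comm _ (g.lower y _ _)]
    rfl
  have h1 : ins p (g.nabla (outerF (s := 2) g.comp g.traceSchoutenF) x)
      = outer (s := 2) (g.comp x) (ins p (g.nabla g.traceSchoutenF x)) := by
    refine (nabla_outerF (g := g) (s := 2) (S := g.comp) (g.smooth x) hJ p).trans ?_
    rw [nabla_comp]
    refine (congrArg (fun t => t + _) (outer_zero_left (s := 2) (g.traceSchoutenF x))).trans ?_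
    exact zero_add _
  rw [h0, nabla_add (smoothIn_smul _ smoothIn_schoutenF) ho, nabla_smul _ smoothIn_schoutenF]
  exact congrArg (fun t => ((n : ℝ) - 2) * g.nabla g.schoutenF x ![p, c, b] + t)
    (congrFun h1 ![c, b])

lemma sum_upper_mul_nabla_schoutenF (p : Fin n) :
    ∑ c, ∑ b, g.upper x c b * g.nabla g.schoutenF x ![p, c, b]
      = g.nabla g.traceSchoutenF x ![p] := by
  refine Eq.trans ?_ (congrFun (nabla_trace (g := g) (r := 0) (x := x)
    smoothIn_schoutenF p) ![]).symm
  simp only [traceWith, Finset.sum_apply, Pi.smul_apply, smul_eq_mul]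
  rfl

lemma nabla_schoutenF_symm (c p b : Fin n) :
    g.nabla g.schoutenF x ![c, p, b] = g.nabla g.schoutenF x ![c, b, p] := by
  have h : g.schoutenF = permF (Equiv.swap 0 1) g.schoutenF := by
    funext y i
    exact g.schouten_symm y (i 0) (i 1)
  conv_lhs => rw [h]
  refine (nabla_permF (Equiv.swap 0 1) smoothIn_schoutenF c ![p, b]).trans ?_
  rw [show (fun s => (![p, b] : Fin 2 → Fin n) ((Equiv.swap 0 1 : Equiv.Perm (Fin 2)) s))
    = ![b, p] by funext s; fin_cases s <;> rfl]

section

variable {σ ρ : TensorField n M 1} {μ : TensorField n M 2} {ν : TensorField n M 0}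

/-- The second derivative of `ν` in degree one. -/
lemma nabla_nabla_nu_apply (hn : 3 ≤ n) (hσs : ∀ y, SmoothIn y σ) (hμ : ∀ y, IsAlt (μ y))
    (hμs : ∀ y, SmoothIn y μ) (hνs : ∀ y, SmoothIn y ν) (h : g.nabla σ = g.sigmaRHS μ ν)
    (c b : Fin n) :
    g.nabla (g.nabla ν) x ![c, b]
      + ∑ p, ∑ q, g.upper x p q * (g.nabla g.schoutenF x ![p, c, b] * σ x ![q])
      + (∑ p, ∑ q, g.upper x p q * (g.schouten x b p * μ x ![c, q])
        - ∑ p, ∑ q, g.upper x p q * (g.schouten x c q * μ x ![p, b]))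
      + 2 * g.schouten x c b * ν x ![] = 0 := by
  have h3 : (3 : ℝ) ≤ n := by exact_mod_cast hn
  have hμ2 : ∀ a b, μ x ![a, b] = -μ x ![b, a] := fun a b => (hμ x).2 a b ![]
  set t := ∑ d, ∑ a, g.upper x d a * g.nabla (g.nabla ν) x ![d, a] with ht
  set w := t + ∑ p, ∑ q, g.upper x p q * (g.nabla g.traceSchoutenF x ![p] * σ x ![q])
    + 2 * g.traceSchouten x * ν x ![] with hw
  set Z : Fin n → Fin n → ℝ := fun c b => g.nabla (g.nabla ν) x ![c, b]
      + ∑ p, ∑ q, g.upper x p q * (g.nabla g.schoutenF x ![p, c, b] * σ x ![q])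
      + (∑ p, ∑ q, g.upper x p q * (g.schouten x b p * μ x ![c, q])
        - ∑ p, ∑ q, g.upper x p q * (g.schouten x c q * μ x ![p, b]))
      + 2 * g.schouten x c b * ν x ![] with hZ
  -- Substituting `Ric = (n - 2) P + J g` in the contracted Ricci identity: the two terms `J μ`
  -- cancel, the coefficients of the metric collect into `w`, and everything else carries the factor
  -- `n - 2`.
  have h1 : ∀ c b, ((n : ℝ) - 2) * Z c b + g.lower x c b * w = 0 := fun c b => by
    have hc := contracted_ricci_mu (g := g) (x := x) hσs hμ hμs hνs h c b
    have e1 : ∑ p, ∑ q, g.upper x p q * (g.nabla g.ricciF x ![p, c, b] * σ x ![q])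
        = ((n : ℝ) - 2) * ∑ p, ∑ q, g.upper x p q * (g.nabla g.schoutenF x ![p, c, b] * σ x ![q])
          + g.lower x c b *
            ∑ p, ∑ q, g.upper x p q * (g.nabla g.traceSchoutenF x ![p] * σ x ![q]) := by
      simp only [nabla_ricciF_eq hn, Finset.mul_sum, ← Finset.sum_add_distrib]
      exact Finset.sum_congr rfl fun p _ => Finset.sum_congr rfl fun q _ => by ring
    have e2 : ∑ p, ∑ q, g.upper x p q * (g.ricci x b p * μ x ![c, q])
        = ((n : ℝ) - 2) * ∑ p, ∑ q, g.upper x p q * (g.schouten x b p * μ x ![c, q])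
          + g.traceSchouten x * μ x ![c, b] := by
      have e : ∑ p, ∑ q, g.upper x p q * (g.lower x q b * μ x ![c, p]) = μ x ![c, b] :=
        sum_upper_lower_mul b fun p => μ x ![c, p]
      rw [sum_upper_mul_swap] at e
      rw [← e]
      simp only [g.ricci_eq_schouten hn, Finset.mul_sum, ← Finset.sum_add_distrib]
      refine Finset.sum_congr rfl fun p _ => Finset.sum_congr rfl fun q _ => ?_
      rw [g.lower_symm x p b]
      ring
    have e3 : ∑ p, ∑ q, g.upper x p q * (g.ricci x c q * μ x ![p, b])
        = ((n : ℝ) - 2) * ∑ p, ∑ q, g.upper x p q * (g.schouten x c q * μ x ![p, b])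
          + g.traceSchouten x * μ x ![c, b] := by
      have e : ∑ p, ∑ q, g.upper x p q * (g.lower x q c * μ x ![p, b]) = μ x ![c, b] :=
        sum_upper_lower_mul c fun p => μ x ![p, b]
      rw [← e]
      simp only [g.ricci_eq_schouten hn, Finset.mul_sum, ← Finset.sum_add_distrib]
      refine Finset.sum_congr rfl fun p _ => Finset.sum_congr rfl fun q _ => ?_
      rw [g.lower_symm x q c]
      ring
    rw [e1, e2, e3, g.ricci_eq_schouten hn] at hc
    simp only [hZ, hw]
    linarith
  have h2 : ∑ c, ∑ b, g.upper x c b * Z c b = w := by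
    have z1 : ∑ c, ∑ b, g.upper x c b *
        ∑ p, ∑ q, g.upper x p q * (g.nabla g.schoutenF x ![p, c, b] * σ x ![q])
        = ∑ p, ∑ q, g.upper x p q * (g.nabla g.traceSchoutenF x ![p] * σ x ![q]) := by
      simp only [← sum_upper_mul_nabla_schoutenF, Finset.mul_sum, Finset.sum_mul]
      rw [sum_comm_pairs]
      exact Finset.sum_congr rfl fun p _ => Finset.sum_congr rfl fun q _ =>
        Finset.sum_congr rfl fun c _ => Finset.sum_congr rfl fun b _ => by ring
    -- A full contraction of the symmetric tensor `P` with the skew tensor `μ` equals its own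
    -- negative.
    have z2 : ∑ c, ∑ b, g.upper x c b *
        ∑ p, ∑ q, g.upper x p q * (g.schouten x b p * μ x ![c, q])
        = -∑ c, ∑ b, g.upper x c b *
          ∑ p, ∑ q, g.upper x p q * (g.schouten x b p * μ x ![c, q]) := by
      conv_lhs =>
        rw [sum_upper_mul_swap]
        simp only [fun c b => sum_upper_mul_swap (g := g) (x := x)
          fun p q => g.schouten x c p * μ x ![b, q]]
        simp only [Finset.mul_sum]
        rw [sum_comm_pairs]
      simp only [Finset.mul_sum, ← Finset.sum_neg_distrib]
      refine Finset.sum_congr rfl fun c _ => Finset.sum_congr rfl fun b _ =>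
        Finset.sum_congr rfl fun p _ => Finset.sum_congr rfl fun q _ => ?_
      rw [hμ2 q c, g.schouten_symm x p b]
      ring
    have z3 : ∑ c, ∑ b, g.upper x c b *
        ∑ p, ∑ q, g.upper x p q * (g.schouten x c q * μ x ![p, b])
        = -∑ c, ∑ b, g.upper x c b *
          ∑ p, ∑ q, g.upper x p q * (g.schouten x b p * μ x ![c, q]) := by
      conv_lhs =>
        rw [sum_upper_mul_swap]
        simp only [fun c b => sum_upper_mul_swap (g := g) (x := x)
          fun p q => g.schouten x b q * μ x ![p, c]]
      simp only [Finset.mul_sum, ← Finset.sum_neg_distrib]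
      refine Finset.sum_congr rfl fun c _ => Finset.sum_congr rfl fun b _ =>
        Finset.sum_congr rfl fun p _ => Finset.sum_congr rfl fun q _ => ?_
      rw [hμ2 q c]
      ring
    have z4 : ∑ c, ∑ b, g.upper x c b * (2 * g.schouten x c b * ν x ![])
        = 2 * g.traceSchouten x * ν x ![] := by
      rw [← g.sum_upper_mul_schouten hn]
      simp only [Finset.mul_sum, Finset.sum_mul]
      exact Finset.sum_congr rfl fun c _ => Finset.sum_congr rfl fun b _ => by ring
    simp only [hZ, mul_add, mul_sub, Finset.sum_add_distrib, Finset.sum_sub_distrib]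
    rw [z1, z3, z4, ← ht, hw]
    linarith
  -- Since `w` is also the trace of `Z`, tracing `h1` gives `(2n - 2) w = 0`; then `h1` itself gives
  -- `Z = 0` because `n ≥ 3`.
  have h4 : ((n : ℝ) - 2) * w + n * w = 0 := by
    have e : ∑ c, ∑ b, g.upper x c b * (((n : ℝ) - 2) * Z c b + g.lower x c b * w)
        = ((n : ℝ) - 2) * (∑ c, ∑ b, g.upper x c b * Z c b)
          + (∑ c, ∑ b, g.upper x c b * g.lower x c b) * w := by
      simp only [Finset.mul_sum, Finset.sum_mul, ← Finset.sum_add_distrib]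
      exact Finset.sum_congr rfl fun c _ => Finset.sum_congr rfl fun b _ => by ring
    rw [h2, g.sum_upper_mul_lower] at e
    rw [← e]
    simp only [h1, mul_zero, Finset.sum_const_zero]
  have h5 : w = 0 := by
    have : (2 * (n : ℝ) - 2) * w = 0 := by linarith
    exact (mul_eq_zero.mp this).resolve_left (by linarith)
  have h6 := h1 c b
  rw [h5, mul_zero, add_zero] at h6
  exact (mul_eq_zero.mp h6).resolve_left (by linarith)

/-- The equation for `∇ρ` in degree one. -/
lemma nabla_rho_of_degree_one (hn : 3 ≤ n) (hσs : ∀ y, SmoothIn y σ) (hμ : ∀ y, IsAlt (μ y))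
    (hμs : ∀ y, SmoothIn y μ) (hνs : ∀ y, SmoothIn y ν) (h : g.nabla σ = g.sigmaRHS μ ν)
    (hν : g.nabla ν = g.nuRHS σ ρ) : g.nabla ρ = g.rhoRHS 0 σ μ ν := by
  funext x
  -- In degree one the Weyl term is absent, so the equation for `∇ν` can be solved for `ρ` and
  -- differentiated.
  have hρ : ρ = (-1 : ℝ) • (g.nabla ν + contrF g (s := 1) (r := 0) g.schoutenF σ) := by
    rw [hν, nuRHS_eq]
    funext y i
    show ρ y i = -1 * (-(((0 : ℕ) : ℝ) + 1) * (ρ y i + contrF g (s := 1) (r := 0) g.schoutenF σ y i)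
      + _ * 0 + contrF g (s := 1) (r := 0) g.schoutenF σ y i)
    push_cast
    ring
  have hc : SmoothIn x (contrF g (s := 1) (r := 0) g.schoutenF σ) :=
    smoothIn_contrF smoothIn_schoutenF (hσs x)
  have hN : SmoothIn x (g.nabla ν) := g.smoothIn_nabla (hνs x)
  refine tensor_ext_ins fun c => tensor_ext_ins fun b => ?_
  funext i
  have hi : i = ![] := Subsingleton.elim _ _
  subst hi
  show g.nabla ρ x ![c, b] = g.rhoRHS 0 σ μ ν x ![c, b]
  have e1 : g.nabla (contrF g (s := 1) (r := 0) g.schoutenF σ) x ![c, b]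
      = ∑ p, ∑ q, g.upper x p q * (g.nabla g.schoutenF x ![c, p, b] * σ x ![q])
        + ∑ p, ∑ q, g.upper x p q * (g.schouten x b p * g.nabla σ x ![c, q]) := by
    refine (congrFun (nabla_contrF (g := g) (s := 1) (r := 0) smoothIn_schoutenF (hσs x) c)
      ![b]).trans ?_
    refine congrArg₂ (fun s t : ℝ => s + t) ?_ ?_
    · show (∑ p, ∑ q, (g.upper x p q * g.nabla g.schoutenF x ![c, b, p]) • ins q (σ x)) ![] = _
      simp only [Finset.sum_apply, Pi.smul_apply, smul_eq_mul, mul_assoc,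
        nabla_schoutenF_symm c b]
      rfl
    · show (∑ p, ∑ q, (g.upper x p q * g.schouten x b p) • ins q (ins c (g.nabla σ x))) ![] = _
      simp only [Finset.sum_apply, Pi.smul_apply, smul_eq_mul, mul_assoc]
      rfl
  have e2 : g.nabla ρ x ![c, b] = -1 * (g.nabla (g.nabla ν) x ![c, b]
      + g.nabla (contrF g (s := 1) (r := 0) g.schoutenF σ) x ![c, b]) := by
    conv_lhs => rw [hρ, nabla_smul _ (smoothIn_add hN hc), nabla_add hN hc]
    rfl
  have e3 : ∑ p, ∑ q, g.upper x p q * (g.schouten x b p * g.nabla σ x ![c, q])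
      = ∑ p, ∑ q, g.upper x p q * (g.schouten x b p * μ x ![c, q])
        + g.schouten x c b * ν x ![] := by
    have e : g.schouten x c b * ν x ![]
        = ∑ p, ∑ q, g.upper x p q * (g.lower x q c * (g.schouten x b p * ν x ![])) := by
      rw [sum_upper_lower_mul c fun p => g.schouten x b p * ν x ![], g.schouten_symm]
    rw [e]
    simp only [← Finset.sum_add_distrib]
    refine Finset.sum_congr rfl fun p _ => Finset.sum_congr rfl fun q _ => ?_
    rw [nabla_sigma_apply h, g.lower_symm x c q]
    ring
  have e4 : g.rhoRHS 0 σ μ ν x ![c, b] = g.schouten x c b * ν x ![]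
      - ∑ p, ∑ q, g.upper x p q * (g.schouten x c q * μ x ![p, b])
      + (∑ p, ∑ q, g.upper x p q * (g.nabla g.schoutenF x ![p, c, b] * σ x ![q])
        - ∑ p, ∑ q, g.upper x p q * (g.nabla g.schoutenF x ![c, p, b] * σ x ![q])) := by
    have f1 : ∑ p, g.schoutenUp x c p * μ x ![p, b]
        = ∑ p, ∑ q, g.upper x p q * (g.schouten x c q * μ x ![p, b]) := by
      simp only [schoutenUp, Finset.sum_mul]
      refine Finset.sum_congr rfl fun p _ => Finset.sum_congr rfl fun q _ => ?_
      rw [g.upper_symm x q p]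
      ring
    have f2 : ∑ p, ∑ q, g.cotton x b p c * g.upper x p q * σ x ![q]
        = ∑ p, ∑ q, g.upper x p q * (g.nabla g.schoutenF x ![p, c, b] * σ x ![q])
        - ∑ p, ∑ q, g.upper x p q * (g.nabla g.schoutenF x ![c, p, b] * σ x ![q]) := by
      simp only [← Finset.sum_sub_distrib]
      refine Finset.sum_congr rfl fun p _ => Finset.sum_congr rfl fun q _ => ?_
      show (g.nabla g.schoutenF x ![p, c, b] - g.nabla g.schoutenF x ![c, p, b]) * _ * _ = _
      ring
    rw [← f1, ← f2]
    rfl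
  have e5 := nabla_nabla_nu_apply (g := g) (x := x) hn hσs hμ hμs hνs h c b
  rw [e2, e1, e3, e4]
  linarith

end

end Metric

end DegreeOne

/-! ## The prolonged system in a scale -/

section Scale

variable {n m : ℕ} {M : Type*} [TopologicalSpace M] [ChartedSpace (Coord n) M]
  [IsManifold (𝓡 n) ∞ M] {g : Metric n M}

namespace Metric

lemma nabla_rhoOf (hn : 3 ≤ n) : ∀ {m : ℕ}, m + 1 ≤ n - 1 → ∀ {σ : TensorField n M (m + 1)},
    (∀ y, IsAlt (σ y)) → (∀ y, SmoothIn y σ) → g.IsConformalKilling σ →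
    g.nabla (g.rhoOf σ) = g.rhoRHS m σ (g.muOf σ) (g.nuOf σ)
  | 0, hk, σ, hσ, hσs, h => nabla_rho_of_degree_one hn hσs (isAlt_muOf σ)
      (fun y => smoothIn_muOf (hσs y)) (fun y => smoothIn_nuOf (hσs y))
      (isConformalKilling_iff.1 h) (nabla_nuOf hn hk hσ hσs h)
  | _ + 1, hk, _, hσ, hσs, h => nabla_rhoOf_of_two_le hn hk hσ hσs h

/-- A conformal Killing form gives rise to a solution of the prolonged system. -/
lemma IsConformalKilling.isProlongedSolution (hn : 3 ≤ n) (hk : m + 1 ≤ n - 1)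
    {σ : TensorField n M (m + 1)} (h : g.IsConformalKilling σ) (hσ : ∀ y, IsAlt (σ y))
    (hσs : ∀ y, SmoothIn y σ) :
    g.IsProlongedSolution σ (g.muOf σ) (g.nuOf σ) (g.rhoOf σ) :=
  ⟨isConformalKilling_iff.1 h, nabla_muOf hn hk hσ hσs h, nabla_nuOf hn hk hσ hσs h,
    nabla_rhoOf hn hk hσ hσs h⟩

/-- A solution of the prolonged system comes from a conformal Killing form. -/
lemma IsProlongedSolution.isConformalKilling (hk : m + 1 ≤ n - 1)
    {σ ρ : TensorField n M (m + 1)} {μ : TensorField n M (m + 2)} {ν : TensorField n M m}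
    (h : g.IsProlongedSolution σ μ ν ρ) (hσ : ∀ y, IsAlt (σ y)) (hσs : ∀ y, SmoothIn y σ)
    (hμ : ∀ y, IsAlt (μ y)) (hν : ∀ y, IsAlt (ν y)) : g.IsConformalKilling σ := by
  rw [isConformalKilling_iff, eq_muOf hμ h.1, eq_nuOf hk hσ hσs hμ hν h.1]
  exact h.1

end Metric

end Scale

/-! ## Weighted forms -/

section Weighted

variable {n k : ℕ}

/-- The `k`-form on `ℝⁿ` with the components `T_{[i₁ … i_k]}`. -/
def altOfTensor (T : Tensor n k) : Coord n [⋀^Fin k]→ₗ[ℝ] ℝ :=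
  ((Nat.factorial k : ℕ) : ℝ)⁻¹ • MultilinearMap.alternatization
    (∑ j : Fin k → Fin n, T j • (MultilinearMap.mkPiAlgebra ℝ (Fin k) ℝ).compLinearMap
      fun s => (EuclideanSpace.proj (𝕜 := ℝ) (j s) : Coord n →L[ℝ] ℝ).toLinearMap)

lemma altOfTensor_apply (T : Tensor n k) (i : Fin k → Fin n) :
    altOfTensor T (fun s => stdVec (i s)) = skew T i := by
  have h : ∀ i' : Fin k → Fin n, ∑ j : Fin k → Fin n,
      T j * ∏ s, (stdVec (i' s) : Coord n) (j s) = T i' := by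
    intro i'
    rw [Finset.sum_eq_single i']
    · simp [stdVec]
    · intro j _ hj
      obtain ⟨s, hs⟩ := Function.ne_iff.1 hj
      rw [Finset.prod_eq_zero (Finset.mem_univ s), mul_zero]
      simp [stdVec, hs]
    · simp
  simp only [altOfTensor, skew, AlternatingMap.smul_apply, MultilinearMap.alternatization_apply,
    smul_eq_mul]
  congr 1
  refine Finset.sum_congr rfl fun π _ => ?_
  rw [← h fun s => i (π s)]
  simp [Units.smul_def]

variable {M : Type*} [TopologicalSpace M] [ChartedSpace (Coord n) M]

/-- The form with given alternating components. -/
def FormField.ofComp (T : TensorField n M k) : FormField n M k := fun x => altOfTensor (T x)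

lemma FormField.comp_ofComp {T : TensorField n M k} (hT : ∀ x, IsAlt (T x)) :
    (FormField.ofComp T).comp = T := by
  funext x i
  exact (altOfTensor_apply (T x) i).trans (congrFun (hT x).skew_eq i)

lemma FormField.isAlt_comp (η : FormField n M k) (x : M) : IsAlt (η.comp x) :=
  isAlt_of_perm fun i π => ((η x).map_perm (fun s => tangentVec x (i s)) π).trans (by
    rw [Units.smul_def, zsmul_eq_mul]
    rfl)

lemma FormField.ext_comp {η θ : FormField n M k} (h : η.comp = θ.comp) : η = θ := by
  funext x
  refine Module.Basis.ext_alternating (EuclideanSpace.basisFun (Fin n) ℝ).toBasis fun v _ => ?_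
  have e : (fun s => (EuclideanSpace.basisFun (Fin n) ℝ).toBasis (v s))
      = fun s => (stdVec (v s) : Coord n) := by
    funext s
    simp [stdVec]
  refine (congrArg (η x) e).trans (Eq.trans ?_ (congrArg (θ x) e).symm)
  exact congrFun (congrFun h x) v

variable [IsManifold (𝓡 n) ∞ M]

namespace Metric

variable {g g' g'' : Metric n M} {Υ Υ' : M → ℝ}

lemma Rescales.refl (g : Metric n M) : Rescales 0 g g :=
  ⟨contMDiff_const, fun x v w => by simp⟩

lemma Rescales.trans (h : Rescales Υ g g') (h' : Rescales Υ' g' g'') :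
    Rescales (fun x => Υ' x + Υ x) g g'' :=
  ⟨h'.1.add h.1, fun x v w => by
    rw [h'.2, h.2, ← mul_assoc, ← Real.exp_add, mul_add]⟩

/-- Nondegeneracy provides two vectors with nonzero scalar product, on which the factors can be
compared. This makes the chosen logarithms of conformal factors additive. -/
lemma Rescales.unique (hn : 0 < n) (h : Rescales Υ g g') (h' : Rescales Υ' g g') : Υ = Υ' := by
  funext x
  obtain ⟨w, hw⟩ : ∃ w, g.val x (tangentVec x ⟨0, hn⟩) w ≠ 0 := by
    by_contra! hc
    have h0 : (stdVec (⟨0, hn⟩ : Fin n) : Coord n) = 0 := g.nondegenerate x _ hc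
    have := congrArg (fun v : Coord n => v ⟨0, hn⟩) h0
    simp [stdVec] at this
  have e := (h.2 x (tangentVec x ⟨0, hn⟩) w).symm.trans (h'.2 x (tangentVec x ⟨0, hn⟩) w)
  have e' := Real.exp_injective (mul_right_cancel₀ hw e)
  linarith

end Metric

lemma IsSmooth.smul {T : TensorField n M k} (hT : IsSmooth T) {f : M → ℝ}
    (hf : ContMDiff (𝓡 n) 𝓘(ℝ, ℝ) ∞ f) : IsSmooth (fun x => f x • T x) := by
  intro x₀ i
  have h1 : ContDiffOn ℝ ∞ (fun u => f ((extChartAt (𝓡 n) x₀).symm u))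
      (extChartAt (𝓡 n) x₀).target :=
    contMDiffOn_iff_contDiffOn.1 (hf.comp_contMDiffOn (contMDiffOn_extChartAt_symm x₀))
  refine (h1.mul (hT x₀ i)).congr fun u _ => ?_
  simp only [inChart, Pi.smul_apply, smul_eq_mul, Finset.mul_sum, mul_assoc]

namespace WeightedForm

variable {c : ConformalStructure n M} {w : ℝ}

lemma isAlt_comp (f : WeightedForm c k w) (g : c.metrics) (x : M) : IsAlt (f.comp g x) :=
  FormField.isAlt_comp _ x

lemma smoothIn_comp (f : WeightedForm c k w) (g : c.metrics) (x : M) : SmoothIn x (f.comp g) :=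
  f.smooth g x

/-- Any two scales of the conformal structure are related by a rescaling, so homogeneity propagates
equality from one scale to all others. -/
lemma ext_comp {f f' : WeightedForm c k w} (g : c.metrics) (h : f.comp g = f'.comp g) : f = f' := by
  ext1
  funext g'
  obtain ⟨Υ, hΥ⟩ := (c.mem_iff g.1 g.2 g'.1).1 g'.2
  funext x
  rw [f.homogeneous g g' Υ hΥ, f'.homogeneous g g' Υ hΥ, FormField.ext_comp h]

/-- The factor relating a metric of the conformal class to a reference metric. -/
def logFactor (g g' : c.metrics) : M → ℝ := ((c.mem_iff g.1 g.2 g'.1).1 g'.2).choose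

lemma rescales_logFactor (g g' : c.metrics) : Metric.Rescales (logFactor g g') g.1 g'.1 :=
  ((c.mem_iff g.1 g.2 g'.1).1 g'.2).choose_spec

/-- The weighted form with given alternating components in the scale `g`. -/
def ofComp (hn : 0 < n) (w : ℝ) (g : c.metrics) (T : TensorField n M k) (hT : ∀ x, IsAlt (T x))
    (hs : ∀ x, SmoothIn x T) : WeightedForm c k w where
  inScale g' x := Real.exp (w * logFactor g g' x) • FormField.ofComp T x
  homogeneous g' g'' Υ hΥ x := by
    -- The rescalings from `g` to `g''` chosen directly and composed through `g'` coincide, which is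
    -- the cocycle condition behind homogeneity.
    rw [((rescales_logFactor g g'').unique hn ((rescales_logFactor g g').trans hΥ)), smul_smul,
      ← Real.exp_add, mul_add]
  smooth g' := by
    have h := IsSmooth.smul (isSmooth_iff.2 hs) (f := fun x => Real.exp (w * logFactor g g' x))
      (Real.contDiff_exp.contMDiff.comp
        (contMDiff_const.mul (rescales_logFactor g g').1))
    rw [← FormField.comp_ofComp hT] at h
    exact h

lemma comp_ofComp (hn : 0 < n) (w : ℝ) (g : c.metrics) (T : TensorField n M k)
    (hT : ∀ x, IsAlt (T x)) (hs : ∀ x, SmoothIn x T) : (ofComp hn w g T hT hs).comp g = T := by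
  have h : logFactor g g = 0 := (rescales_logFactor g g).unique hn (.refl g.1)
  conv_rhs => rw [← FormField.comp_ofComp hT]
  funext x i
  show Real.exp (w * logFactor g g x) * (FormField.ofComp T).comp x i = _
  simp [h]

end WeightedForm

/-- The variables of the prolonged system attached to a conformal Killing form. -/
def ProlongedTuple.ofConformalKilling {m : ℕ} {c : ConformalStructure n M} (hn : 0 < n)
    (g : c.metrics) (σ : WeightedForm c (m + 1) ((m : ℝ) + 2))
    (hσ : g.1.IsConformalKilling (σ.comp g)) : ProlongedTuple c m where
  sigma := σ
  mu := .ofComp hn _ g (g.1.muOf (σ.comp g)) (Metric.isAlt_muOf _)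
    fun x => Metric.smoothIn_muOf (σ.smoothIn_comp g x)
  nu := .ofComp hn _ g (g.1.nuOf (σ.comp g))
    (Metric.isAlt_nuOf (σ.isAlt_comp g) (σ.smoothIn_comp g))
    fun x => Metric.smoothIn_nuOf (σ.smoothIn_comp g x)
  rho := .ofComp hn _ g (g.1.rhoOf (σ.comp g)) (Metric.isAlt_rhoOf _)
    fun x => Metric.smoothIn_rhoOf (σ.smoothIn_comp g x) hσ

section

variable {m : ℕ} {c : ConformalStructure n M} (hn : 0 < n) (g : c.metrics)
  (σ : WeightedForm c (m + 1) ((m : ℝ) + 2)) (hσ : g.1.IsConformalKilling (σ.comp g))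

lemma ProlongedTuple.mu_ofConformalKilling :
    (ofConformalKilling hn g σ hσ).mu.comp g = g.1.muOf (σ.comp g) := by
  simp only [ofConformalKilling, WeightedForm.comp_ofComp]

lemma ProlongedTuple.nu_ofConformalKilling :
    (ofConformalKilling hn g σ hσ).nu.comp g = g.1.nuOf (σ.comp g) := by
  simp only [ofConformalKilling, WeightedForm.comp_ofComp]

lemma ProlongedTuple.rho_ofConformalKilling :
    (ofConformalKilling hn g σ hσ).rho.comp g = g.1.rhoOf (σ.comp g) := by
  simp only [ofConformalKilling, WeightedForm.comp_ofComp]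

end

/-- A solution of the prolonged system is determined by `σ`. -/
lemma Metric.IsProlongedSolution.eq_ofConformalKilling {m : ℕ} {c : ConformalStructure n M}
    {g : c.metrics} (hn : 3 ≤ n) (hk : m + 1 ≤ n - 1) {S : ProlongedTuple c m}
    (hS : g.1.IsProlongedSolution (S.sigma.comp g) (S.mu.comp g) (S.nu.comp g) (S.rho.comp g))
    (hn0 : 0 < n) (hσ : g.1.IsConformalKilling (S.sigma.comp g)) :
    ProlongedTuple.ofConformalKilling hn0 g S.sigma hσ = S := by
  obtain ⟨sigma, mu, nu, rho⟩ := S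
  have e1 := Metric.eq_muOf (mu.isAlt_comp g) hS.1
  have e2 := Metric.eq_nuOf hk (sigma.isAlt_comp g) (sigma.smoothIn_comp g) (mu.isAlt_comp g)
    (nu.isAlt_comp g) hS.1
  have e3 := Metric.eq_rhoOf hn hk (sigma.isAlt_comp g) (sigma.smoothIn_comp g)
    (rho.isAlt_comp g) hσ e2 hS.2.2.1
  unfold ProlongedTuple.ofConformalKilling
  congr 1
  · exact WeightedForm.ext_comp g ((WeightedForm.comp_ofComp ..).trans e1)
  · exact WeightedForm.ext_comp g ((WeightedForm.comp_ofComp ..).trans e2)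
  · exact WeightedForm.ext_comp g ((WeightedForm.comp_ofComp ..).trans e3)

end Weighted

end ConformalKilling

end

theorem mainTheorem2 {n m : ℕ} (hn : 3 ≤ n) (hk : m + 1 ≤ n - 1)
    {M : Type*} [TopologicalSpace M] [ChartedSpace (ConformalKilling.Coord n) M]
    [IsManifold (𝓡 n) ∞ M]
    (c : ConformalKilling.ConformalStructure n M) (g : c.metrics) :
    ∃ F : {σ : ConformalKilling.WeightedForm c (m + 1) ((m : ℝ) + 2) //
            g.1.IsConformalKilling (σ.comp g)} ≃
          {S : ConformalKilling.ProlongedTuple c m //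
            g.1.IsProlongedSolution (S.sigma.comp g) (S.mu.comp g) (S.nu.comp g) (S.rho.comp g)},
      ∀ σ, (F σ).1.sigma = σ.1 ∧
        (F σ).1.mu.comp g = g.1.muOf (σ.1.comp g) ∧
        (F σ).1.nu.comp g = g.1.nuOf (σ.1.comp g) ∧
        (F σ).1.rho.comp g = g.1.rhoOf (σ.1.comp g) := by
  have hn0 : 0 < n := by omega
  -- The inverse map merely forgets `μ`, `ν` and `ρ`. One composite is then the identity by
  -- definition, and the other is the uniqueness of the prolonged variables.
  refine ⟨⟨fun σ => ⟨.ofConformalKilling hn0 g σ.1 σ.2, ?_⟩, fun S => ⟨S.1.sigma,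
    S.2.isConformalKilling hk (S.1.sigma.isAlt_comp g) (S.1.sigma.smoothIn_comp g)
      (S.1.mu.isAlt_comp g) (S.1.nu.isAlt_comp g)⟩, fun σ => rfl, fun S => ?_⟩, fun σ => ?_⟩
  · rw [ConformalKilling.ProlongedTuple.mu_ofConformalKilling,
      ConformalKilling.ProlongedTuple.nu_ofConformalKilling,
      ConformalKilling.ProlongedTuple.rho_ofConformalKilling]
    exact σ.2.isProlongedSolution hn hk (σ.1.isAlt_comp g) (σ.1.smoothIn_comp g)
  · exact Subtype.ext (S.2.eq_ofConformalKilling hn hk hn0 (S.2.isConformalKilling hk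
      (S.1.sigma.isAlt_comp g) (S.1.sigma.smoothIn_comp g) (S.1.mu.isAlt_comp g)
      (S.1.nu.isAlt_comp g)))
  · exact ⟨rfl, ConformalKilling.ProlongedTuple.mu_ofConformalKilling hn0 g σ.1 σ.2,
      ConformalKilling.ProlongedTuple.nu_ofConformalKilling hn0 g σ.1 σ.2,
      ConformalKilling.ProlongedTuple.rho_ofConformalKilling hn0 g σ.1 σ.2⟩
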